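/- Let $m,n$ be positive integers, let $d$ be a positive divisor of $n$, and let $\lambda$ be a rectangular partition (all its positive parts are equal) with at most $mn$ positive parts. Notation. For a partition $\kappa$ with at most $s$ positive parts, $B_\kappa$ is the set of semistandard Young tableaux of shape $\kappa$ with entries in $\{1,\dots,s\}$. For $1\le i\le s-1$ and $T\in B_\kappa$, let $h_{i,c}(T)$ be the number of entries $i+1$ minus the number of entries $i$ in column $c$ or to the right, and let $k_{i,c}(T)$ be the number of entries $i$ minus the number of entries $i+1$ in column $c$ or to the left. The raising operator $e_i$ changes an $i+1$ into $i$ in the rightmost column $c$ for which $h_{i,c}(T)$ is maximal and positive, and $e_i(T)=0$ if there is no such column; the lowering operator $f_i$ changes an $i$ into $i+1$ in the leftmost column $c$ for which $k_{i,c}(T)$ is maximal and positive, and $f_i(T)=0$ if there is no such column. $\operatorname{Rect}$ is rectification by jeu de taquin. Demotion of $T\in B_\kappa$ empties the boxes containing $1$, lowers the other entries by $1$, rectifies, and fills the boxes of $\kappa$ outside the rectified shape with $s$; promotion $\operatorname{pr}$ is the inverse of this bijection $B_\kappa\to B_\kappa$. Take $s=mn$ for $B_\lambda$, and let $j=\operatorname{pr}^m$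 on $B_\lambda$. Regard $B_\lambda$ as an $(\mathfrak{sl}_m^{\oplus n})$-crystal by the operators $e_{km+i},f_{km+i}$ with $0\le k\le n-1$, $1\le i\le m-1$. Its connected components are those of the graph joining $T$ and $T'$ when one of these $e_{km+i}$ takes $T$ to $T'$ or $T'$ to $T$; an element is of highest weight if all these $e_{km+i}$ vanish at it. For $T\in B_\lambda$ and $0\le k\le n-1$, let $\varphi_k(T)$ be the skew tableau formed by the boxes of $T$ with entries in $\{km+1,\dots,(k+1)m\}$, with $km$ subtracted from every entry, and put $$\varphi(T)=(\operatorname{Rect}(\varphi_0(T)),\operatorname{Rect}(\varphi_1(T)),\dots,\operatorname{Rect}(\varphi_{n-1}(T)))$$ (here $\operatorname{Rect}(\varphi_0(T))=\varphi_0(T)$). For partitions $\beta_0,\dots,\beta_{n-1}$ with at most $m$ positive parts, $B_{(\beta_0,\dots,\beta_{n-1})}=B_{\beta_0}\times\cdots\times B_{\beta_{n-1}}$ (with $s=m$ for each factor) is an $(\mathfrak{sl}_m^{\oplus n})$-crystal in which $e_{km+i},f_{km+i}$ act as $e_i,f_i$ on the factor $B_{\beta_k}$ and fix the other factors; $b_\beta$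 is the tableau of shape $\beta$ and content $\beta$. An isomorphism of crystals is a bijection that commutes with all raising and lowering operators. Theorem. (1) For every $T\in B_\lambda$, $$\varphi(j^d(T))=(\operatorname{Rect}(\varphi_{n-d}(T)),\dots,\operatorname{Rect}(\varphi_{n-1}(T)),\operatorname{Rect}(\varphi_0(T)),\dots,\operatorname{Rect}(\varphi_{n-d-1}(T))).$$ (2) Let $\mathcal C$ be a connected component of the $(\mathfrak{sl}_m^{\oplus n})$-crystal $B_\lambda$. Then $\mathcal C$ has a unique highest weight element $b$. If $j^d(b)\ne b$, then $\{T\in\mathcal C: j^d(T)=T\}$ is empty. If $j^d(b)=b$, then there are $d$ partitions $\beta_0,\dots,\beta_{d-1}$, each with at most $m$ positive parts, such that, with $\beta_k:=\beta_{k \bmod d}$ for $0\le k\le n-1$, $\varphi(b)=(b_{\beta_0},b_{\beta_1},\dots,b_{\beta_{n-1}})$, and $\varphi$ restricts to an isomorphism of crystals $\mathcal C\to B_{(\beta_0,\beta_1,\dots,\beta_{n-1})}$ which in turn restricts to a bijection $$\{T\in\mathcal C: j^d(T)=T\}\to\{(U_0,\dots,U_{n-1})\in B_{(\beta_0,\dots,\beta_{n-1})}: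 U_k=U_{k'}\text{ whenever }k\equiv k' \ (\mathrm{mod}\ d)\}.$$ -/

import Mathlib

/-! Conventions: boxes are pairs `(row, column)` numbered from `0`, as in `YoungDiagram`; entries of
tableaux are positive integers, and the entry function of a (skew) tableau is `0` off its boxes. -/

/-- A partition is rectangular if all its positive parts are equal. -/
def IsRectangular (κ : YoungDiagram) : Prop :=
  ∀ i i' : ℕ, 0 < κ.rowLen i → 0 < κ.rowLen i' → κ.rowLen i = κ.rowLen i'

/-- The set `B_κ` of semistandard Young tableaux of shape `κ` with entries in `{1, …, s}`. -/
def Tab (κ : YoungDiagram) (s : ℕ) : Type :=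
  {T : SemistandardYoungTableau κ // ∀ i j, (i, j) ∈ κ → 1 ≤ T i j ∧ T i j ≤ s}

/-! ### Crystal operators -/

/-- The raising operators `e i` and lowering operators `f i` of a crystal with underlying set `X`,
simple roots indexed by `I`; `none` is the symbol `0`. -/
structure CrystalOps (I X : Type) where
  e : I → X → Option X
  f : I → X → Option X

namespace CrystalOps

variable {I X Y : Type}

/-- The underlying graph of a crystal: `b` and `b'` are joined if `e i b = b'` or `e i b' = b`. -/
def graph (A : CrystalOps I X) : SimpleGraph X :=
  SimpleGraph.fromRel fun b b' => ∃ i, A.e i b = some b'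

def IsHighestWeight (A : CrystalOps I X) (b : X) : Prop := ∀ i, A.e i b = none

/-- The bijection `Φ` from a connected component `C` of `A` to `A'` is an isomorphism of crystals:
on `C` one has `e i = Φ⁻¹ ∘ e i ∘ Φ` and `f i = Φ⁻¹ ∘ f i ∘ Φ` (where `Φ⁻¹ 0 = 0`). -/
def IsComponentIso (A : CrystalOps I X) (A' : CrystalOps I Y) (C : A.graph.ConnectedComponent)
    (Φ : C.supp ≃ Y) : Prop :=
  ∀ (i : I) (b : C.supp),
    A.e i b = (A'.e i (Φ b)).map (fun y => (Φ.symm y : X)) ∧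
    A.f i b = (A'.f i (Φ b)).map (fun y => (Φ.symm y : X))

end CrystalOps

namespace Tab

variable {κ : YoungDiagram} {s : ℕ}

/-- Number of occurrences of `a` in the columns of `T` whose index satisfies `P`. -/
def count (T : Tab κ s) (a : ℕ) (P : ℕ → Prop) [DecidablePred P] : ℕ :=
  (κ.cells.filter fun c => P c.2 ∧ T.1 c.1 c.2 = a).card

/-- Occurrences of `i + 1` minus occurrences of `i` in column `j` or to the right. -/
def h (T : Tab κ s) (i j : ℕ) : ℤ :=
  (T.count (i + 1) (fun c => j ≤ c) : ℤ) - T.count i (fun c => j ≤ c)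

/-- Occurrences of `i` minus occurrences of `i + 1` in column `j` or to the left. -/
def k (T : Tab κ s) (i j : ℕ) : ℤ :=
  (T.count i (fun c => c ≤ j) : ℤ) - T.count (i + 1) (fun c => c ≤ j)

/-- `j` is the rightmost column for which `h i j` is maximal, and this maximum is positive. -/
def IsRaisingColumn (T : Tab κ s) (i j : ℕ) : Prop :=
  0 < T.h i j ∧ (∀ j', T.h i j' ≤ T.h i j) ∧ ∀ j', j < j' → T.h i j' < T.h i j

/-- `j` is the leftmost column for which `k i j` is maximal, and this maximum is positive. -/
def IsLoweringColumn (T : Tab κ s) (i j : ℕ) : Prop :=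
  0 < T.k i j ∧ (∀ j', T.k i j' ≤ T.k i j) ∧ ∀ j', j' < j → T.k i j' < T.k i j

/-- The entries after each `a` in column `j` is replaced by `b`. -/
def replaceInColumn (T : Tab κ s) (j a b : ℕ) (r c : ℕ) : ℕ :=
  if c = j ∧ T.1 r c = a then b else T.1 r c

theorem mem_of_ne_zero (T : Tab κ s) {r c : ℕ} (hne : T.1 r c ≠ 0) : (r, c) ∈ κ := by
  by_contra hmem
  exact hne (T.1.zeros hmem)

theorem count_eq_zero (T : Tab κ s) {a j : ℕ} (hno : ∀ r, T.1 r j ≠ a) :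
    T.count a (fun c => c = j) = 0 := by
  unfold count
  rw [Finset.card_eq_zero, Finset.filter_eq_empty_iff]
  rintro ⟨r, c⟩ _ ⟨h1, h2⟩
  dsimp only at h1 h2
  subst h1
  exact hno r h2

theorem count_pos (T : Tab κ s) {a r j : ℕ} (ha : a ≠ 0) (hr : T.1 r j = a) :
    0 < T.count a (fun c => c = j) := by
  unfold count
  rw [Finset.card_pos]
  refine ⟨(r, j), ?_⟩
  simp only [Finset.mem_filter, YoungDiagram.mem_cells]
  exact ⟨T.mem_of_ne_zero (by omega), trivial, hr⟩

theorem count_le_one (T : Tab κ s) (a j : ℕ) : T.count a (fun c => c = j) ≤ 1 := by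
  unfold count
  rw [Finset.card_le_one]
  rintro ⟨r, c⟩ h1 ⟨r', c'⟩ h2
  simp only [Finset.mem_filter, YoungDiagram.mem_cells] at h1 h2
  obtain ⟨m1, rfl, e1⟩ := h1
  obtain ⟨m2, rfl, e2⟩ := h2
  rcases lt_trichotomy r r' with hlt | heq | hlt
  · have := T.1.col_strict hlt m2
    omega
  · rw [heq]
  · have := T.1.col_strict hlt m1
    omega

theorem count_split (T : Tab κ s) (a : ℕ) (P Q R : ℕ → Prop) [DecidablePred P] [DecidablePred Q]
    [DecidablePred R] (hPQR : ∀ c, P c ↔ Q c ∨ R c) (hdis : ∀ c, Q c → ¬ R c) :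
    T.count a P = T.count a Q + T.count a R := by
  unfold count
  rw [← Finset.card_union_of_disjoint]
  · congr 1
    ext x
    simp only [Finset.mem_filter, Finset.mem_union, hPQR]
    tauto
  · rw [Finset.disjoint_filter]
    intro x _ h1 h2
    exact hdis _ h1.1 h2.1

theorem h_succ (T : Tab κ s) (i j : ℕ) :
    T.h i j = T.h i (j + 1) + T.count (i + 1) (fun c => c = j) - T.count i (fun c => c = j) := by
  unfold h
  rw [T.count_split (i + 1) (fun c => j ≤ c) (fun c => j + 1 ≤ c) (fun c => c = j)
      (by intro c; omega) (by intro c; omega),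
    T.count_split i (fun c => j ≤ c) (fun c => j + 1 ≤ c) (fun c => c = j)
      (by intro c; omega) (by intro c; omega)]
  push_cast
  ring

theorem k_succ (T : Tab κ s) (i j : ℕ) :
    T.k i (j + 1) = T.k i j + T.count i (fun c => c = j + 1)
      - T.count (i + 1) (fun c => c = j + 1) := by
  unfold k
  rw [T.count_split (i + 1) (fun c => c ≤ j + 1) (fun c => c ≤ j) (fun c => c = j + 1)
      (by intro c; omega) (by intro c; omega),
    T.count_split i (fun c => c ≤ j + 1) (fun c => c ≤ j) (fun c => c = j + 1)
      (by intro c; omega) (by intro c; omega)]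
  push_cast
  ring

theorem k_zero (T : Tab κ s) (i : ℕ) :
    T.k i 0 = T.count i (fun c => c = 0) - T.count (i + 1) (fun c => c = 0) := by
  simp [k]

/-- Changing the `i + 1` in the raising column to `i` yields a semistandard tableau. -/
def raiseAt (T : Tab κ s) (i j : ℕ) (hi : 1 ≤ i) (hs : i + 1 ≤ s) (hj : T.IsRaisingColumn i j) :
    Tab κ s :=
  have hA : ∀ r, T.1 r j ≠ i := by
    intro r hr
    have h1 := T.h_succ i j
    have h2 := hj.2.2 (j + 1) (by omega)
    have h3 := T.count_pos (by omega) hr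
    have h4 := T.count_le_one (i + 1) j
    omega
  have hB : ∀ r j', j' + 1 = j → T.1 r j = i + 1 → T.1 r j' ≠ i + 1 := by
    rintro r j' rfl hr hr'
    have h1 := T.h_succ i j'
    have h2 := hj.2.1 j'
    have h3 := T.count_pos (by omega) hr'
    have h4 : ∃ r', T.1 r' j' = i := by
      by_contra hno
      have := T.count_eq_zero (a := i) (j := j') (fun r' hr' => hno ⟨r', hr'⟩)
      omega
    obtain ⟨r', h5⟩ := h4
    have m1 : (r', j') ∈ κ := T.mem_of_ne_zero (by omega)
    have m2 : (r, j' + 1) ∈ κ := T.mem_of_ne_zero (by omega)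
    have hlt : r' < r := by
      by_contra hge
      have := T.1.col_weak (not_lt.mp hge) m1
      omega
    have m3 : (r', j' + 1) ∈ κ := κ.up_left_mem hlt.le le_rfl m2
    have h6 := T.1.row_weak (Nat.lt_succ_self j') m3
    have h7 := T.1.col_strict hlt m2
    have h8 := hA r'
    simp only [Nat.succ_eq_add_one] at h6
    omega
  ⟨{ entry := T.replaceInColumn j (i + 1) i
     row_weak' := by
       intro r j1 j2 hlt hm
       have hw := T.1.row_weak hlt hm
       unfold replaceInColumn
       split_ifs with c1 c2 c2
       · omega
       · omega
       · obtain ⟨rfl, h2⟩ := c2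
         obtain ⟨j', rfl⟩ : ∃ j', j2 = j' + 1 := ⟨j2 - 1, by omega⟩
         have h3 := hB r j' rfl h2
         have m : (r, j') ∈ κ := κ.up_left_mem le_rfl (Nat.le_succ j') hm
         have h4 := T.1.row_weak_of_le (show j1 ≤ j' by omega) m
         have h5 := T.1.row_weak (Nat.lt_succ_self j') hm
         simp only [Nat.succ_eq_add_one] at h5
         omega
       · exact hw
     col_strict' := by
       intro r1 r2 c hlt hm
       have hw := T.1.col_strict hlt hm
       unfold replaceInColumn
       split_ifs with c1 c2 c2
       · omega
       · omega
       · obtain ⟨rfl, h2⟩ := c2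
         have := hA r1
         omega
       · exact hw
     zeros' := by
       intro r c hm
       have := T.1.zeros hm
       unfold replaceInColumn
       rw [if_neg (by omega), this] },
   by
     intro r c hm
     have := T.2 r c hm
     change 1 ≤ T.replaceInColumn j (i + 1) i r c ∧ T.replaceInColumn j (i + 1) i r c ≤ s
     unfold replaceInColumn
     split_ifs <;> omega⟩

/-- Changing the `i` in the lowering column to `i + 1` yields a semistandard tableau. -/
def lowerAt (T : Tab κ s) (i j : ℕ) (hi : 1 ≤ i) (hs : i + 1 ≤ s) (hj : T.IsLoweringColumn i j) :
    Tab κ s :=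
  have hA : ∀ r, T.1 r j ≠ i + 1 := by
    intro r hr
    have h3 := T.count_pos (by omega) hr
    have h4 := T.count_le_one i j
    rcases j with _ | j
    · have h1 := T.k_zero i
      have h2 := hj.1
      omega
    · have h1 := T.k_succ i j
      have h2 := hj.2.2 j (by omega)
      omega
  have hB : ∀ r, T.1 r j = i → T.1 r (j + 1) ≠ i := by
    intro r hr hr'
    have h1 := T.k_succ i j
    have h2 := hj.2.1 (j + 1)
    have h3 := T.count_pos (by omega) hr'
    have h4 : ∃ r', T.1 r' (j + 1) = i + 1 := by
      by_contra hno
      have := T.count_eq_zero (a := i + 1) (j := j + 1) (fun r' hr' => hno ⟨r', hr'⟩)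
      omega
    obtain ⟨r', h5⟩ := h4
    have m1 : (r', j + 1) ∈ κ := T.mem_of_ne_zero (by omega)
    have m2 : (r, j + 1) ∈ κ := T.mem_of_ne_zero (by omega)
    have hlt : r < r' := by
      by_contra hge
      have := T.1.col_weak (not_lt.mp hge) m2
      omega
    have m3 : (r', j) ∈ κ := κ.up_left_mem le_rfl (Nat.le_succ j) m1
    have h6 := T.1.row_weak (Nat.lt_succ_self j) m1
    have h7 := T.1.col_strict hlt m3
    have h8 := hA r'
    simp only [Nat.succ_eq_add_one] at h6
    omega
  ⟨{ entry := T.replaceInColumn j i (i + 1)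
     row_weak' := by
       intro r j1 j2 hlt hm
       have hw := T.1.row_weak hlt hm
       unfold replaceInColumn
       split_ifs with c1 c2 c2
       · omega
       · obtain ⟨rfl, h2⟩ := c1
         have h3 := hB r h2
         have m : (r, j1 + 1) ∈ κ := κ.up_left_mem le_rfl hlt hm
         have h4 := T.1.row_weak_of_le (show j1 + 1 ≤ j2 by omega) hm
         have h5 := T.1.row_weak (Nat.lt_succ_self j1) m
         simp only [Nat.succ_eq_add_one] at h5
         omega
       · omega
       · exact hw
     col_strict' := by
       intro r1 r2 c hlt hm
       have hw := T.1.col_strict hlt hm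
       unfold replaceInColumn
       split_ifs with c1 c2 c2
       · omega
       · obtain ⟨rfl, h2⟩ := c1
         have := hA r2
         omega
       · omega
       · exact hw
     zeros' := by
       intro r c hm
       have := T.1.zeros hm
       unfold replaceInColumn
       rw [if_neg (by omega), this] },
   by
     intro r c hm
     have := T.2 r c hm
     change 1 ≤ T.replaceInColumn j i (i + 1) r c ∧ T.replaceInColumn j i (i + 1) r c ≤ s
     unfold replaceInColumn
     split_ifs <;> omega⟩

open Classical in
/-- The raising operator `e_i` on `B_κ`, for `1 ≤ i ≤ s - 1` (and `0` for other `i`). -/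
noncomputable def raise (i : ℕ) (T : Tab κ s) : Option (Tab κ s) :=
  if H : (1 ≤ i ∧ i + 1 ≤ s) ∧ ∃ j, T.IsRaisingColumn i j then
    some (T.raiseAt i H.2.choose H.1.1 H.1.2 H.2.choose_spec)
  else none

open Classical in
/-- The lowering operator `f_i` on `B_κ`, for `1 ≤ i ≤ s - 1` (and `0` for other `i`). -/
noncomputable def lower (i : ℕ) (T : Tab κ s) : Option (Tab κ s) :=
  if H : (1 ≤ i ∧ i + 1 ≤ s) ∧ ∃ j, T.IsLoweringColumn i j then
    some (T.lowerAt i H.2.choose H.1.1 H.1.2 H.2.choose_spec)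
  else none

end Tab

/-- The operators of the `sl_m^{⊕ n}`-crystal `B_lam`, where `lam` has `m * n` parts: the simple
root `(k, i)`, with `k = 0, …, n - 1` and `i = 0, …, m - 2`, carries the operators
`e_{km+i+1}` and `f_{km+i+1}`. -/
noncomputable def blockCrystal (lam : YoungDiagram) (m n : ℕ) :
    CrystalOps (Fin n × Fin (m - 1)) (Tab lam (m * n)) where
  e a T := T.raise (a.1 * m + a.2 + 1)
  f a T := T.lower (a.1 * m + a.2 + 1)

/-- The operators of the `sl_m^{⊕ n}`-crystal `B_{β 0} × ⋯ × B_{β (n-1)}`: those of the simple root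
`(k, i)` act by the `sl_m`-operators `e_{i+1}` and `f_{i+1}` on the `k`th factor and fix the other
factors. -/
noncomputable def productCrystal (m : ℕ) {n : ℕ} (β : Fin n → YoungDiagram) :
    CrystalOps (Fin n × Fin (m - 1)) (∀ k, Tab (β k) m) where
  e a U := ((U a.1).raise (a.2 + 1)).map (Function.update U a.1)
  f a U := ((U a.1).lower (a.2 + 1)).map (Function.update U a.1)

/-! ### Jeu de taquin -/

/-- A filling of a skew diagram `κ / ι`; the field `shape` is the outer diagram `κ`, and `ι` is
specified separately. Fillings with `ι` empty are compared as a whole (shape and entries). -/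
structure Filling where
  shape : YoungDiagram
  entry : ℕ → ℕ → ℕ

/-- Remove an outside corner from a Young diagram. -/
def eraseCorner (κ : YoungDiagram) (r c : ℕ) (hb : (r + 1, c) ∉ κ) (hr : (r, c + 1) ∉ κ) :
    YoungDiagram where
  cells := κ.cells.erase (r, c)
  isLowerSet := by
    rintro ⟨a, b⟩ ⟨a', b'⟩ hle hm
    have hle' : a' ≤ a ∧ b' ≤ b := hle
    simp only [Finset.coe_erase, Set.mem_sdiff, Finset.mem_coe, YoungDiagram.mem_cells,
      Set.mem_singleton_iff] at hm ⊢
    refine ⟨κ.up_left_mem hle'.1 hle'.2 hm.1, ?_⟩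
    intro heq
    obtain ⟨rfl, rfl⟩ := Prod.mk.inj heq
    rcases Nat.lt_or_ge a' a with h1 | h1
    · exact hb (κ.up_left_mem h1 hle'.2 hm.1)
    · have h2 : a = a' := le_antisymm h1 hle'.1
      rcases Nat.lt_or_ge b' b with h3 | h3
      · exact hr (κ.up_left_mem hle'.1 h3 hm.1)
      · exact hm.2 (by rw [h2, le_antisymm h3 hle'.2])

/-- The entries after the entry of the box `(r, c)` is set to `v`. -/
def setEntry (T : ℕ → ℕ → ℕ) (r c v : ℕ) (i j : ℕ) : ℕ :=
  if i = r ∧ j = c then v else T i j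

theorem lt_sup_of_mem {κ : YoungDiagram} {r c : ℕ} (hm : (r, c) ∈ κ) :
    r + c ≤ κ.cells.sup fun x => x.1 + x.2 :=
  Finset.le_sup (f := fun x : ℕ × ℕ => x.1 + x.2) ((YoungDiagram.mem_cells _).mpr hm)

/-- A jeu-de-taquin slide on a filling with outer diagram `κ`, where `(r, c)` is the empty box: the
entry below slides into it if it is at most the entry to the right or if there is no box to the
right, otherwise the entry to the right does; this goes on until the empty box is an outside
corner, which is then removed. -/
def slide (κ : YoungDiagram) (T : ℕ → ℕ → ℕ) (r c : ℕ) : Filling :=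
  if hb : (r + 1, c) ∈ κ ∧ ((r, c + 1) ∈ κ → T (r + 1) c ≤ T r (c + 1)) then
    slide κ (setEntry T r c (T (r + 1) c)) (r + 1) c
  else if hr : (r, c + 1) ∈ κ then
    slide κ (setEntry T r c (T r (c + 1))) r (c + 1)
  else
    ⟨eraseCorner κ r c (fun hm => hb ⟨hm, fun hm' => absurd hm' hr⟩) hr, setEntry T r c 0⟩
termination_by (κ.cells.sup fun x => x.1 + x.2) - (r + c)
decreasing_by
  · have := lt_sup_of_mem hb.1
    omega
  · have := lt_sup_of_mem hr
    omega

/-- The boxes of `ι` from the bottom row to the top row, each row from right to left. Each box is a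
corner of the diagram that remains when the boxes before it are removed. -/
def cornerSequence (ι : YoungDiagram) : List (ℕ × ℕ) :=
  (List.range (ι.colLen 0)).reverse.flatMap fun r =>
    (List.range (ι.rowLen r)).reverse.map fun c => (r, c)

/-- The rectification of a filling `F` of a skew diagram with inner diagram `ι`: slides are
performed from inside corners until the inner diagram is empty. (The result does not depend on the
order in which the inside corners are chosen; here it is that of `cornerSequence`.) -/
def rect (ι : YoungDiagram) (F : Filling) : Filling :=
  (cornerSequence ι).foldl (fun G x => slide G.shape G.entry x.1 x.2) F

namespace Tab

variable {κ : YoungDiagram} {s : ℕ}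

def toFilling (T : Tab κ s) : Filling := ⟨κ, T.1⟩

/-- The boxes of `T` with entry at most `a`. -/
def shapeLE (T : Tab κ s) (a : ℕ) : YoungDiagram where
  cells := κ.cells.filter fun x => T.1 x.1 x.2 ≤ a
  isLowerSet := by
    rintro ⟨i, j⟩ ⟨i', j'⟩ hle hm
    have hle' : i' ≤ i ∧ j' ≤ j := hle
    simp only [Finset.coe_filter, YoungDiagram.mem_cells, Set.mem_ofPred_eq] at hm ⊢
    have m1 : (i', j) ∈ κ := κ.up_left_mem hle'.1 le_rfl hm.1
    exact ⟨κ.up_left_mem hle'.1 hle'.2 hm.1,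
      (T.1.row_weak_of_le hle'.2 m1).trans ((T.1.col_weak hle'.1 hm.1).trans hm.2)⟩

/-! ### Promotion -/

/-- The entries of the jeu-de-taquin demotion of `T`: the boxes containing `1` are emptied, the
other entries are decremented by `1`, the resulting skew tableau is rectified, and the boxes of `κ`
outside the shape of the rectification are filled with `s`. -/
def demotionEntry (T : Tab κ s) (i j : ℕ) : ℕ :=
  let R := rect (T.shapeLE 1) ⟨κ, fun r c => T.1 r c - 1⟩
  if (i, j) ∈ R.shape then R.entry i j else if (i, j) ∈ κ then s else 0

open Classical in
/-- Jeu-de-taquin promotion on `B_κ`: it sends `U` to the tableau `T` whose demotion is `U`.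
(Demotion is a bijection of `B_κ`, so there is exactly one such `T`.) -/
noncomputable def promotion (U : Tab κ s) : Tab κ s :=
  if H : ∃ T : Tab κ s, T.demotionEntry = U.1 then H.choose else U

/-- The action of `j`: `m` iterations of promotion. -/
noncomputable def blockPromotion (m : ℕ) : Tab κ s → Tab κ s := promotion^[m]

/-! ### Blocks -/

/-- The skew tableau `φ_k(T)` formed by the boxes with entry in `{km + 1, …, (k + 1)m}`, the
entries being lowered by `km`. Its inner diagram is `T.shapeLE (k * m)`. -/
def block (T : Tab κ s) (m k : ℕ) : Filling where
  shape := T.shapeLE ((k + 1) * m)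
  entry i j := if k * m < T.1 i j ∧ T.1 i j ≤ (k + 1) * m then T.1 i j - k * m else 0

/-- The tuple `φ(T) = (Rect φ_0(T), …, Rect φ_{n-1}(T))`. (The skew tableau `φ_0(T)` has empty inner
diagram and equals its rectification.) -/
def blocks (m n : ℕ) (T : Tab κ s) : Fin n → Filling :=
  fun k => rect (T.shapeLE (k * m)) (T.block m k)

end Tab

/-- The tableau `b_β` of shape `β` and content `β`: all entries of its `i`th row from the top (with
`i = 1, 2, …`) are `i`. -/
def highestFilling (β : YoungDiagram) : Filling where
  shape := β
  entry i j := if (i, j) ∈ β then i + 1 else 0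

/-! ### Tuples -/

/-- `(x_{n-d}, …, x_{n-1}, x_0, …, x_{n-d-1})`, for `d ≤ n`. -/
def cyclicShift {X : Type} {n : ℕ} (d : ℕ) (x : Fin n → X) : Fin n → X :=
  fun k => x ⟨(k + (n - d)) % n, Nat.mod_lt _ k.pos⟩

/-- The `n`-tuple `(x_0, …, x_{d-1}, x_0, …, x_{d-1}, …)`. -/
def periodicTuple {X : Type} {d : ℕ} (hd : 0 < d) (n : ℕ) (x : Fin d → X) : Fin n → X :=
  fun k => x ⟨k % d, Nat.mod_lt _ hd⟩

/-!
A (skew) tableau is encoded by its Gelfand–Tsetlin pattern: the sequence of diagrams formed by the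
boxes with entry at most `k`, given by their row lengths (`IsPattern`, `Represents`). In this
language a raising operator changes one diagram by one box, in the first row in which a certain
height function is maximal (`RaisesTo`, `Tab.raise_eq_some_iff`), and a jeu-de-taquin slide removes
one box from each diagram, in a row found by a local rule (`slidePattern`, `Represents.slide`).

Four facts about patterns carry the proof.

* Slides commute with the raising operators and neither create nor destroy their zeros, and a raising
  operator does not change the row in which a slide ends, except at the level that it modifies
  (`RaisesTo.slides`, `exists_raisesTo_of_slides`, `exists_raisesTo_left_of_slides`).
* Slides are reversible: the pattern is determined by the result and by the rows in which the slides
  end (`slides_injective`).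
* A highest weight pattern that begins with the empty diagram is determined by its content, and also
  by its last diagram (`highest_unique`, `highest_unique_of_shape`).
* Lowering operators are partial inverses of raising operators (`Tab.lower_eq_some_iff`).

By the first, demotion turns `e_{i+1}` into `e_i`. For a rectangular tableau with entries at
most `s`, two demotions moreover turn `e_1` into `e_{s-1}` (`Tab.raise_demote_demote`): as both sides
commute with `e_3, …, e_{s-1}`, it suffices to check this where these operators vanish, and there
the shape is so rigid that everything is explicit (`highest_rectangle`, `Tab.doubleDemotion`). Hence
`m` demotions rotate the operators of the `n` blocks (`Tab.raise_blockDemotion`). They also rotate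
the content. Since the raising operators of a block act on its rectification, descending induction
from the highest weight shows that `m` demotions rotate the rectified blocks
(`Tab.blockRect_demote`), which is the assertion about `φ(j^d(T))`.

On a connected component of the block crystal, the inner diagrams of the blocks, the rows in which
the slides of their rectifications end and the shapes of the rectifications are constant. So `φ` is
injective on the component by reversibility, which together with the uniqueness of highest weight
patterns gives the uniqueness of the highest weight element; `φ` is onto the product of crystals
because raising operators can be undone before rectification when they can be undone after it
(`surjective_component`). Finally `j^d` permutes the components and preserves highest weights, so
that it maps a component to itself as soon as it fixes one of its elements, and then fixes the
highest weight element; on such a component its fixed points are the tableaux for which `φ(T)` is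
invariant under the cyclic shift.
-/

/-! ### Interlacing patterns -/

/-- An interlacing (Gelfand–Tsetlin type) pattern with at most `N` nonzero rows: `x k r` is the
length of row `r` of the `k`th diagram of a chain in which consecutive diagrams differ by a
horizontal strip. A (skew) tableau corresponds to the pattern in which the `k`th diagram consists of
the boxes with entry at most `k`, the boxes of the inner diagram counting as entries `0`. -/
structure IsPattern (N : ℕ) (x : ℕ → ℕ → ℕ) : Prop where
  le_succ : ∀ k r, x k r ≤ x (k + 1) r
  succ_le : ∀ k r, x (k + 1) (r + 1) ≤ x k r
  zero : ∀ k r, N ≤ r → x k r = 0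

/-- The row `p` increased by one. -/
def incRow (A : ℕ → ℕ) (p : ℕ) : ℕ → ℕ := fun t => if t = p then A t + 1 else A t

/-- The row `p` decreased by one. -/
def decRow (A : ℕ → ℕ) (p : ℕ) : ℕ → ℕ := fun t => if t = p then A t - 1 else A t

/-- For consecutive diagrams `A ⊆ B ⊆ C` of a pattern, with entries `i` in `B / A` and `i + 1` in
`C / B`: the number of `i + 1` in the rows up to `p` minus the number of `i` in the rows
above `p`. -/
def height (A B C : ℕ → ℕ) : ℕ → ℤ
  | 0 => (C 0 : ℤ) - B 0
  | p + 1 => height A B C p + ((C (p + 1) : ℤ) - B (p + 1)) - ((B p : ℤ) - A p)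

/-- `p` is the first place where `g` is maximal, and this maximum is positive. -/
def IsFirstMax (g : ℕ → ℤ) (p : ℕ) : Prop :=
  0 < g p ∧ (∀ q, g q ≤ g p) ∧ ∀ q, q < p → g q < g p

/-- `p` is the last place where `g` is maximal. -/
def IsLastMax (g : ℕ → ℤ) (p : ℕ) : Prop :=
  (∀ q, g q ≤ g p) ∧ ∀ q, p < q → g q < g p

theorem IsFirstMax.unique {g : ℕ → ℤ} {p q : ℕ} (hp : IsFirstMax g p) (hq : IsFirstMax g q) :
    p = q := by
  rcases lt_trichotomy p q with h | h | h
  · have := hq.2.2 p h; have := hp.2.1 q; omega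
  · exact h
  · have := hp.2.2 q h; have := hq.2.1 p; omega

theorem IsLastMax.unique {g : ℕ → ℤ} {p q : ℕ} (hp : IsLastMax g p) (hq : IsLastMax g q) :
    p = q := by
  rcases lt_trichotomy p q with h | h | h
  · have := hp.2 q h; have := hq.1 p; omega
  · exact h
  · have := hq.2 p h; have := hp.1 q; omega

theorem exists_isFirstMax {g : ℕ → ℤ} {M : ℕ} (hM : ∀ q, M ≤ q → g q ≤ g M) {q : ℕ}
    (hq : 0 < g q) : ∃ p, IsFirstMax g p := by
  classical
  obtain ⟨p₀, -, hp₀⟩ := Finset.exists_max_image (Finset.range (M + 1)) g ⟨0, by simp⟩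
  have hmax : ∀ q, g q ≤ g p₀ := by
    intro q
    rcases Nat.lt_or_ge q (M + 1) with h | h
    · exact hp₀ q (by simpa using h)
    · exact (hM q (by omega)).trans (hp₀ M (by simp))
  have hex : ∃ p, ∀ q, g q ≤ g p := ⟨p₀, hmax⟩
  refine ⟨Nat.find hex, ?_, Nat.find_spec hex, ?_⟩
  · have := Nat.find_spec hex q; omega
  · intro q hqp
    have h1 := Nat.find_min hex hqp
    push Not at h1
    obtain ⟨t, ht⟩ := h1
    have := Nat.find_spec hex t
    omega

theorem exists_isLastMax {g : ℕ → ℤ} {M p : ℕ} (hM : ∀ q, M ≤ q → g q < g p) :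
    ∃ p, IsLastMax g p := by
  classical
  obtain ⟨p₀, -, hp₀⟩ := Finset.exists_max_image (Finset.range (M + p + 1)) g ⟨0, by simp⟩
  have hp : g p ≤ g p₀ := hp₀ p (by simp)
  have hmax : ∀ q, g q ≤ g p₀ := by
    intro q
    rcases Nat.lt_or_ge q M with h | h
    · exact hp₀ q (by simp; omega)
    · exact (hM q h).le.trans hp
  set S := (Finset.range (M + p + 1)).filter fun q => g q = g p₀ with hS
  have hmem : ∀ q, g q = g p₀ → q ∈ S := by
    intro q hq
    have : ¬ M ≤ q := fun h => by have := hM q h; omega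
    simp [hS, hq]; omega
  refine ⟨S.max' ⟨p₀, hmem p₀ rfl⟩, ?_⟩
  have h1 : g (S.max' ⟨p₀, hmem p₀ rfl⟩) = g p₀ :=
    (Finset.mem_filter.mp (S.max'_mem ⟨p₀, hmem p₀ rfl⟩)).2
  refine ⟨fun q => (hmax q).trans h1.ge, fun q hq => ?_⟩
  rw [h1]
  refine lt_of_le_of_ne (hmax q) fun h => ?_
  have := S.le_max' q (hmem q h)
  omega

theorem height_eq_sum (A B C : ℕ → ℕ) (p : ℕ) :
    height A B C p = ∑ t ∈ Finset.range (p + 1), ((C t : ℤ) - B t)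
      - ∑ t ∈ Finset.range p, ((B t : ℤ) - A t) := by
  induction p with
  | zero => simp [height]
  | succ p ih =>
    rw [height, ih, Finset.sum_range_succ _ (p + 1),
      Finset.sum_range_succ (fun t => (B t : ℤ) - A t) p]
    ring

theorem cast_incRow (A : ℕ → ℕ) (p t : ℕ) :
    (incRow A p t : ℤ) = A t + if t = p then 1 else 0 := by
  unfold incRow
  split_ifs <;> push_cast <;> ring

theorem cast_decRow {A : ℕ → ℕ} {p : ℕ} (hA : 0 < A p) (t : ℕ) :
    (decRow A p t : ℤ) = A t - if t = p then 1 else 0 := by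
  unfold decRow
  split_ifs with h
  · subst h; omega
  · ring

theorem height_incRow (A B C : ℕ → ℕ) (p q : ℕ) :
    height A (incRow B p) C q =
      height A B C q - (if p ≤ q then 1 else 0) - (if p < q then 1 else 0) := by
  induction q with
  | zero =>
    rw [height, height, cast_incRow]
    split_ifs <;> omega
  | succ q ih =>
    rw [height, height, ih, cast_incRow, cast_incRow]
    split_ifs <;> omega

theorem height_decRow {A B C : ℕ → ℕ} {a b c : ℕ} (ha : 0 < A a) (hb : 0 < B b) (hc : 0 < C c)
    (p : ℕ) :
    height (decRow A a) (decRow B b) (decRow C c) p =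
      height A B C p - (if c ≤ p then 1 else 0) + (if b ≤ p then 1 else 0)
        + (if b < p then 1 else 0) - (if a < p then 1 else 0) := by
  induction p with
  | zero =>
    rw [height, height, cast_decRow hb, cast_decRow hc]
    simp only [Nat.le_zero, Nat.not_lt_zero, if_false, eq_comm (a := 0)]
    ring
  | succ p ih =>
    have e1 : ∀ u : ℕ, (if u ≤ p + 1 then (1 : ℤ) else 0) =
        (if u ≤ p then 1 else 0) + if p + 1 = u then 1 else 0 := by
      intro u; split_ifs <;> omega
    have e2 : ∀ u : ℕ, (if u < p + 1 then (1 : ℤ) else 0) =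
        (if u < p then 1 else 0) + if p = u then 1 else 0 := by
      intro u; split_ifs <;> omega
    rw [height, height, ih, cast_decRow hb, cast_decRow hc, cast_decRow hb, cast_decRow ha,
      e1, e1, e2, e2]
    ring

/-- Three consecutive diagrams of a pattern. -/
structure Interlace3 (A B C : ℕ → ℕ) : Prop where
  hAB : ∀ r, A r ≤ B r
  hBC : ∀ r, B r ≤ C r
  hBA : ∀ r, B (r + 1) ≤ A r
  hCB : ∀ r, C (r + 1) ≤ B r

/-- A slide that vacates the last box of row `r` of `A` vacates the last box of this row of the next
diagram `B`: if the box below the hole belongs to `B`, the hole moves down to it, and otherwise it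
moves to the end of its row of `B`. -/
def nextRow (A B : ℕ → ℕ) (r : ℕ) : ℕ := if B (r + 1) = A r then r + 1 else r

theorem nextRow_of_eq {A B : ℕ → ℕ} {r : ℕ} (h : B (r + 1) = A r) : nextRow A B r = r + 1 :=
  if_pos h

theorem nextRow_of_ne {A B : ℕ → ℕ} {r : ℕ} (h : B (r + 1) ≠ A r) : nextRow A B r = r :=
  if_neg h

theorem incRow_of_ne {A : ℕ → ℕ} {p t : ℕ} (h : t ≠ p) : incRow A p t = A t := if_neg h

/-- Raising row `p` is possible at the first maximum of the height. -/
theorem Interlace3.room {A B C : ℕ → ℕ} (h : Interlace3 A B C) {p : ℕ}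
    (hp : IsFirstMax (height A B C) p) : B p < C p ∧ ∀ q, p = q + 1 → B p < A q := by
  rcases p with _ | q
  · have := hp.1
    simp only [height] at this
    exact ⟨by omega, by omega⟩
  · have h1 := hp.2.2 q (by omega)
    simp only [height] at h1
    have h2 := h.hAB q; have h3 := h.hCB q
    refine ⟨by omega, ?_⟩
    rintro q' hq
    obtain rfl : q = q' := by omega
    omega

/-- Lowering row `p` is possible at the last maximum of the height. -/
theorem Interlace3.room_last {A B C : ℕ → ℕ} (h : Interlace3 A B C) {p : ℕ}
    (hp : IsLastMax (height A B C) p) : A p < B p ∧ C (p + 1) < B p := by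
  have h1 := hp.2 (p + 1) (by omega)
  simp only [height] at h1
  have h2 := h.hBC (p + 1); have h3 := h.hBA p
  omega

/-- The row raised is recovered as the last maximum of the height of the result. -/
theorem isLastMax_incRow {A B C : ℕ → ℕ} {p : ℕ} (hp : IsFirstMax (height A B C) p) :
    IsLastMax (height A (incRow B p) C) p := by
  refine ⟨fun q => ?_, fun q hq => ?_⟩
  · rw [height_incRow, height_incRow]
    have h1 := hp.2.1 q
    have h2 := hp.2.2 q
    split_ifs <;> omega
  · rw [height_incRow, height_incRow]
    have h1 := hp.2.1 q
    split_ifs <;> omega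

theorem isFirstMax_of_isLastMax_incRow {A B C : ℕ → ℕ} {p : ℕ}
    (h0 : incRow B p 0 ≤ C 0)
    (hp : IsLastMax (height A (incRow B p) C) p) : IsFirstMax (height A B C) p := by
  have key := height_incRow A B C p
  refine ⟨?_, fun q => ?_, fun q hq => ?_⟩
  · have h1 := hp.1 0
    have h2 : 0 ≤ height A (incRow B p) C 0 := by simp only [height]; omega
    have h3 := key p
    simp only [le_refl, if_true, lt_irrefl, if_false] at h3
    omega
  · have h1 := hp.1 q; have h2 := hp.2 q
    rw [key, key] at h1 h2
    split_ifs at h1 h2 <;> omega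
  · have h1 := hp.1 q
    rw [key, key] at h1
    split_ifs at h1 <;> omega

/-! ### One slide through two consecutive strips -/

theorem nextRow_corner {A B : ℕ → ℕ} (hAB : ∀ r, A r ≤ B r) (hBA : ∀ r, B (r + 1) ≤ A r) {r : ℕ}
    (hr : A (r + 1) < A r) : B (nextRow A B r + 1) < B (nextRow A B r) := by
  unfold nextRow
  have h1 := hAB r; have h2 := hBA r; have h3 := hBA (r + 1)
  split_ifs <;> omega

/-- A slide through the strips `B / A` and `C / B` changes the height at one place at most, where
the height was not maximal before or is not maximal afterwards. -/
theorem height_slide {A B C : ℕ → ℕ} (h : Interlace3 A B C) {r r' r'' : ℕ}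
    (hr : A (r + 1) < A r) (h' : r' = nextRow A B r) (h'' : r'' = nextRow B C r') :
    (∀ p, height (decRow A r) (decRow B r') (decRow C r'') p = height A B C p) ∨
    (r' = r + 1 ∧ r'' = r + 1 ∧ height A B C (r + 1) ≤ height A B C r ∧
      ∀ p, height (decRow A r) (decRow B r') (decRow C r'') p =
        height A B C p - if p = r + 1 then 1 else 0) ∨
    (r' = r ∧ r'' = r + 1 ∧ height A B C r + 1 ≤ height A B C (r + 1) ∧
      ∀ p, height (decRow A r) (decRow B r') (decRow C r'') p =
        height A B C p + if p = r then 1 else 0) := by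
  have hr' : B (r' + 1) < B r' := h' ▸ nextRow_corner h.hAB h.hBA hr
  have hr'' : C (r'' + 1) < C r'' := h'' ▸ nextRow_corner h.hBC h.hCB hr'
  have key := height_decRow (A := A) (B := B) (C := C) (a := r) (b := r') (c := r'')
    (by omega) (by omega) (by omega)
  have hs : height A B C (r + 1) = height A B C r + ((C (r + 1) : ℤ) - B (r + 1))
    - ((B r : ℤ) - A r) := rfl
  have h1 := h.hBA r; have h2 := h.hCB r
  unfold nextRow at h' h''
  by_cases c1 : B (r + 1) = A r
  · rw [if_pos c1] at h'
    subst h'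
    by_cases c2 : C (r + 1 + 1) = B (r + 1)
    · rw [if_pos c2] at h''
      subst h''
      left
      intro p; rw [key p]; split_ifs <;> omega
    · rw [if_neg c2] at h''
      subst h''
      right; left
      refine ⟨rfl, rfl, by omega, fun p => ?_⟩
      rw [key p]; split_ifs <;> omega
  · rw [if_neg c1] at h'
    subst h'
    by_cases c2 : C (r' + 1) = B r'
    · rw [if_pos c2] at h''
      subst h''
      right; right
      refine ⟨rfl, rfl, by omega, fun p => ?_⟩
      rw [key p]; split_ifs <;> omega
    · rw [if_neg c2] at h''
      subst h''
      left
      intro p; rw [key p]; split_ifs <;> omega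

/-- A slide commutes with raising: the slide leaves the last of three consecutive diagrams through
the same row, whether or not the middle one has been raised before. -/
theorem slide_incRow {A B C : ℕ → ℕ} (h : Interlace3 A B C) {r r' r'' : ℕ}
    (hr : A (r + 1) < A r) (h' : r' = nextRow A B r) (h'' : r'' = nextRow B C r') {p : ℕ}
    (hp : IsFirstMax (height A B C) p) :
    nextRow (incRow B p) C (nextRow A (incRow B p) r) = r'' ∧
    ∃ p', IsFirstMax (height (decRow A r) (decRow B r') (decRow C r'')) p' ∧
      decRow (incRow B p) (nextRow A (incRow B p) r) = incRow (decRow B r') p' := by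
  have hr' : B (r' + 1) < B r' := h' ▸ nextRow_corner h.hAB h.hBA hr
  have hH := height_slide h hr h' h''
  have hs : height A B C (r + 1) = height A B C r + ((C (r + 1) : ℤ) - B (r + 1))
    - ((B r : ℤ) - A r) := rfl
  have h1 := h.hBA r; have h2 := h.hCB r; have h3 := h.hCB (r + 1); have h4 := h.hAB r
  obtain ⟨hp0, hpm, hpf⟩ := hp
  -- In all cases but one the same row is raised before and after, and the slide is not affected.
  have same : ∀ (_ : nextRow A (incRow B p) r = r')
      (_ : nextRow (incRow B p) C r' = r'')
      (_ : IsFirstMax (height (decRow A r) (decRow B r') (decRow C r'')) p),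
      nextRow (incRow B p) C (nextRow A (incRow B p) r) = r'' ∧
      ∃ p', IsFirstMax (height (decRow A r) (decRow B r') (decRow C r'')) p' ∧
      decRow (incRow B p) (nextRow A (incRow B p) r) = incRow (decRow B r') p' := by
    intro e1 e2 e3
    rw [e1]
    refine ⟨e2, p, e3, ?_⟩
    funext t
    simp only [incRow, decRow]
    split_ifs <;> subst_vars <;> omega
  have hp1 := hpm r; have hp2 := hpm (r + 1); have hp3 := hpf r; have hp4 := hpf (r + 1)
  rcases hH with hH | ⟨e1, e2, hle, hH⟩ | ⟨e1, e2, hle, hH⟩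
  · have hfm : IsFirstMax (height (decRow A r) (decRow B r') (decRow C r'')) p := by
      have := funext hH
      rw [this]; exact ⟨hp0, hpm, hpf⟩
    unfold nextRow at h' h''
    by_cases c1 : B (r + 1) = A r
    · rw [if_pos c1] at h'
      subst h'
      have hpr : p ≠ r + 1 := by rintro rfl; have := hp3 (by omega); omega
      refine same ?_ ?_ hfm
      · exact nextRow_of_eq (by rw [incRow_of_ne (Ne.symm hpr), c1])
      · rw [nextRow, incRow_of_ne (Ne.symm hpr)]; exact h''.symm
    · rw [if_neg c1] at h'
      subst h'
      have hc2 : C (r' + 1) ≠ B r' := by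
        intro c2
        rw [if_pos c2] at h''
        subst h''
        have := hH r'
        have k := height_decRow (A := A) (B := B) (C := C) (a := r') (b := r') (c := r' + 1)
          (by omega) (by omega) (by omega) r'
        simp at k
        omega
      rw [if_neg hc2] at h''
      subst h''
      refine same ?_ ?_ hfm
      · apply nextRow_of_ne
        unfold incRow
        split_ifs with c
        · subst c; have := hp3 (by omega); omega
        · exact c1
      · apply nextRow_of_ne
        unfold incRow
        split_ifs <;> omega
  · subst e1
    subst e2
    have hpr : p ≠ r + 1 := by rintro rfl; have := hp3 (by omega); omega
    unfold nextRow at h' h''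
    have c1 : B (r + 1) = A r := by by_contra c; rw [if_neg c] at h'; omega
    refine same ?_ ?_ ⟨?_, fun q => ?_, fun q hq => ?_⟩
    · exact nextRow_of_eq (by rw [incRow_of_ne (Ne.symm hpr), c1])
    · rw [nextRow, incRow_of_ne (Ne.symm hpr)]; exact h''.symm
    · rw [hH, if_neg hpr]; omega
    · rw [hH, hH, if_neg hpr]; have := hpm q; split_ifs <;> omega
    · rw [hH, hH, if_neg hpr]; have := hpf q hq; split_ifs <;> omega
  · subst e1
    subst e2
    have c1 : B (r' + 1) ≠ A r' := by
      intro c; unfold nextRow at h'; rw [if_pos c] at h'; omega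
    have c2 : C (r' + 1) = B r' := by
      by_contra c; unfold nextRow at h''; rw [if_neg c] at h''; omega
    have hpr : p ≠ r' := by rintro rfl; omega
    by_cases c3 : p = r' + 1 ∧ A r' = B (r' + 1) + 1
    · -- The slide takes the other way around the box that is raised.
      obtain ⟨rfl, c3⟩ := c3
      have e1 : nextRow A (incRow B (r' + 1)) r' = r' + 1 := by
        simp [nextRow, incRow, c3]
      rw [e1]
      refine ⟨?_, r', ⟨?_, fun q => ?_, fun q hq => ?_⟩, ?_⟩
      · simp only [nextRow, incRow]
        rw [if_neg]
        simp; omega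
      · rw [hH]; simp; omega
      · rw [hH, hH]; have := hpm q; simp only [if_true]; split_ifs with hq
        · subst hq; omega
        · omega
      · rw [hH, hH, if_neg (by omega)]; have := hpf q (by omega); simp only [if_true]; omega
      · funext t
        simp only [incRow, decRow]
        split_ifs <;> subst_vars <;> omega
    · refine same ?_ ?_ ⟨?_, fun q => ?_, fun q hq => ?_⟩
      · apply nextRow_of_ne
        unfold incRow
        split_ifs <;> omega
      · exact nextRow_of_eq (by rw [incRow_of_ne (Ne.symm hpr), c2])
      · rw [hH, if_neg hpr]; omega
      · rw [hH, hH, if_neg hpr]; have := hpm q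
        split_ifs with hq
        · subst hq; omega
        · omega
      · rw [hH, hH, if_neg hpr]; have := hpf q hq
        split_ifs with hq'
        · subst hq'
          rcases Nat.lt_or_ge (q + 1) p with c | c
          · have := hp4 c; omega
          · omega
        · omega

/-! ### Slides of patterns -/

/-- The row of an outside corner of a diagram with row lengths `A`. -/
def HasCorner (A : ℕ → ℕ) (r : ℕ) : Prop := A (r + 1) < A r

/-- The rows through which the hole of a slide starting in row `r` leaves the successive diagrams of
a pattern. -/
def slidePath (x : ℕ → ℕ → ℕ) (r : ℕ) : ℕ → ℕ
  | 0 => r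
  | k + 1 => nextRow (x k) (x (k + 1)) (slidePath x r k)

/-- The effect of a jeu-de-taquin slide into the last box of row `r` of the inner diagram. -/
def slidePattern (x : ℕ → ℕ → ℕ) (r : ℕ) : ℕ → ℕ → ℕ := fun k => decRow (x k) (slidePath x r k)

/-- The number of boxes in the first `N` rows. -/
def size (N : ℕ) (A : ℕ → ℕ) : ℕ := ∑ t ∈ Finset.range N, A t

theorem size_incRow {N p : ℕ} (A : ℕ → ℕ) (hp : p < N) : size N (incRow A p) = size N A + 1 := by
  have : ∀ t, incRow A p t = A t + if t = p then 1 else 0 := by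
    intro t; unfold incRow; split_ifs <;> rfl
  simp only [size, this, Finset.sum_add_distrib, Finset.sum_ite_eq', Finset.mem_range, if_pos hp]

theorem size_decRow {N p : ℕ} {A : ℕ → ℕ} (hA : 0 < A p) (hp : p < N) :
    size N (decRow A p) + 1 = size N A := by
  rw [← size_incRow _ hp]
  congr 1
  funext t
  unfold incRow decRow
  split_ifs <;> subst_vars <;> omega

namespace IsPattern

variable {N : ℕ} {x : ℕ → ℕ → ℕ}

theorem mono (h : IsPattern N x) {k l : ℕ} (hkl : k ≤ l) (r : ℕ) : x k r ≤ x l r :=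
  monotone_nat_of_le_succ (f := fun k => x k r) (fun k => h.le_succ k r) hkl

theorem succ_row_le (h : IsPattern N x) (k r : ℕ) : x k (r + 1) ≤ x k r :=
  (h.le_succ k (r + 1)).trans (h.succ_le k r)

theorem interlace3 (h : IsPattern N x) (k : ℕ) : Interlace3 (x k) (x (k + 1)) (x (k + 2)) :=
  ⟨h.le_succ k, h.le_succ (k + 1), h.succ_le k, h.succ_le (k + 1)⟩

theorem corner_slidePath (h : IsPattern N x) {r : ℕ} (hr : HasCorner (x 0) r) (k : ℕ) :
    HasCorner (x k) (slidePath x r k) := by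
  induction k with
  | zero => exact hr
  | succ k ih => exact nextRow_corner (h.le_succ k) (h.succ_le k) ih

theorem lt_of_corner (h : IsPattern N x) {k r : ℕ} (hr : HasCorner (x k) r) : r < N := by
  by_contra hN
  have := h.zero k r (by omega)
  unfold HasCorner at hr
  omega

theorem slide (h : IsPattern N x) {r : ℕ} (hr : HasCorner (x 0) r) :
    IsPattern N (slidePattern x r) where
  le_succ k t := by
    have h1 := h.corner_slidePath hr k
    have h2 := h.le_succ k t
    rw [slidePattern, slidePattern, slidePath]
    generalize slidePath x r k = p at *
    simp only [decRow, nextRow, HasCorner] at h1 ⊢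
    split_ifs <;> subst_vars <;> omega
  succ_le k t := by
    have h1 := h.corner_slidePath hr k
    have h2 := h.succ_le k t
    rw [slidePattern, slidePattern, slidePath]
    generalize slidePath x r k = p at *
    simp only [decRow, nextRow, HasCorner] at h1 ⊢
    split_ifs <;> subst_vars <;> omega
  zero k t ht := by
    have := h.zero k t ht
    simp only [slidePattern, decRow]
    split_ifs <;> omega

theorem size_slide (h : IsPattern N x) {r : ℕ} (hr : HasCorner (x 0) r) (k : ℕ) :
    size N (slidePattern x r k) + 1 = size N (x k) := by
  have h1 := h.corner_slidePath hr k
  exact size_decRow (Nat.zero_lt_of_lt h1) (h.lt_of_corner h1)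

/-- Once the diagrams of the pattern are constant, so is the path of a slide. -/
theorem slidePath_stationary (h : IsPattern N x) {r s : ℕ} (hr : HasCorner (x 0) r)
    (hs : ∀ k, s ≤ k → x k = x s) {k : ℕ} (hk : s ≤ k) : slidePath x r k = slidePath x r s := by
  induction k, hk using Nat.le_induction with
  | base => rfl
  | succ k hk ih =>
    rw [← ih, slidePath, nextRow_of_ne]
    have := h.corner_slidePath hr k
    unfold HasCorner at this
    rw [hs (k + 1) (by omega), ← hs k hk]
    omega

theorem slide_stationary (h : IsPattern N x) {r s : ℕ} (hr : HasCorner (x 0) r)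
    (hs : ∀ k, s ≤ k → x k = x s) {k : ℕ} (hk : s ≤ k) :
    slidePattern x r k = slidePattern x r s := by
  unfold slidePattern
  rw [h.slidePath_stationary hr hs hk, hs k hk]

/-- A slide is reversible: its path, traced back from the row in which it ends, is determined by the
pattern that results. -/
theorem slide_injective (h : IsPattern N x) {y : ℕ → ℕ → ℕ} (h' : IsPattern N y) {r r' s : ℕ}
    (hr : HasCorner (x 0) r) (hr' : HasCorner (y 0) r')
    (hxy : ∀ k, k ≤ s → slidePattern x r k = slidePattern y r' k)
    (hend : slidePath x r s = slidePath y r' s) : ∀ k, k ≤ s → x k = y k := by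
  induction s with
  | zero =>
    intro k hk
    obtain rfl : k = 0 := by omega
    have h1 := hxy 0 le_rfl
    funext t
    have h2 := congrFun h1 t
    simp only [slidePattern, decRow, hend] at h2
    have h3 := h.corner_slidePath hr 0
    have h4 := h'.corner_slidePath hr' 0
    unfold HasCorner at h3 h4
    split_ifs at h2 with c
    · rw [hend] at h3
      rw [← c] at h3 h4
      omega
    · exact h2
  | succ s ih =>
    have h3 := h.corner_slidePath hr (s + 1)
    have h4 := h'.corner_slidePath hr' (s + 1)
    have h5 := h.corner_slidePath hr s
    have h6 := h'.corner_slidePath hr' s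
    have key : slidePath x r s = slidePath y r' s := by
      have e1 := hxy s (by omega)
      have e2 := hxy (s + 1) le_rfl
      simp only [slidePattern, hend] at e1 e2
      simp only [slidePath, nextRow] at hend e2
      generalize slidePath x r s = p at *
      generalize slidePath y r' s = q at *
      unfold HasCorner at h5 h6
      by_contra hpq
      split_ifs at hend with c1 c2 c2
      · omega
      · obtain rfl : q = p + 1 := by omega
        have f1 := congrFun e1 p
        have f2 := congrFun e2 (p + 1)
        simp only [decRow] at f1 f2
        simp [c2] at f1 f2
        have f3 := h'.succ_le s p
        have f4 := h'.le_succ s (p + 1)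
        omega
      · obtain rfl : p = q + 1 := by omega
        have f1 := congrFun e1 q
        have f2 := congrFun e2 (q + 1)
        simp only [decRow] at f1 f2
        simp [c2] at f1 f2
        have f3 := h.succ_le s q
        have f4 := h.le_succ s (q + 1)
        omega
      · omega
    intro k hk
    rcases Nat.lt_or_ge s k with hk' | hk'
    · obtain rfl : k = s + 1 := by omega
      have e2 := hxy (s + 1) le_rfl
      funext t
      have f := congrFun e2 t
      simp only [slidePattern, hend, decRow] at f
      rw [hend] at h3
      unfold HasCorner at h3 h4
      split_ifs at f with c
      · rw [← c] at h3 h4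
        omega
      · exact f
    · exact ih (fun k hk => hxy k (by omega)) key k hk'

end IsPattern

/-! ### Raising operators on patterns -/

/-- The raising operator of index `i` takes the pattern `x` to `y`: in the diagram at level `i + 1`
the first row at which the height is maximal and positive is increased. It is `e_{i+1}` on the
tableau of the pattern. -/
def RaisesTo (i : ℕ) (x y : ℕ → ℕ → ℕ) : Prop :=
  ∃ p, IsFirstMax (height (x i) (x (i + 1)) (x (i + 2))) p ∧ y (i + 1) = incRow (x (i + 1)) p ∧
    ∀ k, k ≠ i + 1 → y k = x k

theorem RaisesTo.unique_right {i : ℕ} {x y y' : ℕ → ℕ → ℕ} (h : RaisesTo i x y)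
    (h' : RaisesTo i x y') : y = y' := by
  obtain ⟨p, hp, hy, hk⟩ := h
  obtain ⟨p', hp', hy', hk'⟩ := h'
  obtain rfl := hp.unique hp'
  funext k
  by_cases c : k = i + 1
  · subst c; rw [hy, hy']
  · rw [hk k c, hk' k c]

theorem RaisesTo.isLastMax {i : ℕ} {x y : ℕ → ℕ → ℕ} (h : RaisesTo i x y) :
    ∃ p, IsLastMax (height (y i) (y (i + 1)) (y (i + 2))) p ∧ y (i + 1) = incRow (x (i + 1)) p := by
  obtain ⟨p, hp, hy, hk⟩ := h
  refine ⟨p, ?_, hy⟩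
  rw [hk i (by omega), hk (i + 2) (by omega), hy]
  exact isLastMax_incRow hp

theorem RaisesTo.unique_left {i : ℕ} {x x' y : ℕ → ℕ → ℕ} (h : RaisesTo i x y)
    (h' : RaisesTo i x' y) : x = x' := by
  obtain ⟨p, hp, hy⟩ := h.isLastMax
  obtain ⟨p', hp', hy'⟩ := h'.isLastMax
  obtain rfl := hp.unique hp'
  funext k
  by_cases c : k = i + 1
  · subst c
    rw [hy] at hy'
    funext t
    have := congrFun hy' t
    unfold incRow at this
    split_ifs at this <;> omega
  · rw [← h.choose_spec.2.2 k c, ← h'.choose_spec.2.2 k c]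

theorem RaisesTo.isPattern {N i : ℕ} {x y : ℕ → ℕ → ℕ} (h : RaisesTo i x y)
    (hx : IsPattern N x) : IsPattern N y := by
  obtain ⟨p, hp, hy, hk⟩ := h
  obtain ⟨h1, h2⟩ := (hx.interlace3 i).room hp
  rw [show i + 2 = i + 1 + 1 from rfl] at h1
  refine ⟨fun k r => ?_, fun k r => ?_, fun k r hr => ?_⟩
  · have := hx.le_succ k r
    by_cases c1 : k = i + 1
    · subst c1
      rw [hy, hk _ (by omega)]
      unfold incRow
      split_ifs with c
      · subst c; omega
      · exact this
    · by_cases c2 : k = i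
      · subst c2
        rw [hy, hk _ c1]
        unfold incRow
        split_ifs <;> omega
      · rw [hk _ c1, hk _ (by omega)]; exact this
  · have := hx.succ_le k r
    by_cases c1 : k = i + 1
    · subst c1
      rw [hy, hk _ (by omega)]
      unfold incRow
      split_ifs <;> omega
    · by_cases c2 : k = i
      · subst c2
        rw [hy, hk _ c1]
        unfold incRow
        split_ifs with c
        · have := h2 r c.symm
          subst c; omega
        · exact this
      · rw [hk _ c1, hk _ (by omega)]; exact this
  · by_cases c1 : k = i + 1
    · subst c1
      rw [hy, incRow_of_ne]
      · exact hx.zero _ r hr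
      · rintro rfl
        have := hx.zero (i + 1 + 1) r hr
        omega
    · rw [hk _ c1]; exact hx.zero k r hr

theorem IsPattern.height_eq_of_le {N : ℕ} {x : ℕ → ℕ → ℕ} (hx : IsPattern N x) (i : ℕ) {q : ℕ}
    (hq : N ≤ q) : height (x i) (x (i + 1)) (x (i + 2)) q =
      height (x i) (x (i + 1)) (x (i + 2)) N := by
  induction q, hq using Nat.le_induction with
  | base => rfl
  | succ q hq ih =>
    rw [height, ih, hx.zero _ q hq, hx.zero _ q hq, hx.zero _ (q + 1) (by omega),
      hx.zero _ (q + 1) (by omega)]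
    ring

/-- A raising operator does not vanish if and only if the height is positive somewhere. -/
theorem exists_raisesTo_iff {N : ℕ} {x : ℕ → ℕ → ℕ} (hx : IsPattern N x) (i : ℕ) :
    (∃ y, RaisesTo i x y) ↔ ∃ p, 0 < height (x i) (x (i + 1)) (x (i + 2)) p := by
  constructor
  · rintro ⟨y, p, hp, -⟩
    exact ⟨p, hp.1⟩
  · rintro ⟨q, hq⟩
    obtain ⟨p, hp⟩ := exists_isFirstMax (M := N) (fun q hq => (hx.height_eq_of_le i hq).le) hq
    refine ⟨fun k => if k = i + 1 then incRow (x k) p else x k, p, hp, by simp, ?_⟩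
    intro k hk
    simp [hk]

/-- A lowering operator does not vanish if and only if the height drops below its maximum in the
end. -/
theorem exists_raisesTo_left_iff {N : ℕ} {x : ℕ → ℕ → ℕ} (hx : IsPattern N x) (i : ℕ) :
    (∃ y, IsPattern N y ∧ RaisesTo i y x) ↔
      ∃ p M, ∀ q, M ≤ q → height (x i) (x (i + 1)) (x (i + 2)) q <
        height (x i) (x (i + 1)) (x (i + 2)) p := by
  constructor
  · rintro ⟨y, -, h⟩
    obtain ⟨p, hp, -⟩ := h.isLastMax
    exact ⟨p, p + 1, fun q hq => hp.2 q hq⟩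
  · rintro ⟨p, M, hM⟩
    obtain ⟨p, hp⟩ := exists_isLastMax hM
    have h3 := hx.interlace3 i
    obtain ⟨h1, h2⟩ := h3.room_last hp
    have e : x (i + 1) = incRow (decRow (x (i + 1)) p) p := by
      funext t
      unfold incRow decRow
      split_ifs with c
      · subst c; omega
      · rfl
    obtain ⟨y, hy, hk⟩ : ∃ y : ℕ → ℕ → ℕ, y (i + 1) = decRow (x (i + 1)) p ∧
        ∀ k, k ≠ i + 1 → y k = x k :=
      ⟨fun k => if k = i + 1 then decRow (x k) p else x k, by simp, fun k hk => by simp [hk]⟩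
    rw [show i + 2 = i + 1 + 1 from rfl] at h2
    refine ⟨y, ⟨fun k r => ?_, fun k r => ?_, fun k r hr => ?_⟩, p, ?_, ?_, ?_⟩
    · have := hx.le_succ k r
      by_cases c1 : k = i
      · subst c1
        rw [hy, hk _ (by omega)]
        simp only [decRow]
        split_ifs with c
        · subst c; omega
        · exact this
      · rw [hk (k + 1) (by omega)]
        by_cases c2 : k = i + 1
        · subst c2
          rw [hy]
          simp only [decRow]
          split_ifs <;> omega
        · rw [hk k c2]; exact this
    · have := hx.succ_le k r
      by_cases c1 : k = i + 1
      · subst c1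
        rw [hy, hk _ (by omega)]
        simp only [decRow]
        split_ifs with c
        · subst c; omega
        · exact this
      · rw [hk k c1]
        by_cases c2 : k = i
        · subst c2
          rw [hy]
          simp only [decRow]
          split_ifs <;> omega
        · rw [hk (k + 1) (by omega)]; exact this
    · have := hx.zero k r hr
      by_cases c1 : k = i + 1
      · subst c1
        rw [hy]
        simp only [decRow]
        split_ifs <;> omega
      · rw [hk k c1]; exact this
    · rw [hy, hk i (by omega), hk (i + 2) (by omega)]
      refine isFirstMax_of_isLastMax_incRow ?_ (e ▸ hp)
      rw [← e]; exact h3.hBC 0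
    · rw [hy]; exact e
    · intro k hk'
      exact (hk k hk').symm

/-- Raising commutes with slides, and changes the path of a slide only at the level of the diagram
that is raised. -/
theorem RaisesTo.slide {N i : ℕ} {x y : ℕ → ℕ → ℕ} (h : RaisesTo i x y) (hx : IsPattern N x)
    {r : ℕ} (hr : HasCorner (x 0) r) :
    RaisesTo i (slidePattern x r) (slidePattern y r) ∧
      ∀ k, k ≠ i + 1 → slidePath y r k = slidePath x r k := by
  obtain ⟨p, hp, hy, hk⟩ := h
  have hi : ∀ k, k ≤ i → slidePath y r k = slidePath x r k := by
    intro k hki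
    induction k with
    | zero => rfl
    | succ k ih => rw [slidePath, slidePath, ih (by omega), hk _ (by omega), hk _ (by omega)]
  obtain ⟨h1, p', hp', h2⟩ := slide_incRow (hx.interlace3 i) (hx.corner_slidePath hr i)
    (r' := slidePath x r (i + 1)) (r'' := slidePath x r (i + 2)) rfl rfl hp
  have hi1 : slidePath y r (i + 1) = nextRow (x i) (incRow (x (i + 1)) p) (slidePath x r i) := by
    rw [slidePath, hi i le_rfl, hy, hk _ (by omega)]
  have hi2 : slidePath y r (i + 2) = slidePath x r (i + 2) := by
    rw [slidePath, hi1, hy, hk _ (by omega), h1]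
  have hgt : ∀ k, i + 2 ≤ k → slidePath y r k = slidePath x r k := by
    intro k hk'
    induction k, hk' using Nat.le_induction with
    | base => exact hi2
    | succ k hk' ih => rw [slidePath, slidePath, ih, hk _ (by omega), hk _ (by omega)]
  have hall : ∀ k, k ≠ i + 1 → slidePath y r k = slidePath x r k := by
    intro k hk'
    rcases Nat.lt_or_ge i k with c | c
    · exact hgt k (by omega)
    · exact hi k c
  refine ⟨⟨p', hp', ?_, fun k hk' => ?_⟩, hall⟩
  · unfold slidePattern
    rw [hi1, hy, h2]
  · unfold slidePattern
    rw [hall k hk', hk k hk']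

theorem exists_height_slide_le {N : ℕ} {x : ℕ → ℕ → ℕ} (hx : IsPattern N x) {r : ℕ}
    (hr : HasCorner (x 0) r) (i p : ℕ) :
    ∃ q, height (slidePattern x r i) (slidePattern x r (i + 1)) (slidePattern x r (i + 2)) p ≤
      height (x i) (x (i + 1)) (x (i + 2)) q := by
  rcases height_slide (hx.interlace3 i) (hx.corner_slidePath hr i)
    (r' := slidePath x r (i + 1)) (r'' := slidePath x r (i + 2)) rfl rfl with h | h | h
  · exact ⟨p, (h p).le⟩
  · refine ⟨p, (h.2.2.2 p).le.trans ?_⟩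
    split_ifs <;> omega
  · by_cases c : p = slidePath x r i
    · refine ⟨slidePath x r i + 1, (h.2.2.2 p).le.trans ?_⟩
      have := h.2.2.1
      rw [if_pos c, c]; omega
    · refine ⟨p, (h.2.2.2 p).le.trans ?_⟩
      rw [if_neg c]; omega

theorem exists_raisesTo_of_slide {N i : ℕ} {x : ℕ → ℕ → ℕ} (hx : IsPattern N x) {r : ℕ}
    (hr : HasCorner (x 0) r) (h : ∃ y, RaisesTo i (slidePattern x r) y) :
    ∃ y, RaisesTo i x y := by
  rw [exists_raisesTo_iff (hx.slide hr)] at h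
  rw [exists_raisesTo_iff hx]
  obtain ⟨p, hp⟩ := h
  obtain ⟨q, hq⟩ := exists_height_slide_le hx hr i p
  exact ⟨q, hp.trans_le hq⟩

theorem exists_raisesTo_left_of_slide {N i : ℕ} {x : ℕ → ℕ → ℕ} (hx : IsPattern N x) {r : ℕ}
    (hr : HasCorner (x 0) r) (h : ∃ y, IsPattern N y ∧ RaisesTo i y (slidePattern x r)) :
    ∃ y, IsPattern N y ∧ RaisesTo i y x := by
  rw [exists_raisesTo_left_iff (hx.slide hr)] at h
  rw [exists_raisesTo_left_iff hx]
  obtain ⟨p, M, hp⟩ := h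
  obtain ⟨q, hq⟩ := exists_height_slide_le hx hr i p
  refine ⟨q, max M (slidePath x r i + 2), fun t ht => ?_⟩
  have h1 := hp t (by omega)
  have h2 := height_slide (hx.interlace3 i) (hx.corner_slidePath hr i)
    (r' := slidePath x r (i + 1)) (r'' := slidePath x r (i + 2)) rfl rfl
  have h3 : height (slidePattern x r i) (slidePattern x r (i + 1)) (slidePattern x r (i + 2)) t =
      height (x i) (x (i + 1)) (x (i + 2)) t := by
    rcases h2 with h | h | h
    · exact h t
    · refine (h.2.2.2 t).trans ?_
      rw [if_neg (by omega)]; ring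
    · refine (h.2.2.2 t).trans ?_
      rw [if_neg (by omega)]; ring
  omega

/-- Raising operators whose indices differ by at least `2` commute. -/
theorem RaisesTo.comm {i j : ℕ} (hij : i + 2 ≤ j ∨ j + 2 ≤ i) {x y z : ℕ → ℕ → ℕ}
    (h : RaisesTo i x y) (h' : RaisesTo j x z) : ∃ w, RaisesTo j y w ∧ RaisesTo i z w := by
  obtain ⟨p, hp, hy, hk⟩ := h
  obtain ⟨q, hq, hz, hl⟩ := h'
  refine ⟨fun k => if k = i + 1 then y k else z k, ⟨q, ?_, ?_, ?_⟩, ⟨p, ?_, ?_, ?_⟩⟩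
  · rw [hk _ (by omega), hk _ (by omega), hk _ (by omega)]; exact hq
  · simp only; rw [if_neg (by omega), hz, hk _ (by omega)]
  · intro k hk'
    simp only
    split_ifs with c
    · rfl
    · rw [hl _ hk', hk _ c]
  · rw [hl _ (by omega), hl _ (by omega), hl _ (by omega)]; exact hp
  · simp only [if_true]; rw [hy, hl _ (by omega)]
  · intro k hk'
    simp [hk']

theorem RaisesTo.exists_of_raisesTo {N i j : ℕ} (hij : i + 2 ≤ j ∨ j + 2 ≤ i)
    {x y : ℕ → ℕ → ℕ} (hx : IsPattern N x) (h : RaisesTo i x y) (h' : ∃ w, RaisesTo j y w) :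
    ∃ z, RaisesTo j x z := by
  rw [exists_raisesTo_iff (h.isPattern hx)] at h'
  rw [exists_raisesTo_iff hx]
  obtain ⟨p, hp, hy, hk⟩ := h
  rwa [hk _ (by omega), hk _ (by omega), hk _ (by omega)] at h'

theorem RaisesTo.size {N i : ℕ} {x y : ℕ → ℕ → ℕ} (h : RaisesTo i x y) (hx : IsPattern N x)
    (k : ℕ) : size N (y k) = size N (x k) + if k = i + 1 then 1 else 0 := by
  obtain ⟨p, hp, hy, hk⟩ := h
  obtain ⟨h1, -⟩ := (hx.interlace3 i).room hp
  split_ifs with c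
  · subst c
    rw [hy, size_incRow]
    by_contra hN
    have := hx.zero (i + 2) p (by omega)
    omega
  · rw [hk k c]; rfl

/-! ### Sequences of slides -/

/-- The slides into the last boxes of the rows listed in `l`, one after the other. -/
def slides (l : List ℕ) (x : ℕ → ℕ → ℕ) : ℕ → ℕ → ℕ := l.foldl slidePattern x

/-- Each row of the list `l` has an outside corner when the corners of the rows listed before it
are removed from the diagram with row lengths `A`. -/
def Admissible : List ℕ → (ℕ → ℕ) → Prop
  | [], _ => True
  | r :: l, A => HasCorner A r ∧ Admissible l (decRow A r)

/-- The rows in which the slides into the rows listed in `l` leave the diagram at level `s`. -/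
def slideEnds (s : ℕ) : List ℕ → (ℕ → ℕ → ℕ) → List ℕ
  | [], _ => []
  | r :: l, x => slidePath x r s :: slideEnds s l (slidePattern x r)

theorem slides_isPattern {N : ℕ} {l : List ℕ} {x : ℕ → ℕ → ℕ} (hx : IsPattern N x)
    (hl : Admissible l (x 0)) : IsPattern N (slides l x) := by
  induction l generalizing x with
  | nil => exact hx
  | cons r l ih => exact ih (hx.slide hl.1) hl.2

theorem size_slides {N : ℕ} {l : List ℕ} {x : ℕ → ℕ → ℕ} (hx : IsPattern N x)
    (hl : Admissible l (x 0)) (k : ℕ) : size N (slides l x k) + l.length = size N (x k) := by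
  induction l generalizing x with
  | nil => rfl
  | cons r l ih =>
    have h1 := ih (hx.slide hl.1) hl.2
    have h2 := hx.size_slide hl.1 k
    simp only [slides, List.foldl_cons, List.length_cons] at h1 ⊢
    omega

theorem slides_stationary {N s : ℕ} {l : List ℕ} {x : ℕ → ℕ → ℕ} (hx : IsPattern N x)
    (hl : Admissible l (x 0)) (hs : ∀ k, s ≤ k → x k = x s) {k : ℕ} (hk : s ≤ k) :
    slides l x k = slides l x s := by
  induction l generalizing x with
  | nil => exact hs k hk
  | cons r l ih => exact ih (hx.slide hl.1) hl.2 fun k hk => hx.slide_stationary hl.1 hs hk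

theorem RaisesTo.slides {N i : ℕ} {l : List ℕ} {x y : ℕ → ℕ → ℕ} (h : RaisesTo i x y)
    (hx : IsPattern N x) (hl : Admissible l (x 0)) :
    RaisesTo i (slides l x) (slides l y) ∧
      ∀ k, k ≠ i + 1 → slideEnds k l y = slideEnds k l x := by
  induction l generalizing x y with
  | nil => exact ⟨h, fun _ _ => rfl⟩
  | cons r l ih =>
    obtain ⟨h1, h2⟩ := h.slide hx hl.1
    obtain ⟨h3, h4⟩ := ih h1 (hx.slide hl.1) hl.2
    refine ⟨h3, fun k hk => ?_⟩
    rw [slideEnds, slideEnds, h2 k hk, h4 k hk]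

theorem exists_raisesTo_of_slides {N i : ℕ} {l : List ℕ} {x : ℕ → ℕ → ℕ}
    (hx : IsPattern N x) (hl : Admissible l (x 0)) (h : ∃ y, RaisesTo i (slides l x) y) :
    ∃ y, RaisesTo i x y := by
  induction l generalizing x with
  | nil => exact h
  | cons r l ih => exact exists_raisesTo_of_slide hx hl.1 (ih (hx.slide hl.1) hl.2 h)

theorem exists_raisesTo_left_of_slides {N i : ℕ} {l : List ℕ} {x : ℕ → ℕ → ℕ}
    (hx : IsPattern N x) (hl : Admissible l (x 0))
    (h : ∃ y, IsPattern N y ∧ RaisesTo i y (slides l x)) :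
    ∃ y, IsPattern N y ∧ RaisesTo i y x := by
  induction l generalizing x with
  | nil => exact h
  | cons r l ih => exact exists_raisesTo_left_of_slide hx hl.1 (ih (hx.slide hl.1) hl.2 h)

/-- A pattern is determined by the result of a sequence of slides and the rows in which they end. -/
theorem slides_injective {N s : ℕ} {l : List ℕ} {x y : ℕ → ℕ → ℕ} (hx : IsPattern N x)
    (hy : IsPattern N y) (hlx : Admissible l (x 0)) (hly : Admissible l (y 0))
    (hend : slideEnds s l x = slideEnds s l y)
    (h : ∀ k, k ≤ s → slides l x k = slides l y k) : ∀ k, k ≤ s → x k = y k := by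
  induction l generalizing x y with
  | nil => exact h
  | cons r l ih =>
    simp only [slideEnds, List.cons.injEq] at hend
    exact hx.slide_injective hy hlx.1 hly.1
      (ih (hx.slide hlx.1) (hy.slide hly.1) hlx.2 hly.2 hend.2 h) hend.1

/-! ### Fillings and patterns -/

/-- The filling `F` is that of the pattern `x`: the first `x k r` boxes of row `r` are those with
entry at most `k`. -/
structure Represents (x : ℕ → ℕ → ℕ) (F : Filling) : Prop where
  lt_iff : ∀ k r c, c < x k r ↔ (r, c) ∈ F.shape ∧ F.entry r c ≤ k
  zero : ∀ r c, (r, c) ∉ F.shape → F.entry r c = 0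

namespace Represents

variable {x y : ℕ → ℕ → ℕ} {F G : Filling}

theorem pattern_unique (h : Represents x F) (h' : Represents y F) : x = y := by
  funext k r
  refine le_antisymm ?_ ?_
  · by_contra hlt
    exact lt_irrefl _ ((h'.lt_iff k r _).2 ((h.lt_iff k r _).1 (not_le.1 hlt)))
  · by_contra hlt
    exact lt_irrefl _ ((h.lt_iff k r _).2 ((h'.lt_iff k r _).1 (not_le.1 hlt)))

theorem mem_shape_iff (h : Represents x F) {r c : ℕ} : (r, c) ∈ F.shape ↔ ∃ k, c < x k r :=
  ⟨fun hm => ⟨F.entry r c, (h.lt_iff _ r c).2 ⟨hm, le_rfl⟩⟩,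
    fun ⟨k, hk⟩ => ((h.lt_iff k r c).1 hk).1⟩

theorem filling_unique (h : Represents x F) (h' : Represents x G) : F = G := by
  have hs : F.shape = G.shape := by
    ext ⟨r, c⟩
    rw [YoungDiagram.mem_cells, YoungDiagram.mem_cells, h.mem_shape_iff, h'.mem_shape_iff]
  have he : F.entry = G.entry := by
    funext r c
    by_cases hm : (r, c) ∈ F.shape
    · have hm' : (r, c) ∈ G.shape := hs ▸ hm
      refine le_antisymm ?_ ?_
      · exact ((h.lt_iff _ r c).1 ((h'.lt_iff _ r c).2 ⟨hm', le_rfl⟩)).2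
      · exact ((h'.lt_iff _ r c).1 ((h.lt_iff _ r c).2 ⟨hm, le_rfl⟩)).2
    · rw [h.zero r c hm, h'.zero r c (hs ▸ hm)]
  cases F; cases G
  simp only at hs he
  rw [hs, he]

theorem mem_shape_iff_of_stationary (h : Represents x F) {N s : ℕ} (hx : IsPattern N x)
    (hs : ∀ k, s ≤ k → x k = x s) {r c : ℕ} : (r, c) ∈ F.shape ↔ c < x s r := by
  rw [h.mem_shape_iff]
  refine ⟨fun ⟨k, hk⟩ => ?_, fun hk => ⟨s, hk⟩⟩
  have := hx.mono (le_max_left k s) r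
  rw [hs _ (le_max_right k s)] at this
  omega

end Represents

theorem mem_eraseCorner {κ : YoungDiagram} {r c : ℕ} (hb : (r + 1, c) ∉ κ) (hr : (r, c + 1) ∉ κ)
    (a : ℕ × ℕ) : a ∈ eraseCorner κ r c hb hr ↔ a ≠ (r, c) ∧ a ∈ κ := by
  rw [← YoungDiagram.mem_cells, ← YoungDiagram.mem_cells]
  exact Finset.mem_erase

/-- A stage of the slide into row `r` of the pattern `x`: the entries up to `k` have reached their
final places, and the hole is in the box `(slidePath x r k, c)`, having passed only entries `k + 1`
since. -/
structure SlideState (κ : YoungDiagram) (x : ℕ → ℕ → ℕ) (r : ℕ) (T : ℕ → ℕ → ℕ) (k c : ℕ) :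
    Prop where
  ge : x k (slidePath x r k) ≤ c + 1
  lt : c < x (k + 1) (slidePath x r k)
  stay : x k (slidePath x r k) ≤ c →
    x (k + 1) (slidePath x r k + 1) ≠ x k (slidePath x r k)
  entries : ∀ i j, (i, j) ≠ (slidePath x r k, c) → ∀ l, ((i, j) ∈ κ ∧ T i j ≤ l ↔
    j < if l ≤ k then slidePattern x r l i else x l i)
  zero : ∀ i j, (i, j) ∉ κ → T i j = 0

section

variable {κ : YoungDiagram} {N s r : ℕ} {x T : ℕ → ℕ → ℕ}

theorem SlideState.final (hx : IsPattern N x)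
    (hr : HasCorner (x 0) r) (hs : ∀ k, s ≤ k → x k = x s)
    (hκ : ∀ i j, (i, j) ∈ κ ↔ j < x s i) {k c : ℕ} (hk : s ≤ k)
    (h : SlideState κ x r T k c) :
    Represents (slidePattern x r) (slide κ T (slidePath x r k) c) := by
  have hp := hx.slidePath_stationary hr hs hk
  have hcor := hx.corner_slidePath hr s
  have hge := h.ge
  have hlt := h.lt
  unfold HasCorner at hcor
  rw [hs (k + 1) (by omega), hp] at hlt
  rw [hs k hk, hp] at hge
  have hent := h.entries
  rw [hp] at hent ⊢
  have hb : (slidePath x r s + 1, c) ∉ κ := by rw [hκ]; omega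
  have hr' : (slidePath x r s, c + 1) ∉ κ := by rw [hκ]; omega
  rw [slide, dif_neg (fun h => hb h.1), dif_neg hr']
  have hμs : slidePattern x r s (slidePath x r s) = c := by
    simp only [slidePattern, decRow, if_true]; omega
  have hstat : ∀ l, s ≤ l → slidePattern x r l = slidePattern x r s :=
    fun l hl => hx.slide_stationary hr hs hl
  refine ⟨fun l i j => ?_, fun i j hij => ?_⟩
  · simp only [mem_eraseCorner]
    by_cases hij : (i, j) = (slidePath x r s, c)
    · simp only [hij, ne_eq, not_true, false_and, iff_false]
      obtain ⟨rfl, rfl⟩ := Prod.mk.inj hij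
      have h1 := (hx.slide hr).mono (le_max_left l s) (slidePath x r s)
      rw [hstat _ (le_max_right l s), hμs] at h1
      omega
    · have h1 := hent i j hij l
      have h2 : setEntry T (slidePath x r s) c 0 i j = T i j := by
        unfold setEntry
        rw [if_neg]
        rintro ⟨rfl, rfl⟩
        exact hij rfl
      rw [h2]
      simp only [ne_eq, hij, not_false_eq_true, true_and, h1]
      split_ifs with hl
      · rfl
      · rw [hstat l (by omega), hs l (by omega)]
        simp only [slidePattern, decRow]
        split_ifs with c1
        · subst c1
          have : j ≠ c := by rintro rfl; exact hij rfl
          omega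
        · rfl
  · simp only [mem_eraseCorner] at hij
    simp only [setEntry]
    split_ifs with c1
    · rfl
    · refine h.zero i j fun hm => hij ⟨?_, hm⟩
      rintro h1
      exact c1 (Prod.mk.inj h1)

theorem SlideState.represents (hx : IsPattern N x)
    (hr : HasCorner (x 0) r) (hs : ∀ k, s ≤ k → x k = x s)
    (hκ : ∀ i j, (i, j) ∈ κ ↔ j < x s i) {k c : ℕ} (h : SlideState κ x r T k c) :
    Represents (slidePattern x r) (slide κ T (slidePath x r k) c) := by
  induction hM : (s - k) + ((κ.cells.sup fun x => x.1 + x.2) - (slidePath x r k + c))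
    using Nat.strong_induction_on generalizing k c T with
  | _ M ih =>
    rcases Nat.lt_or_ge k s with hk | hk
    swap
    · exact h.final hx hr hs hκ hk
    have hge := h.ge
    have hlt := h.lt
    have hstay := h.stay
    have hent := h.entries
    have hcor := hx.corner_slidePath hr k
    have hcor' := hx.corner_slidePath hr (k + 1)
    have hnext : slidePath x r (k + 1) = nextRow (x k) (x (k + 1)) (slidePath x r k) := rfl
    have hμk : slidePattern x r k = decRow (x k) (slidePath x r k) := rfl
    have hμk' : slidePattern x r (k + 1) = decRow (x (k + 1)) (slidePath x r (k + 1)) := rfl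
    have hAB := hx.le_succ k
    have hBA := hx.succ_le k
    have hCB := hx.succ_le (k + 1)
    have hBC := hx.le_succ (k + 1)
    have hle : ∀ i, x (k + 1) i ≤ x s i := hx.mono (by omega)
    have hsup : slidePath x r k + c ≤ κ.cells.sup fun x => x.1 + x.2 :=
      lt_sup_of_mem ((hκ _ _).2 (hlt.trans_le (hle _)))
    generalize hp : slidePath x r k = p at *
    unfold HasCorner at hcor
    have hentr : ∀ i j, (i, j) ≠ (p, c) → j < x (k + 1) i → (i, j) ∈ κ ∧ T i j ≤ k + 1 := by
      intro i j hij hj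
      refine (hent i j hij (k + 1)).2 ?_
      rw [if_neg (by omega)]; exact hj
    have hright : (p, c + 1) ∈ κ → k + 1 ≤ T p (c + 1) := by
      intro hm
      by_contra hlt'
      have := (hent p (c + 1) (by simp) k).1 ⟨hm, by omega⟩
      rw [if_pos le_rfl, hμk] at this
      simp only [decRow, if_true] at this
      omega
    by_cases hD : c < x (k + 1) (p + 1)
    · -- The entry below is `k + 1`: the hole moves down and the entries `k + 1` are settled.
      have hb1 := hBA p
      have hc1 : c + 1 = x k p := by omega
      have hc2 : x (k + 1) (p + 1) = x k p := by omega
      rw [nextRow_of_eq hc2] at hnext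
      obtain ⟨hm, hT⟩ := hentr (p + 1) c (by simp) hD
      have hT' : T (p + 1) c = k + 1 := by
        refine le_antisymm hT ?_
        by_contra hlt'
        have := (hent (p + 1) c (by simp) k).1 ⟨hm, by omega⟩
        rw [if_pos le_rfl, hμk] at this
        simp only [decRow] at this
        split_ifs at this <;> omega
      rw [slide, dif_pos ⟨hm, fun hm' => hT.trans (hright hm')⟩]
      have hst : SlideState κ x r (setEntry T p c (T (p + 1) c)) (k + 1) c := by
        refine ⟨?_, ?_, ?_, ?_, ?_⟩
        · rw [hnext]; omega
        · rw [hnext]; exact hD.trans_le (hBC _)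
        · rw [hnext]; omega
        · intro i j hij l
          rw [hnext] at hij
          simp only [setEntry]
          by_cases c1 : i = p ∧ j = c
          · obtain ⟨rfl, rfl⟩ := c1
            rw [if_pos ⟨rfl, rfl⟩, hT']
            have hmem : (i, j) ∈ κ := (hκ _ _).2 (hlt.trans_le (hle _))
            simp only [hmem, true_and]
            split_ifs with hl
            · rcases Nat.lt_or_ge l (k + 1) with hl' | hl'
              · have h1 := (hx.slide hr).mono (show l ≤ k by omega) i
                rw [hμk] at h1
                simp only [decRow, if_true] at h1
                omega
              · obtain rfl : l = k + 1 := by omega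
                rw [hμk', hnext]
                simp only [decRow]
                rw [if_neg (by omega)]
                omega
            · have h1 := hx.mono (show k + 1 ≤ l by omega) i
              omega
          · rw [if_neg c1, hent i j (by simpa using c1) l]
            by_cases hl : l ≤ k
            · rw [if_pos hl, if_pos (by omega)]
            · rw [if_neg hl]
              split_ifs with hl'
              · obtain rfl : l = k + 1 := by omega
                rw [hμk', hnext]
                simp only [decRow]
                split_ifs with c2
                · subst c2
                  have : j ≠ c := by rintro rfl; exact hij rfl
                  omega
                · rfl
              · rfl
        · intro i j hij
          have : ¬ (i = p ∧ j = c) := by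
            rintro ⟨rfl, rfl⟩
            exact hij ((hκ _ _).2 (hlt.trans_le (hle _)))
          simp only [setEntry]; rw [if_neg this]; exact h.zero i j hij
      have := ih _ ?_ hst rfl
      · rw [hnext] at this; exact this
      · rw [hnext]; omega
    · by_cases hR : c + 1 < x (k + 1) p
      · -- The entry to the right is `k + 1` and smaller than the one below.
        obtain ⟨hm, hT⟩ := hentr p (c + 1) (by simp) hR
        have hT' : T p (c + 1) = k + 1 := le_antisymm hT (hright hm)
        have hnb : ¬ ((p + 1, c) ∈ κ ∧ ((p, c + 1) ∈ κ → T (p + 1) c ≤ T p (c + 1))) := by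
          rintro ⟨h1, h2⟩
          have h3 := (hent (p + 1) c (by simp) (k + 1)).1 ⟨h1, (h2 hm).trans hT⟩
          rw [if_neg (by omega)] at h3
          exact hD h3
        rw [slide, dif_neg hnb, dif_pos hm]
        have hst : SlideState κ x r (setEntry T p c (T p (c + 1))) k (c + 1) := by
          refine ⟨?_, ?_, ?_, ?_, ?_⟩
          · rw [hp]; omega
          · rw [hp]; exact hR
          · rw [hp]
            intro _
            by_cases c1 : x k p ≤ c
            · exact hstay c1
            · omega
          · intro i j hij l
            rw [hp] at hij
            simp only [setEntry]
            by_cases c1 : i = p ∧ j = c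
            · obtain ⟨rfl, rfl⟩ := c1
              rw [if_pos ⟨rfl, rfl⟩, hT']
              have hmem : (i, j) ∈ κ := (hκ _ _).2 (hlt.trans_le (hle _))
              simp only [hmem, true_and]
              split_ifs with hl
              · have h1 := (hx.slide hr).mono (show l ≤ k by omega) i
                rw [hμk] at h1
                simp only [decRow, if_true] at h1
                omega
              · have h1 := hx.mono (show k + 1 ≤ l by omega) i
                omega
            · rw [if_neg c1, hent i j (by simpa using c1) l]
          · intro i j hij
            have : ¬ (i = p ∧ j = c) := by
              rintro ⟨rfl, rfl⟩
              exact hij ((hκ _ _).2 (hlt.trans_le (hle _)))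
            simp only [setEntry]; rw [if_neg this]; exact h.zero i j hij
        have hsup' : p + (c + 1) ≤ κ.cells.sup fun x => x.1 + x.2 := lt_sup_of_mem hm
        have := ih _ ?_ hst rfl
        · rw [hp] at this; exact this
        · rw [hp]; omega
      · -- The hole is at the end of its row among the entries `k + 1`.
        have hne : x (k + 1) (p + 1) ≠ x k p := by
          by_cases c1 : x k p ≤ c
          · exact hstay c1
          · omega
        rw [nextRow_of_ne hne] at hnext
        rw [hnext] at hcor'
        unfold HasCorner at hcor'
        have hst : SlideState κ x r T (k + 1) c := by
          refine ⟨?_, ?_, ?_, ?_, h.zero⟩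
          · rw [hnext]; omega
          · rw [hnext]; exact hlt.trans_le (hBC _)
          · rw [hnext]; omega
          · intro i j hij l
            rw [hnext] at hij
            rw [hent i j hij l]
            by_cases hl : l ≤ k
            · rw [if_pos hl, if_pos (by omega)]
            · rw [if_neg hl]
              split_ifs with hl'
              · obtain rfl : l = k + 1 := by omega
                rw [hμk', hnext]
                simp only [decRow]
                split_ifs with c2
                · subst c2
                  have : j ≠ c := by rintro rfl; exact hij rfl
                  omega
                · rfl
              · rfl
        have := ih _ ?_ hst rfl
        · rw [hnext] at this; exact this
        · rw [hnext]; omega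

end

/-- The slide of a filling is the filling of the slide of its pattern. -/
theorem Represents.slide {N s r : ℕ} {x : ℕ → ℕ → ℕ} {F : Filling} (h : Represents x F)
    (hx : IsPattern N x) (hr : HasCorner (x 0) r) (hs : ∀ k, s ≤ k → x k = x s) {c : ℕ}
    (hc : c + 1 = x 0 r) :
    Represents (slidePattern x r) (slide F.shape F.entry r c) := by
  refine SlideState.represents (k := 0) hx hr hs
    (fun i j => h.mem_shape_iff_of_stationary hx hs) ⟨?_, ?_, ?_, ?_, h.zero⟩
  · exact hc.ge
  · have := hx.le_succ 0 r
    simp only [slidePath]; omega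
  · simp only [slidePath]; omega
  · intro i j hij l
    rw [← h.lt_iff l i j]
    split_ifs with hl
    · obtain rfl : l = 0 := by omega
      change (i, j) ≠ (r, c) at hij
      rw [show slidePattern x r 0 = decRow (x 0) r from rfl]
      simp only [decRow]
      by_cases c1 : i = r
      · subst c1
        have : j ≠ c := by rintro rfl; exact hij rfl
        rw [if_pos rfl]
        omega
      · rw [if_neg c1]
    · rfl

/-- The boxes of the list `L` are successively outside corners of the diagram with row
lengths `A`. -/
def IsCornerList : List (ℕ × ℕ) → (ℕ → ℕ) → Prop
  | [], _ => True
  | a :: L, A => HasCorner A a.1 ∧ a.2 + 1 = A a.1 ∧ IsCornerList L (decRow A a.1)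

theorem IsCornerList.admissible {L : List (ℕ × ℕ)} {A : ℕ → ℕ} (h : IsCornerList L A) :
    Admissible (L.map Prod.fst) A := by
  induction L generalizing A with
  | nil => trivial
  | cons a L ih => exact ⟨h.1, ih h.2.2⟩

theorem Represents.foldl_slide {N s : ℕ} {L : List (ℕ × ℕ)} {x : ℕ → ℕ → ℕ} {F : Filling}
    (h : Represents x F) (hx : IsPattern N x) (hs : ∀ k, s ≤ k → x k = x s)
    (hL : IsCornerList L (x 0)) :
    Represents (slides (L.map Prod.fst) x)
      (L.foldl (fun G a => _root_.slide G.shape G.entry a.1 a.2) F) := by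
  induction L generalizing x F with
  | nil => exact h
  | cons a L ih =>
    exact ih (h.slide hx hL.1 hs hL.2.1) (hx.slide hL.1)
      (fun k hk => hx.slide_stationary hL.1 hs hk) hL.2.2

theorem isCornerList_row {n R : ℕ} {A : ℕ → ℕ} (hR : A R = n) (hR' : A (R + 1) = 0)
    {L : List (ℕ × ℕ)} (hL : IsCornerList L fun t => if t = R then 0 else A t) :
    IsCornerList ((List.range n).reverse.map (fun c => (R, c)) ++ L) A := by
  induction n generalizing A with
  | zero =>
    have e : (fun t => if t = R then 0 else A t) = A := by
      funext t
      split_ifs with c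
      · rw [c, hR]
      · rfl
    rw [e] at hL
    exact hL
  | succ n ih =>
    rw [List.range_succ, List.reverse_append]
    refine ⟨?_, ?_, ih ?_ ?_ ?_⟩
    · simp only [HasCorner]; omega
    · exact hR.symm
    · simp [decRow, hR]
    · simp [decRow, hR']
    · convert hL using 2
      simp only [decRow]
      split_ifs <;> rfl

theorem foldl_decRow_row {n R : ℕ} {A : ℕ → ℕ} (hR : A R = n) :
    (List.replicate n R).foldl decRow A = fun t => if t = R then 0 else A t := by
  induction n generalizing A with
  | zero =>
    funext t
    split_ifs with c
    · rw [c]; exact hR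
    · rfl
  | succ n ih =>
    rw [List.replicate_succ, List.foldl_cons, ih (by simp [decRow, hR])]
    funext t
    simp only [decRow]
    split_ifs <;> rfl

theorem isCornerList_rows (R : ℕ) {A : ℕ → ℕ} (hA : ∀ r, R ≤ r → A r = 0) :
    IsCornerList ((List.range R).reverse.flatMap fun r =>
      (List.range (A r)).reverse.map fun c => (r, c)) A ∧
    (((List.range R).reverse.flatMap fun r =>
      (List.range (A r)).reverse.map fun c => (r, c)).map Prod.fst).foldl decRow A = 0 := by
  induction R generalizing A with
  | zero => exact ⟨trivial, funext fun r => hA r (Nat.zero_le r)⟩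
  | succ R ih =>
    obtain ⟨h1, h2⟩ := ih (A := fun t => if t = R then 0 else A t) (by
      intro r hr
      split_ifs
      · rfl
      · exact hA r (by omega))
    have e : ((List.range R).reverse.flatMap fun r =>
        (List.range (if r = R then 0 else A r)).reverse.map fun c => (r, c)) =
        ((List.range R).reverse.flatMap fun r =>
          (List.range (A r)).reverse.map fun c => (r, c)) := by
      rw [List.flatMap_def, List.flatMap_def]
      congr 1
      refine List.map_congr_left fun r hr => ?_
      simp only [List.mem_reverse, List.mem_range] at hr
      rw [if_neg (by omega)]
    rw [e] at h1 h2
    rw [List.range_succ, List.reverse_append]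
    refine ⟨isCornerList_row rfl (hA _ le_rfl) h1, ?_⟩
    simp only [List.reverse_cons, List.reverse_nil, List.nil_append, List.cons_append,
      List.flatMap_cons, List.map_append, List.foldl_append]
    have e2 : ((List.range (A R)).reverse.map fun c => (R, c)).map Prod.fst =
        List.replicate (A R) R := by
      rw [List.map_map]
      simp
    rw [e2, foldl_decRow_row rfl]
    exact h2

/-- The rows of the boxes of `ι`, in the order in which rectification fills them. -/
def cornerRows (ι : YoungDiagram) : List ℕ := (cornerSequence ι).map Prod.fst

theorem rowLen_eq_zero {ι : YoungDiagram} {r : ℕ} (hr : ι.colLen 0 ≤ r) : ι.rowLen r = 0 := by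
  by_contra h
  have h1 : (r, 0) ∈ ι := YoungDiagram.mem_iff_lt_rowLen.2 (Nat.pos_of_ne_zero h)
  have h2 := YoungDiagram.mem_iff_lt_colLen.1 h1
  omega

theorem isCornerList_cornerSequence (ι : YoungDiagram) :
    IsCornerList (cornerSequence ι) ι.rowLen ∧ (cornerRows ι).foldl decRow ι.rowLen = 0 :=
  isCornerList_rows (ι.colLen 0) fun _ hr => rowLen_eq_zero hr

theorem slides_zero (l : List ℕ) (x : ℕ → ℕ → ℕ) : slides l x 0 = l.foldl decRow (x 0) := by
  induction l generalizing x with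
  | nil => rfl
  | cons r l ih => exact ih (slidePattern x r)

/-- The rectification of a filling is the filling of the rectification of its pattern. -/
theorem Represents.rect {N s : ℕ} {x : ℕ → ℕ → ℕ} {F : Filling} {ι : YoungDiagram}
    (h : Represents x F) (hx : IsPattern N x) (hs : ∀ k, s ≤ k → x k = x s)
    (hι : x 0 = ι.rowLen) : Represents (slides (cornerRows ι) x) (rect ι F) :=
  h.foldl_slide hx hs (hι ▸ (isCornerList_cornerSequence ι).1)

theorem admissible_cornerRows {x : ℕ → ℕ → ℕ} {ι : YoungDiagram} (hι : x 0 = ι.rowLen) :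
    Admissible (cornerRows ι) (x 0) :=
  hι ▸ (isCornerList_cornerSequence ι).1.admissible

theorem slides_cornerRows_zero {x : ℕ → ℕ → ℕ} {ι : YoungDiagram} (hι : x 0 = ι.rowLen) :
    slides (cornerRows ι) x 0 = 0 := by
  rw [slides_zero, hι]
  exact (isCornerList_cornerSequence ι).2

/-! ### Tableaux and patterns -/

theorem IsPattern.row_antitone {N : ℕ} {x : ℕ → ℕ → ℕ} (h : IsPattern N x) (k : ℕ) {r r' : ℕ}
    (hr : r ≤ r') : x k r' ≤ x k r :=
  antitone_nat_of_succ_le (f := x k) (h.succ_row_le k) hr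

/-- Descending induction along a weight function on a finite set. -/
theorem induction_of_finite {X : Type} [Finite X] (w : X → ℕ) {P : X → Prop}
    (h : ∀ x, (∀ y, w x < w y → P y) → P x) (x : X) : P x := by
  have hwf : WellFounded fun y x : X => w x < w y := by
    have : IsTrans X fun y x => w x < w y := ⟨fun _ _ _ h h' => h'.trans h⟩
    have : Std.Irrefl fun y x : X => w x < w y := ⟨fun _ => lt_irrefl _⟩
    exact Finite.wellFounded_of_trans_of_irrefl _
  induction x using hwf.induction with
  | _ x ih => exact h x ih

namespace Tab

variable {κ : YoungDiagram} {s : ℕ}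

/-- The pattern of a tableau. -/
def pat (T : Tab κ s) : ℕ → ℕ → ℕ := fun k => (T.shapeLE k).rowLen

theorem lt_pat (T : Tab κ s) {k r c : ℕ} : c < T.pat k r ↔ (r, c) ∈ κ ∧ T.1 r c ≤ k := by
  unfold pat
  rw [← YoungDiagram.mem_iff_lt_rowLen, ← YoungDiagram.mem_cells]
  simp [shapeLE]

theorem represents_pat (T : Tab κ s) : Represents T.pat T.toFilling :=
  ⟨fun _ _ _ => T.lt_pat, fun _ _ h => T.1.zeros h⟩

theorem toFilling_injective : Function.Injective (toFilling : Tab κ s → Filling) := by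
  intro T T' h
  have h1 : T.1.entry = T'.1.entry := congrArg Filling.entry h
  exact Subtype.ext (SemistandardYoungTableau.ext fun i j => congrFun (congrFun h1 i) j)

theorem pat_injective : Function.Injective (pat : Tab κ s → ℕ → ℕ → ℕ) := by
  intro T T' h
  exact toFilling_injective (T.represents_pat.filling_unique (h ▸ T'.represents_pat))

theorem pat_zero (T : Tab κ s) : T.pat 0 = 0 := by
  funext r
  refine eq_of_forall_lt_iff fun c => ?_
  rw [lt_pat]
  simp only [Pi.zero_apply, Nat.not_lt_zero, iff_false, not_and]
  intro hm
  have := (T.2 r c hm).1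
  omega

theorem pat_of_le (T : Tab κ s) {k : ℕ} (hk : s ≤ k) : T.pat k = κ.rowLen := by
  funext r
  refine eq_of_forall_lt_iff fun c => ?_
  rw [lt_pat, ← YoungDiagram.mem_iff_lt_rowLen]
  exact ⟨fun h => h.1, fun h => ⟨h, (T.2 r c h).2.trans hk⟩⟩

theorem pat_stationary (T : Tab κ s) : ∀ k, s ≤ k → T.pat k = T.pat s := fun k hk => by
  rw [T.pat_of_le hk, T.pat_of_le le_rfl]

theorem isPattern_pat (T : Tab κ s) : IsPattern (κ.colLen 0) T.pat := by
  refine ⟨fun k r => le_of_forall_lt fun c => ?_, fun k r => le_of_forall_lt fun c => ?_,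
    fun k r hr => ?_⟩
  · rw [lt_pat, lt_pat]
    exact fun h => ⟨h.1, by omega⟩
  · rw [lt_pat, lt_pat]
    rintro ⟨h1, h2⟩
    have := T.1.col_strict (show r < r + 1 by omega) h1
    exact ⟨κ.up_left_mem (Nat.le_succ r) le_rfl h1, by omega⟩
  · refine eq_of_forall_lt_iff fun c => ?_
    rw [lt_pat, YoungDiagram.mem_iff_lt_rowLen, rowLen_eq_zero hr]
    simp

/-- A pattern that begins with the empty diagram and ends with `κ` is that of a tableau. -/
theorem exists_pat_eq {N : ℕ} {x : ℕ → ℕ → ℕ} (hx : IsPattern N x) (h0 : x 0 = 0)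
    (hs : ∀ k, s ≤ k → x k = κ.rowLen) : ∃ T : Tab κ s, T.pat = x := by
  classical
  have hmem : ∀ r c, (∃ k, c < x k r) ↔ (r, c) ∈ κ := by
    intro r c
    rw [YoungDiagram.mem_iff_lt_rowLen]
    refine ⟨fun ⟨k, hk⟩ => ?_, fun h => ⟨s, by rwa [hs s le_rfl]⟩⟩
    have := hx.mono (le_max_left k s) r
    rw [hs _ (le_max_right k s)] at this
    omega
  let f : ℕ → ℕ → ℕ := fun r c => if h : ∃ k, c < x k r then Nat.find h else 0
  have hf : ∀ k r c, c < x k r ↔ (r, c) ∈ κ ∧ f r c ≤ k := by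
    intro k r c
    by_cases h : ∃ k, c < x k r
    · have hfe : f r c = Nat.find h := dif_pos h
      rw [hfe, ← hmem]
      refine ⟨fun h' => ⟨h, Nat.find_min' h h'⟩, fun h' => ?_⟩
      exact (Nat.find_spec h).trans_le (hx.mono h'.2 r)
    · rw [← hmem]
      exact ⟨fun h' => absurd ⟨k, h'⟩ h, fun h' => absurd h'.1 h⟩
  have hpos : ∀ r c, (r, c) ∈ κ → 1 ≤ f r c := by
    intro r c hm
    by_contra hlt
    have := (hf 0 r c).2 ⟨hm, by omega⟩
    rw [h0] at this
    simp at this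
  let T : SemistandardYoungTableau κ :=
    { entry := f
      row_weak' := by
        intro r c1 c2 hlt hm
        have := (hf _ r c2).2 ⟨hm, le_rfl⟩
        exact ((hf _ r c1).1 (hlt.trans this)).2
      col_strict' := by
        intro r1 r2 c hlt hm
        have h1 := hpos r2 c hm
        obtain ⟨k, hk⟩ : ∃ k, f r2 c = k + 1 := ⟨f r2 c - 1, by omega⟩
        have h2 := (hf (k + 1) r2 c).2 ⟨hm, hk.le⟩
        have h3 := hx.row_antitone (k + 1) (show r1 + 1 ≤ r2 from hlt)
        have h4 := hx.succ_le k r1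
        have h5 := ((hf k r1 c).1 (by omega)).2
        omega
      zeros' := by
        intro r c hm
        exact dif_neg fun h => hm ((hmem r c).1 h) }
  refine ⟨⟨T, fun r c hm => ⟨hpos r c hm, ?_⟩⟩, ?_⟩
  · refine ((hf s r c).1 ?_).2
    rw [hs s le_rfl, ← YoungDiagram.mem_iff_lt_rowLen]; exact hm
  · funext k r
    exact eq_of_forall_lt_iff fun c => (lt_pat _).trans (hf k r c).symm

/-! ### Raising operators on tableaux -/

theorem count_eq_sum (T : Tab κ s) (k j : ℕ) :
    T.count (k + 1) (fun c => j ≤ c) =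
      ∑ r ∈ Finset.range (κ.colLen 0), (T.pat (k + 1) r - max j (T.pat k r)) := by
  unfold count
  rw [Finset.card_eq_sum_card_fiberwise (f := Prod.fst) (t := Finset.range (κ.colLen 0))]
  · refine Finset.sum_congr rfl fun r _ => ?_
    rw [← Nat.card_Ico]
    symm
    refine Finset.card_bij (fun c _ => (r, c)) ?_ ?_ ?_
    · intro c hc
      rw [Finset.mem_Ico, lt_pat, max_le_iff, ← not_lt (b := T.pat k r), lt_pat] at hc
      simp only [Finset.mem_filter, YoungDiagram.mem_cells, and_true]
      refine ⟨hc.2.1, hc.1.1, ?_⟩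
      have : ¬ T.1 r c ≤ k := fun h => hc.1.2 ⟨hc.2.1, h⟩
      omega
    · intro c _ c' _ h
      exact (Prod.mk.inj h).2
    · rintro ⟨r', c⟩ hc
      simp only [Finset.mem_filter, YoungDiagram.mem_cells] at hc
      obtain ⟨⟨h1, h2, h3⟩, rfl⟩ := hc
      refine ⟨c, ?_, rfl⟩
      rw [Finset.mem_Ico, lt_pat, max_le_iff, ← not_lt (b := T.pat k r'), lt_pat]
      refine ⟨⟨h2, ?_⟩, h1, h3.le⟩
      rintro ⟨-, h⟩
      omega
  · rintro ⟨r, c⟩ hm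
    simp only [Finset.coe_filter, YoungDiagram.mem_cells, Set.mem_ofPred_eq] at hm
    simp only [Finset.coe_range, Set.mem_Iio]
    by_contra hr
    have := YoungDiagram.mem_iff_lt_rowLen.1 hm.1
    rw [rowLen_eq_zero (not_lt.1 hr)] at this
    omega

theorem cast_count (T : Tab κ s) (k j : ℕ) :
    (T.count (k + 1) (fun c => j ≤ c) : ℤ) =
      ∑ r ∈ Finset.range (κ.colLen 0), ((max j (T.pat (k + 1) r) : ℤ) - max j (T.pat k r)) := by
  rw [count_eq_sum, Nat.cast_sum]
  refine Finset.sum_congr rfl fun r _ => ?_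
  have := T.isPattern_pat.le_succ k r
  omega

end Tab

/-- The row lengths `A`, made at least `j`. -/
def fillRows (j : ℕ) (A : ℕ → ℕ) : ℕ → ℕ := fun r => max j (A r)

/-- The contribution of the columns from `j` on to the height, in terms of the heights. -/
theorem height_fillRows {A B C : ℕ → ℕ} (h : Interlace3 A B C) {N : ℕ} (hB : B N = 0) (j : ℕ) :
    ∃ P, B P ≤ j ∧ (∀ q, q < P → j < B q) ∧
      height A B C P + B P - j ≤ height (fillRows j A) (fillRows j B) (fillRows j C) N ∧
      (height (fillRows j A) (fillRows j B) (fillRows j C) N = height A B C P + B P - j ∨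
      (height (fillRows j A) (fillRows j B) (fillRows j C) N ≤ 0 ∧ P = 0) ∨
      ∃ q, P = q + 1 ∧
        height (fillRows j A) (fillRows j B) (fillRows j C) N ≤ height A B C q) := by
  obtain ⟨P, hP, hP', hPN⟩ : ∃ P, B P ≤ j ∧ (∀ q, q < P → j < B q) ∧ P ≤ N := by
    classical
    have hex : ∃ P, B P ≤ j := ⟨N, by omega⟩
    exact ⟨Nat.find hex, Nat.find_spec hex, fun q hq => not_le.1 (Nat.find_min hex hq),
      Nat.find_min' hex (by omega)⟩
  refine ⟨P, hP, hP', ?_⟩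
  have hanti : ∀ q, P ≤ q → B q ≤ j := by
    intro q hq
    induction q, hq using Nat.le_induction with
    | base => exact hP
    | succ q hq ih => have := h.hBA q; have := h.hAB q; omega
  have hlt : ∀ q, q < P → height (fillRows j A) (fillRows j B) (fillRows j C) q =
      height A B C q := by
    intro q hq
    induction q with
    | zero =>
      have := hP' 0 hq; have := h.hBC 0
      simp only [height, fillRows]; omega
    | succ q ih =>
      have h1 := hP' (q + 1) hq; have h2 := h.hBC (q + 1); have h3 := h.hBA q
      have h4 := hP' q (by omega)
      simp only [height, fillRows] at ih ⊢
      rw [ih (by omega)]; omega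
  have hge : height (fillRows j A) (fillRows j B) (fillRows j C) N =
      height (fillRows j A) (fillRows j B) (fillRows j C) P := by
    clear hP'
    induction N, hPN using Nat.le_induction with
    | base => rfl
    | succ q hq ih =>
      have h1 := hanti q hq; have h2 := hanti (q + 1) (by omega)
      have h3 := h.hCB q; have h4 := h.hAB q
      rw [height]
      have : height (fillRows j A) (fillRows j B) (fillRows j C) q =
          height (fillRows j A) (fillRows j B) (fillRows j C) P := by
        clear ih hB
        induction q, hq using Nat.le_induction with
        | base => rfl
        | succ q hq ih =>
          have h1 := hanti q hq; have h2 := hanti (q + 1) (by omega)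
          have h3 := h.hCB q; have h4 := h.hAB q
          rw [height, ih h1 (by omega) h3 h4]
          simp only [fillRows]; omega
      rw [this]
      simp only [fillRows]; omega
  rw [hge]
  rcases P with _ | q
  · have h1 := h.hBC 0
    have e : height (fillRows j A) (fillRows j B) (fillRows j C) 0 =
      (max j (C 0) : ℕ) - (max j (B 0) : ℕ) := rfl
    have e' : height A B C 0 = (C 0 : ℤ) - B 0 := rfl
    rw [e, e']
    refine ⟨by omega, ?_⟩
    by_cases c : j < C 0
    · left; omega
    · right; left; exact ⟨by omega, rfl⟩
  · have h1 := hP' q (by omega)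
    have h2 := hlt q (by omega)
    have h3 := h.hCB q; have h4 := h.hAB q
    have e : height (fillRows j A) (fillRows j B) (fillRows j C) (q + 1) =
      height (fillRows j A) (fillRows j B) (fillRows j C) q +
        ((max j (C (q + 1)) : ℕ) - (max j (B (q + 1)) : ℕ)) -
        ((max j (B q) : ℕ) - (max j (A q) : ℕ)) := rfl
    have e' : height A B C (q + 1) = height A B C q + ((C (q + 1) : ℤ) - B (q + 1))
      - ((B q : ℤ) - A q) := rfl
    rw [e, e', h2]
    refine ⟨by omega, ?_⟩
    by_cases c : j < C (q + 1) ∧ j ≤ A q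
    · left; omega
    · right; right; exact ⟨q, rfl, by omega⟩

namespace Tab

variable {κ : YoungDiagram} {s : ℕ}

/-- The height of the pattern of a tableau at the raising index `i`. -/
def patHeight (T : Tab κ s) (i : ℕ) : ℕ → ℤ := height (T.pat i) (T.pat (i + 1)) (T.pat (i + 2))

theorem h_eq_height (T : Tab κ s) (i j : ℕ) :
    T.h (i + 1) j = height (fillRows j (T.pat i)) (fillRows j (T.pat (i + 1)))
      (fillRows j (T.pat (i + 2))) (κ.colLen 0) := by
  unfold h
  rw [cast_count, cast_count, height_eq_sum, Finset.sum_range_succ]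
  simp only [fillRows, T.isPattern_pat.zero _ _ le_rfl]
  push_cast
  ring

theorem h_eq_sum (T : Tab κ s) (i j : ℕ) :
    T.h (i + 1) j = ∑ r ∈ Finset.range (κ.colLen 0), ((max j (T.pat (i + 2) r) : ℤ)
      - 2 * max j (T.pat (i + 1) r) + max j (T.pat i r)) := by
  unfold h
  rw [cast_count, cast_count, ← Finset.sum_sub_distrib]
  exact Finset.sum_congr rfl fun r _ => by push_cast; ring

theorem h_zero_eq (T : Tab κ s) (i : ℕ) : T.h (i + 1) 0 = T.patHeight i (κ.colLen 0) := by
  rw [h_eq_height]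
  have : ∀ A : ℕ → ℕ, fillRows 0 A = A := fun A => funext fun r => by simp [fillRows]
  simp only [this, patHeight]

theorem exists_h_le (T : Tab κ s) (i j : ℕ) : ∃ q, T.h (i + 1) j ≤ T.patHeight i q := by
  have h3 := T.isPattern_pat.interlace3 i
  obtain ⟨P, hP, -, -, h⟩ := height_fillRows h3 (T.isPattern_pat.zero _ _ le_rfl) j
  rw [← h_eq_height] at h
  rcases h with h | ⟨h, -⟩ | ⟨q, -, h⟩
  · exact ⟨P, by unfold patHeight; omega⟩
  · refine ⟨0, h.trans ?_⟩
    have := h3.hBC 0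
    simp only [patHeight, height]; omega
  · exact ⟨q, h⟩

theorem isRaisingColumn_of_isFirstMax (T : Tab κ s) {i p : ℕ}
    (hp : IsFirstMax (T.patHeight i) p) : T.IsRaisingColumn (i + 1) (T.pat (i + 1) p) := by
  have h3 := T.isPattern_pat.interlace3 i
  obtain ⟨hr1, hr2⟩ := h3.room hp
  have hN := T.isPattern_pat.zero (i + 1) _ le_rfl
  have hle : ∀ j, T.h (i + 1) j ≤ T.patHeight i p := fun j => by
    obtain ⟨q, hq⟩ := T.exists_h_le i j
    exact hq.trans (hp.2.1 q)
  have hval : T.h (i + 1) (T.pat (i + 1) p) = T.patHeight i p := by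
    refine le_antisymm (hle _) ?_
    obtain ⟨P, hP, hP', h, -⟩ := height_fillRows h3 hN (T.pat (i + 1) p)
    have hPp : P = p := by
      rcases lt_trichotomy P p with c | c | c
      · obtain ⟨q, rfl⟩ : ∃ q, p = q + 1 := ⟨p - 1, by omega⟩
        have h1 := hr2 q rfl
        have h2 := h3.hAB q
        have h4 := T.isPattern_pat.row_antitone (i + 1) (show P ≤ q by omega)
        omega
      · exact c
      · exact absurd (hP' p c) (lt_irrefl _)
    subst hPp
    rw [← h_eq_height] at h
    unfold patHeight
    omega
  refine ⟨hval ▸ hp.1, fun j => hval ▸ hle j, fun j hj => ?_⟩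
  rw [hval]
  obtain ⟨P, hP, hP', -, h⟩ := height_fillRows h3 hN j
  rw [← h_eq_height] at h
  have hPp : P ≤ p := by
    by_contra hlt
    have := hP' p (by omega)
    omega
  have hpos := hp.1
  have hmax := hp.2.1 P
  have hfirst := hp.2.2
  unfold patHeight at *
  rcases h with h | ⟨h, -⟩ | ⟨q, hq, h⟩
  · rcases hPp.lt_or_eq with c | c
    · have := hfirst P c; omega
    · subst c; omega
  · omega
  · have := hfirst q (by omega); omega

theorem isRaisingColumn_unique {T : Tab κ s} {i j j' : ℕ} (h : T.IsRaisingColumn i j)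
    (h' : T.IsRaisingColumn i j') : j = j' := by
  rcases lt_trichotomy j j' with c | c | c
  · have := h.2.2 j' c; have := h'.2.1 j; omega
  · exact c
  · have := h'.2.2 j c; have := h.2.1 j'; omega

theorem isLoweringColumn_unique {T : Tab κ s} {i j j' : ℕ} (h : T.IsLoweringColumn i j)
    (h' : T.IsLoweringColumn i j') : j = j' := by
  rcases lt_trichotomy j j' with c | c | c
  · have := h'.2.2 j c; have := h.2.1 j'; omega
  · exact c
  · have := h.2.2 j' c; have := h'.2.1 j; omega

/-- The raising column is the one behind the first `p`th row, where `p` is the first row at which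
the height is maximal. -/
theorem exists_isFirstMax_of_isRaisingColumn {T : Tab κ s} {i j : ℕ}
    (h : T.IsRaisingColumn (i + 1) j) :
    ∃ p, IsFirstMax (T.patHeight i) p ∧ j = T.pat (i + 1) p := by
  obtain ⟨q, hq⟩ := T.exists_h_le i j
  obtain ⟨p, hp⟩ := exists_isFirstMax (M := κ.colLen 0)
    (fun q hq => (T.isPattern_pat.height_eq_of_le i hq).le) (h.1.trans_le hq)
  exact ⟨p, hp, isRaisingColumn_unique h (T.isRaisingColumn_of_isFirstMax hp)⟩

theorem raiseAt_raisesTo (T : Tab κ s) {i p j : ℕ} (hp : IsFirstMax (T.patHeight i) p)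
    (hi : 1 ≤ i + 1) (hs : i + 1 + 1 ≤ s) (hj : T.IsRaisingColumn (i + 1) j)
    (hjp : j = T.pat (i + 1) p) :
    RaisesTo i T.pat (T.raiseAt (i + 1) j hi hs hj).pat := by
  have hx := T.isPattern_pat
  have h3 := hx.interlace3 i
  obtain ⟨hr1, hr2⟩ := h3.room hp
  have hent : ∀ k r c, c < (T.raiseAt (i + 1) j hi hs hj).pat k r ↔
      (r, c) ∈ κ ∧ (if c = j ∧ T.1 r c = i + 1 + 1 then i + 1 else T.1 r c) ≤ k :=
    fun k r c => lt_pat _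
  refine ⟨p, hp, ?_, fun k hk => ?_⟩
  · funext r
    refine eq_of_forall_lt_iff fun c => ?_
    have e1 : c < T.pat (i + 2) r ↔ (r, c) ∈ κ ∧ T.1 r c ≤ i + 2 := T.lt_pat
    have e2 : c < T.pat (i + 1) r ↔ (r, c) ∈ κ ∧ T.1 r c ≤ i + 1 := T.lt_pat
    have key : c < (T.raiseAt (i + 1) j hi hs hj).pat (i + 1) r ↔
        c < T.pat (i + 1) r ∨ (c = j ∧ c < T.pat (i + 2) r) := by
      rw [hent, e1, e2]
      split_ifs with c1
      · obtain ⟨rfl, c2⟩ := c1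
        rw [c2]
        simp
      · constructor
        · exact Or.inl
        · rintro (h | ⟨h1, h2, h3⟩)
          · exact h
          · refine ⟨h2, ?_⟩
            have : T.1 r c ≠ i + 1 + 1 := fun h => c1 ⟨h1, h⟩
            omega
    rw [key, hjp]
    simp only [incRow]
    split_ifs with c1
    · subst c1; omega
    · rcases Nat.lt_or_gt_of_ne c1 with c2 | c2
      · obtain ⟨q, rfl⟩ : ∃ q, p = q + 1 := ⟨p - 1, by omega⟩
        have h1 := hr2 q rfl
        have h2 := h3.hAB q
        have h4 := hx.row_antitone (i + 1) (show r ≤ q by omega)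
        omega
      · obtain ⟨q, rfl⟩ : ∃ q, r = q + 1 := ⟨r - 1, by omega⟩
        have h2 := h3.hCB q
        have h4 := hx.row_antitone (i + 1) (show p ≤ q by omega)
        omega
  · funext r
    refine eq_of_forall_lt_iff fun c => ?_
    rw [hent, lt_pat]
    split_ifs with c1
    · rw [c1.2]
      constructor <;> rintro ⟨h1, h2⟩ <;> exact ⟨h1, by omega⟩
    · rfl

/-- A raising operator on tableaux is that on their patterns. -/
theorem raise_eq_some_iff {T T' : Tab κ s} {i : ℕ} (hs : i + 2 ≤ s) :
    T.raise (i + 1) = some T' ↔ RaisesTo i T.pat T'.pat := by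
  have hto : ∀ {T'}, T.raise (i + 1) = some T' → RaisesTo i T.pat T'.pat := by
    intro T' h
    unfold raise at h
    split_ifs at h with H
    obtain ⟨p, hp, hj⟩ := exists_isFirstMax_of_isRaisingColumn H.2.choose_spec
    rw [← Option.some.inj h]
    exact T.raiseAt_raisesTo hp _ _ _ hj
  refine ⟨hto, fun hT' => ?_⟩
  obtain ⟨p, hp, -⟩ := id hT'
  have H : (1 ≤ i + 1 ∧ i + 1 + 1 ≤ s) ∧ ∃ j, T.IsRaisingColumn (i + 1) j :=
    ⟨⟨by omega, hs⟩, _, T.isRaisingColumn_of_isFirstMax hp⟩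
  obtain ⟨T'', hT''⟩ : ∃ T'', T.raise (i + 1) = some T'' := by
    unfold raise
    exact ⟨_, dif_pos H⟩
  rw [hT'', pat_injective ((hto hT'').unique_right hT')]

theorem exists_raise_eq_some_iff {T : Tab κ s} {i : ℕ} (hs : i + 2 ≤ s) :
    (∃ T', T.raise (i + 1) = some T') ↔ ∃ y, RaisesTo i T.pat y := by
  refine ⟨fun ⟨T', h⟩ => ⟨_, (raise_eq_some_iff hs).1 h⟩, fun ⟨y, hy⟩ => ?_⟩
  obtain ⟨p, hp, -⟩ := hy
  have H : (1 ≤ i + 1 ∧ i + 1 + 1 ≤ s) ∧ ∃ j, T.IsRaisingColumn (i + 1) j :=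
    ⟨⟨by omega, hs⟩, _, T.isRaisingColumn_of_isFirstMax hp⟩
  unfold raise
  exact ⟨_, dif_pos H⟩

theorem k_eq (T : Tab κ s) (i j : ℕ) : T.k i j = T.h i (j + 1) - T.h i 0 := by
  unfold k h
  rw [T.count_split i (fun c => 0 ≤ c) (fun c => c ≤ j) (fun c => j + 1 ≤ c)
      (by intro c; omega) (by intro c; omega),
    T.count_split (i + 1) (fun c => 0 ≤ c) (fun c => c ≤ j) (fun c => j + 1 ≤ c)
      (by intro c; omega) (by intro c; omega)]
  push_cast
  ring

theorem h_of_raisesTo {T T' : Tab κ s} {i p : ℕ} (hp : IsFirstMax (T.patHeight i) p)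
    (hy : T'.pat (i + 1) = incRow (T.pat (i + 1)) p) (hk : ∀ k, k ≠ i + 1 → T'.pat k = T.pat k)
    (c : ℕ) : T'.h (i + 1) c = T.h (i + 1) c - if c ≤ T.pat (i + 1) p then 2 else 0 := by
  obtain ⟨hr1, -⟩ := (T.isPattern_pat.interlace3 i).room hp
  have hpN : p < κ.colLen 0 := by
    by_contra hN
    have := T.isPattern_pat.zero (i + 2) p (by omega)
    omega
  have e : (if c ≤ T.pat (i + 1) p then (2 : ℤ) else 0) = ∑ r ∈ Finset.range (κ.colLen 0),
      if r = p then (if c ≤ T.pat (i + 1) p then (2 : ℤ) else 0) else 0 := by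
    rw [Finset.sum_ite_eq', if_pos (Finset.mem_range.2 hpN)]
  rw [h_eq_sum, h_eq_sum, hk i (by omega), hk (i + 2) (by omega), hy, e,
    ← Finset.sum_sub_distrib]
  refine Finset.sum_congr rfl fun r _ => ?_
  simp only [incRow]
  split_ifs with c1 c2
  · subst c1; omega
  · subst c1; omega
  · omega

theorem pat_lowerAt {T T' : Tab κ s} {i p j : ℕ} (hp : IsFirstMax (T.patHeight i) p)
    (hy : T'.pat (i + 1) = incRow (T.pat (i + 1)) p) (hk : ∀ k, k ≠ i + 1 → T'.pat k = T.pat k)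
    (hi : 1 ≤ i + 1) (hs : i + 1 + 1 ≤ s) (hj : T'.IsLoweringColumn (i + 1) j)
    (hjp : j = T.pat (i + 1) p) : (T'.lowerAt (i + 1) j hi hs hj).pat = T.pat := by
  have hx := T.isPattern_pat
  have h3 := hx.interlace3 i
  obtain ⟨hr1, hr2⟩ := h3.room hp
  have hent : ∀ k r c, c < (T'.lowerAt (i + 1) j hi hs hj).pat k r ↔
      (r, c) ∈ κ ∧ (if c = j ∧ T'.1 r c = i + 1 then i + 1 + 1 else T'.1 r c) ≤ k :=
    fun k r c => lt_pat _
  funext k r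
  refine eq_of_forall_lt_iff fun c => ?_
  by_cases hki : k = i + 1
  · subst hki
    have e1 : c < T'.pat i r ↔ (r, c) ∈ κ ∧ T'.1 r c ≤ i := T'.lt_pat
    have e2 : c < T'.pat (i + 1) r ↔ (r, c) ∈ κ ∧ T'.1 r c ≤ i + 1 := T'.lt_pat
    have key : c < (T'.lowerAt (i + 1) j hi hs hj).pat (i + 1) r ↔
        c < T'.pat (i + 1) r ∧ (c = j → c < T'.pat i r) := by
      rw [hent, e1, e2]
      split_ifs with c1
      · obtain ⟨rfl, c2⟩ := c1
        rw [c2]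
        simp
      · constructor
        · rintro ⟨h1, h2⟩
          refine ⟨⟨h1, h2⟩, fun h => ⟨h1, ?_⟩⟩
          have : T'.1 r c ≠ i + 1 := fun h' => c1 ⟨h, h'⟩
          omega
        · exact And.left
    rw [key, hjp, hy, hk i (by omega)]
    have h2 := h3.hAB r
    simp only [incRow]
    split_ifs with c1
    · subst c1; omega
    · rcases Nat.lt_or_gt_of_ne c1 with c2 | c2
      · obtain ⟨q, rfl⟩ : ∃ q, p = q + 1 := ⟨p - 1, by omega⟩
        have h1 := hr2 q rfl
        have h4 := hx.row_antitone i (show r ≤ q by omega)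
        omega
      · have h4 := hx.row_antitone (i + 1) (show p ≤ r by omega)
        omega
  · rw [hent, ← hk k hki, lt_pat]
    split_ifs with c1
    · rw [c1.2]
      constructor <;> rintro ⟨h1, h2⟩ <;> exact ⟨h1, by omega⟩
    · rfl

theorem isLoweringColumn_of_raisesTo {T T' : Tab κ s} {i p : ℕ}
    (hp : IsFirstMax (T.patHeight i) p)
    (hy : T'.pat (i + 1) = incRow (T.pat (i + 1)) p) (hk : ∀ k, k ≠ i + 1 → T'.pat k = T.pat k) :
    T'.IsLoweringColumn (i + 1) (T.pat (i + 1) p) := by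
  have hh := h_of_raisesTo hp hy hk
  obtain ⟨h1, h2, h3⟩ := T.isRaisingColumn_of_isFirstMax hp
  have h4 := T.h_succ (i + 1) (T.pat (i + 1) p)
  have h5 := T.count_le_one (i + 1 + 1) (T.pat (i + 1) p)
  have h6 := h3 (T.pat (i + 1) p + 1) (by omega)
  have e0 := hh 0
  have e1 := hh (T.pat (i + 1) p + 1)
  have h7 := h2 0
  rw [if_pos (by omega)] at e0
  rw [if_neg (by omega)] at e1
  refine ⟨?_, fun j => ?_, fun j hj => ?_⟩
  · rw [k_eq]; omega
  · rw [k_eq, k_eq]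
    have e2 := hh (j + 1)
    have h8 := h2 (j + 1)
    have h9 := h3 (j + 1)
    split_ifs at e2 <;> omega
  · rw [k_eq, k_eq]
    have e2 := hh (j + 1)
    have h8 := h2 (j + 1)
    rw [if_pos (by omega)] at e2
    omega

/-- The lowering operators are the partial inverses of the raising operators. -/
theorem lower_eq_some_iff {T T' : Tab κ s} {i : ℕ} (hs : i + 2 ≤ s) :
    T'.lower (i + 1) = some T ↔ T.raise (i + 1) = some T' := by
  have hto : ∀ {T T' : Tab κ s}, T.raise (i + 1) = some T' → T'.lower (i + 1) = some T := by
    intro T T' hr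
    obtain ⟨p, hp, hy, hk⟩ := (raise_eq_some_iff hs).1 hr
    have H : (1 ≤ i + 1 ∧ i + 1 + 1 ≤ s) ∧ ∃ j, T'.IsLoweringColumn (i + 1) j :=
      ⟨⟨by omega, hs⟩, _, isLoweringColumn_of_raisesTo hp hy hk⟩
    unfold lower
    rw [dif_pos H]
    refine congrArg some (pat_injective (pat_lowerAt hp hy hk _ _ _ ?_))
    exact isLoweringColumn_unique H.2.choose_spec (isLoweringColumn_of_raisesTo hp hy hk)
  refine ⟨fun hl => ?_, hto⟩
  have hl' := hl
  unfold lower at hl'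
  split_ifs at hl' with H
  obtain ⟨j, hj⟩ := H.2
  have hx := T'.isPattern_pat
  have hpos := hj.1
  rw [k_eq, h_zero_eq] at hpos
  obtain ⟨q, hq⟩ := T'.exists_h_le i (j + 1)
  obtain ⟨y, hy, hyr⟩ := (exists_raisesTo_left_iff hx i).2
    ⟨q, κ.colLen 0, fun t ht => by
      rw [hx.height_eq_of_le i ht]; unfold patHeight at *; omega⟩
  obtain ⟨p, -, -, hk⟩ := id hyr
  obtain ⟨T₀, rfl⟩ := exists_pat_eq (κ := κ) (s := s) hy
    (by rw [← hk 0 (by omega), T'.pat_zero])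
    (fun k hk' => by rw [← hk k (by omega), T'.pat_of_le hk'])
  have hr := (raise_eq_some_iff hs).2 hyr
  rw [hto hr] at hl
  rw [← Option.some.inj hl, hr]

theorem exists_lower_of_raisesTo {N : ℕ} {T' : Tab κ s} {i : ℕ} (hs : i + 2 ≤ s)
    {y : ℕ → ℕ → ℕ} (hy : IsPattern N y) (hyr : RaisesTo i y T'.pat) :
    ∃ T : Tab κ s, T.raise (i + 1) = some T' := by
  obtain ⟨p, -, -, hk⟩ := id hyr
  obtain ⟨T₀, rfl⟩ := exists_pat_eq (κ := κ) (s := s) hy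
    (by rw [← hk 0 (by omega), T'.pat_zero])
    (fun k hk' => by rw [← hk k (by omega), T'.pat_of_le hk'])
  exact ⟨T₀, (raise_eq_some_iff hs).2 hyr⟩

instance : Finite (Tab κ s) := by
  classical
  refine Finite.of_injective
    (β := κ.cells → Fin (s + 1))
    (fun T a => ⟨T.1 a.1.1 a.1.2, Nat.lt_succ_of_le (T.2 _ _ a.2).2⟩) fun T T' h => ?_
  refine Subtype.ext (SemistandardYoungTableau.ext fun r c => ?_)
  by_cases hm : (r, c) ∈ κ
  · exact congrArg Fin.val (congrFun h ⟨(r, c), hm⟩)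
  · rw [T.1.zeros hm, T'.1.zeros hm]

/-- The total size of the pattern. -/
def weight (T : Tab κ s) : ℕ := ∑ k ∈ Finset.range s, size (κ.colLen 0) (T.pat k)

theorem weight_lt_of_raise {T T' : Tab κ s} {i : ℕ} (hi : i + 2 ≤ s)
    (h : T.raise (i + 1) = some T') : T.weight < T'.weight := by
  have h1 := ((raise_eq_some_iff hi).1 h).size T.isPattern_pat
  refine Finset.sum_lt_sum (fun k _ => (h1 k).ge.trans' (Nat.le_add_right _ _))
    ⟨i + 1, Finset.mem_range.2 hi, ?_⟩
  rw [h1, if_pos rfl]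
  omega

/-- Every tableau is reached by descending induction from those at which the raising operators in a
given set vanish. -/
theorem raise_induction {P : Tab κ s → Prop} (I : ℕ → Prop) (hI : ∀ i, I i → i + 2 ≤ s)
    (h : ∀ T : Tab κ s, (∀ i, I i → ∀ T', T.raise (i + 1) = some T' → P T') → P T)
    (T : Tab κ s) : P T :=
  induction_of_finite weight
    (fun T ih => h T fun i hi T' hT' => ih T' (weight_lt_of_raise (hI i hi) hT')) T

end Tab

/-! ### Demotion -/

/-- Consecutive slides into the last boxes of one row leave each diagram through rows that weakly
increase. -/
theorem slidePath_le_slidePath (x : ℕ → ℕ → ℕ) (r k : ℕ) :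
    slidePath x r k ≤ slidePath (slidePattern x r) r k := by
  induction k with
  | zero => rfl
  | succ k ih =>
    have h1 : slidePath x r (k + 1) = nextRow (x k) (x (k + 1)) (slidePath x r k) := rfl
    have h2 : slidePath (slidePattern x r) r (k + 1) = nextRow (slidePattern x r k)
      (slidePattern x r (k + 1)) (slidePath (slidePattern x r) r k) := rfl
    have e1 : slidePattern x r k = decRow (x k) (slidePath x r k) := rfl
    have e2 : slidePattern x r (k + 1) = decRow (x (k + 1)) (slidePath x r (k + 1)) := rfl
    rw [h2, e1, e2]
    rw [h1]
    generalize slidePath x r k = p at *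
    generalize slidePath (slidePattern x r) r k = q at *
    by_cases c : x (k + 1) (p + 1) = x k p
    · rw [nextRow_of_eq c]
      rcases ih.lt_or_eq with c1 | c1
      · unfold nextRow; split_ifs <;> omega
      · subst c1
        rw [nextRow_of_eq]
        simp only [decRow, if_true, c]
    · rw [nextRow_of_ne c]
      unfold nextRow; split_ifs <;> omega

theorem slides_replicate_succ (n r : ℕ) (x : ℕ → ℕ → ℕ) :
    slides (List.replicate (n + 1) r) x = slidePattern (slides (List.replicate n r) x) r := by
  unfold slides
  rw [List.replicate_succ', List.foldl_append]
  rfl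

theorem slides_le (l : List ℕ) (x : ℕ → ℕ → ℕ) (k r : ℕ) : slides l x k r ≤ x k r := by
  induction l generalizing x with
  | nil => exact le_rfl
  | cons a l ih =>
    refine (ih (slidePattern x a)).trans ?_
    simp only [slidePattern, decRow]
    split_ifs <;> omega

theorem slides_replicate_zero_level {n r : ℕ} {x : ℕ → ℕ → ℕ} (t : ℕ) :
    slides (List.replicate n r) x 0 t = x 0 t - if t = r then n else 0 := by
  induction n with
  | zero => simp [slides]
  | succ n ih =>
    rw [slides_replicate_succ]
    have : ∀ y : ℕ → ℕ → ℕ, slidePattern y r 0 t = if t = r then y 0 t - 1 else y 0 t :=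
      fun _ => rfl
    rw [this, ih]
    split_ifs <;> omega

theorem admissible_replicate {n r : ℕ} {A : ℕ → ℕ} (h : A (r + 1) = 0) (hn : n ≤ A r) :
    Admissible (List.replicate n r) A := by
  induction n generalizing A with
  | zero => trivial
  | succ n ih =>
    refine ⟨by simp only [HasCorner]; omega, ih ?_ ?_⟩
    · simp [decRow, h]
    · simp only [decRow, if_true]; omega

section

variable {N s : ℕ} {x y : ℕ → ℕ → ℕ}

/-- The boxes vacated by slides into the first row form a horizontal strip. -/
theorem slides_replicate_strip (hx : IsPattern N x) (h1 : x 0 1 = 0) {n : ℕ} (hn : n ≤ x 0 0) :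
    (∀ r, x s (r + 1) ≤ slides (List.replicate n 0) x s r) ∧
    ∀ r, slidePath (slides (List.replicate n 0) x) 0 s < r →
      slides (List.replicate n 0) x s r = x s r := by
  induction n with
  | zero => exact ⟨fun r => hx.succ_row_le s r, fun r _ => rfl⟩
  | succ n ih =>
    obtain ⟨ih1, ih2⟩ := ih (by omega)
    have hP := slides_isPattern hx (admissible_replicate (r := 0) (n := n) h1 (by omega))
    have hc : HasCorner (slides (List.replicate n 0) x 0) 0 := by
      unfold HasCorner
      rw [slides_replicate_zero_level, slides_replicate_zero_level]
      simp only [zero_add, one_ne_zero, if_false, if_true]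
      omega
    have hcs := hP.corner_slidePath hc s
    have hmono := slidePath_le_slidePath (slides (List.replicate n 0) x) 0 s
    rw [slides_replicate_succ]
    refine ⟨fun r => ?_, fun r hr => ?_⟩
    · have := ih1 r
      simp only [slidePattern, decRow]
      split_ifs with c
      · subst c
        have := ih2 (slidePath (slides (List.replicate n 0) x) 0 s + 1) (by omega)
        unfold HasCorner at hcs
        omega
      · exact this
    · have := ih2 r (by omega)
      rw [← this]
      simp only [slidePattern, decRow]
      rw [if_neg (by omega)]

theorem slides_replicate_injective (hx : IsPattern N x) (hy : IsPattern N y) (hx1 : x 0 1 = 0)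
    (hy1 : y 0 1 = 0) (hxy : x s = y s) {n : ℕ} (hnx : n ≤ x 0 0) (hny : n ≤ y 0 0)
    (h : ∀ k, k ≤ s → slides (List.replicate n 0) x k = slides (List.replicate n 0) y k) :
    ∀ k, k ≤ s → x k = y k := by
  induction n with
  | zero => exact h
  | succ n ih =>
    have hPx := slides_isPattern hx (admissible_replicate (r := 0) (n := n) hx1 (by omega))
    have hPy := slides_isPattern hy (admissible_replicate (r := 0) (n := n) hy1 (by omega))
    have hcx : HasCorner (slides (List.replicate n 0) x 0) 0 := by
      unfold HasCorner
      rw [slides_replicate_zero_level, slides_replicate_zero_level]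
      simp only [zero_add, one_ne_zero, if_false, if_true]
      omega
    have hcy : HasCorner (slides (List.replicate n 0) y 0) 0 := by
      unfold HasCorner
      rw [slides_replicate_zero_level, slides_replicate_zero_level]
      simp only [zero_add, one_ne_zero, if_false, if_true]
      omega
    have hsx := hPx.corner_slidePath hcx s
    have hsy := hPy.corner_slidePath hcy s
    have h2x := (slides_replicate_strip (s := s) hx hx1 (n := n) (by omega)).2
    have h2y := (slides_replicate_strip (s := s) hy hy1 (n := n) (by omega)).2
    have hlx := slides_le (List.replicate n 0) x s
    have hly := slides_le (List.replicate n 0) y s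
    rw [slides_replicate_succ, slides_replicate_succ] at h
    have hs := h s le_rfl
    refine ih (by omega) (by omega) (hPx.slide_injective hPy hcx hcy h ?_)
    -- The row in which the last slide ends is the last row with a vacated box.
    simp only [slidePattern] at hs
    unfold HasCorner at hsx hsy
    generalize slidePath (slides (List.replicate n 0) x) 0 s = p at *
    generalize slidePath (slides (List.replicate n 0) y) 0 s = q at *
    rcases lt_trichotomy p q with c | c | c
    · have e1 := congrFun hs q
      simp only [decRow, if_true] at e1
      rw [if_neg (by omega), h2x q c, hxy] at e1
      have := hly q
      omega
    · exact c
    · have e1 := congrFun hs p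
      simp only [decRow, if_true] at e1
      rw [if_neg (by omega), h2y p c, ← hxy] at e1
      have := hlx p
      omega

end

namespace Tab

variable {κ : YoungDiagram} {s : ℕ}

theorem pat_one_succ (T : Tab κ s) (r : ℕ) : T.pat 1 (r + 1) = 0 := by
  have := T.isPattern_pat.succ_le 0 r
  rw [T.pat_zero] at this
  simpa using this

/-- The pattern of the rectification in the demotion of `T`. -/
def demoteSlides (T : Tab κ s) : ℕ → ℕ → ℕ :=
  slides (List.replicate (T.pat 1 0) 0) fun k => T.pat (k + 1)

theorem isPattern_shift {N : ℕ} {x : ℕ → ℕ → ℕ} (hx : IsPattern N x) (a : ℕ) :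
    IsPattern N fun k => x (k + a) where
  le_succ k r := by rw [Nat.add_right_comm]; exact hx.le_succ _ r
  succ_le k r := by rw [Nat.add_right_comm]; exact hx.succ_le _ r
  zero k r hr := hx.zero _ r hr

theorem admissible_demote (T : Tab κ s) :
    Admissible (List.replicate (T.pat 1 0) 0) (T.pat (0 + 1)) :=
  admissible_replicate (T.pat_one_succ 0) le_rfl

theorem isPattern_demoteSlides (T : Tab κ s) : IsPattern (κ.colLen 0) T.demoteSlides :=
  slides_isPattern (isPattern_shift T.isPattern_pat 1) T.admissible_demote

theorem demoteSlides_stationary (T : Tab κ s) :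
    ∀ k, s - 1 ≤ k → T.demoteSlides k = T.demoteSlides (s - 1) := fun k hk =>
  slides_stationary (isPattern_shift T.isPattern_pat 1) T.admissible_demote
    (fun l hl => by rw [T.pat_of_le (by omega), T.pat_of_le (by omega)]) hk

theorem demoteSlides_zero (T : Tab κ s) : T.demoteSlides 0 = 0 := by
  funext r
  unfold demoteSlides
  rw [slides_replicate_zero_level]
  rcases r with _ | r
  · simp
  · rw [zero_add, T.pat_one_succ]; simp

/-- The pattern of the demotion of `T`. -/
def demotePat (T : Tab κ s) : ℕ → ℕ → ℕ := fun k => if k < s then T.demoteSlides k else κ.rowLen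

theorem demoteSlides_le (T : Tab κ s) (k r : ℕ) : T.demoteSlides k r ≤ κ.rowLen r := by
  refine (slides_le _ _ k r).trans ?_
  rw [← T.pat_of_le (le_max_right (k + 1) s)]
  exact T.isPattern_pat.mono (le_max_left _ _) r

theorem isPattern_demotePat (T : Tab κ s) : IsPattern (κ.colLen 0) T.demotePat := by
  have hD := T.isPattern_demoteSlides
  have hx := T.isPattern_pat
  refine ⟨fun k r => ?_, fun k r => ?_, fun k r hr => ?_⟩
  · unfold demotePat
    split_ifs with c1 c2
    · exact hD.le_succ k r
    · exact T.demoteSlides_le k r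
    · omega
    · exact le_rfl
  · unfold demotePat
    split_ifs with c1 c2 c3
    · exact hD.succ_le k r
    · omega
    · have := (slides_replicate_strip (s := k) (isPattern_shift hx 1) (T.pat_one_succ 0) le_rfl).1 r
      rw [T.pat_of_le (by omega)] at this
      exact this
    · rw [← T.pat_of_le le_rfl]
      exact hx.succ_row_le s r
  · unfold demotePat
    split_ifs with c1
    · exact hD.zero k r hr
    · exact rowLen_eq_zero hr

theorem demotePat_zero (T : Tab κ s) : T.demotePat 0 = 0 := by
  unfold demotePat
  split_ifs with c
  · exact T.demoteSlides_zero
  · rw [← T.pat_of_le (k := 0) (by omega), T.pat_zero]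

theorem exists_pat_eq_demotePat (T : Tab κ s) : ∃ U : Tab κ s, U.pat = T.demotePat :=
  exists_pat_eq T.isPattern_demotePat T.demotePat_zero fun k hk => if_neg (by omega)

/-- The demotion of a tableau. -/
noncomputable def demote (T : Tab κ s) : Tab κ s := T.exists_pat_eq_demotePat.choose

theorem pat_demote (T : Tab κ s) : T.demote.pat = T.demotePat :=
  T.exists_pat_eq_demotePat.choose_spec

theorem cornerRows_shapeLE_one (T : Tab κ s) :
    cornerRows (T.shapeLE 1) = List.replicate (T.pat 1 0) 0 := by
  have hle : (T.shapeLE 1).colLen 0 ≤ 1 := by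
    by_contra h
    have h1 : (1, 0) ∈ T.shapeLE 1 := YoungDiagram.mem_iff_lt_colLen.2 (by omega)
    have h2 : 0 < T.pat 1 1 := YoungDiagram.mem_iff_lt_rowLen.1 h1
    have h3 := T.pat_one_succ 0
    rw [zero_add] at h3
    omega
  unfold cornerRows cornerSequence
  rcases Nat.le_one_iff_eq_zero_or_eq_one.1 hle with h | h
  · have : T.pat 1 0 = 0 := rowLen_eq_zero h.le
    rw [h, this]
    rfl
  · rw [h]
    simp [List.range_succ, Function.comp_def, pat]

theorem represents_demoteSlides (T : Tab κ s) :
    Represents T.demoteSlides (rect (T.shapeLE 1) ⟨κ, fun r c => T.1 r c - 1⟩) := by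
  have h : Represents (fun k => T.pat (k + 1)) ⟨κ, fun r c => T.1 r c - 1⟩ := by
    refine ⟨fun k r c => ?_, fun r c hm => ?_⟩
    · change c < T.pat (k + 1) r ↔ (r, c) ∈ κ ∧ T.1 r c - 1 ≤ k
      rw [lt_pat]
      constructor <;> rintro ⟨h1, h2⟩ <;> exact ⟨h1, by omega⟩
    · simp only [T.1.zeros hm]
  have := h.rect (s := s) (ι := T.shapeLE 1) (isPattern_shift T.isPattern_pat 1)
    (fun k hk => by rw [T.pat_of_le (by omega), T.pat_of_le (by omega)]) rfl
  rwa [cornerRows_shapeLE_one] at this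

theorem demotionEntry_eq (T : Tab κ s) : T.demotionEntry = T.demote.1 := by
  have hR := T.represents_demoteSlides
  have hsh : ∀ {r c}, (r, c) ∈ (rect (T.shapeLE 1) ⟨κ, fun r c => T.1 r c - 1⟩).shape →
      (r, c) ∈ κ := by
    intro r c hm
    obtain ⟨k, hk⟩ := hR.mem_shape_iff.1 hm
    exact YoungDiagram.mem_iff_lt_rowLen.2 (hk.trans_le (T.demoteSlides_le k r))
  have h : Represents T.demotePat ⟨κ, T.demotionEntry⟩ := by
    refine ⟨fun k r c => ?_, fun r c hm => ?_⟩
    · simp only [demotionEntry]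
      by_cases hk : k < s
      · have e : T.demotePat k = T.demoteSlides k := if_pos hk
        rw [e, hR.lt_iff]
        constructor
        · rintro ⟨h1, h2⟩
          exact ⟨hsh h1, by rwa [if_pos h1]⟩
        · rintro ⟨h1, h2⟩
          split_ifs at h2 with h3
          · exact ⟨h3, h2⟩
          · omega
      · have e : T.demotePat k = κ.rowLen := if_neg hk
        rw [e, ← YoungDiagram.mem_iff_lt_rowLen]
        refine ⟨fun h1 => ⟨h1, ?_⟩, And.left⟩
        split_ifs with h3
        · have h4 := (hR.mem_shape_iff_of_stationary T.isPattern_demoteSlides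
            T.demoteSlides_stationary).1 h3
          have := ((hR.lt_iff _ r c).1 h4).2
          omega
        · omega
    · simp only [demotionEntry]
      rw [if_neg fun h => hm (hsh h), if_neg hm]
  have := h.filling_unique (T.pat_demote ▸ T.demote.represents_pat)
  exact congrArg Filling.entry this

theorem size_demoteSlides (T : Tab κ s) (k : ℕ) :
    size (κ.colLen 0) (T.demoteSlides k) + T.pat 1 0 = size (κ.colLen 0) (T.pat (k + 1)) := by
  have := size_slides (isPattern_shift T.isPattern_pat 1) T.admissible_demote k
  rwa [List.length_replicate] at this

theorem size_zero (N : ℕ) : size N 0 = 0 := by simp [size]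

theorem demote_injective : Function.Injective (demote : Tab κ s → Tab κ s) := by
  intro T T' h
  rcases Nat.eq_zero_or_pos s with hs | hs
  · refine pat_injective (funext fun k => ?_)
    rw [T.pat_of_le (by omega), T'.pat_of_le (by omega)]
  have hp : T.demotePat = T'.demotePat := by rw [← pat_demote, ← pat_demote, h]
  have hk : ∀ k, k ≤ s - 1 → T.demoteSlides k = T'.demoteSlides k := by
    intro k hk
    have := congrFun hp k
    unfold demotePat at this
    rwa [if_pos (by omega), if_pos (by omega)] at this
  have hn : T.pat 1 0 = T'.pat 1 0 := by
    have h1 := T.size_demoteSlides (s - 1)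
    have h2 := T'.size_demoteSlides (s - 1)
    rw [hk _ le_rfl] at h1
    rw [T.pat_of_le (k := s - 1 + 1) (by omega)] at h1
    rw [T'.pat_of_le (k := s - 1 + 1) (by omega)] at h2
    omega
  have := slides_replicate_injective (s := s - 1) (isPattern_shift T.isPattern_pat 1)
    (isPattern_shift T'.isPattern_pat 1) (T.pat_one_succ 0) (T'.pat_one_succ 0)
    (by rw [T.pat_of_le (by omega), T'.pat_of_le (by omega)]) (n := T.pat 1 0) le_rfl hn.le
    (by intro k hk'; have := hk k hk'; unfold demoteSlides at this; rwa [← hn] at this)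
  refine pat_injective (funext fun k => ?_)
  rcases k with _ | k
  · rw [T.pat_zero, T'.pat_zero]
  · rcases Nat.lt_or_ge (s - 1) k with c | c
    · rw [T.pat_of_le (by omega), T'.pat_of_le (by omega)]
    · exact this k c

theorem demote_promotion (U : Tab κ s) : U.promotion.demote = U := by
  obtain ⟨T, rfl⟩ := (Finite.injective_iff_surjective.1 demote_injective) U
  have H : ∃ T' : Tab κ s, T'.demotionEntry = T.demote.1 := ⟨T, T.demotionEntry_eq⟩
  have h1 : T.demote.promotion = H.choose := dif_pos H
  have h2 := H.choose_spec
  rw [demotionEntry_eq] at h2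
  rw [h1]
  exact Subtype.ext (DFunLike.coe_injective h2)

theorem promotion_demote (T : Tab κ s) : T.demote.promotion = T :=
  demote_injective (demote_promotion _)

/-! ### Demotion and the raising operators -/

/-- Demotion turns the raising operator `e_{i+2}` into `e_{i+1}`. -/
theorem raise_demote (T : Tab κ s) {i : ℕ} (hi : i + 3 ≤ s) :
    T.demote.raise (i + 1) = (T.raise (i + 2)).map demote := by
  have hx := isPattern_shift T.isPattern_pat 1
  have hlt : ∀ (T : Tab κ s) {k : ℕ}, k < s → T.demote.pat k = T.demoteSlides k := by
    intro T k hk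
    rw [pat_demote]; exact if_pos hk
  cases hT : T.raise (i + 2) with
  | some T' =>
    rw [Option.map_some, raise_eq_some_iff (by omega)]
    obtain ⟨p, hp, hy, hk⟩ := (raise_eq_some_iff (i := i + 1) (by omega)).1 hT
    have h1 : RaisesTo i (fun k => T.pat (k + 1)) (fun k => T'.pat (k + 1)) :=
      ⟨p, hp, hy, fun k hk' => hk _ (by omega)⟩
    obtain ⟨q, hq, hz, hl⟩ := (h1.slides hx T.admissible_demote).1
    have e : slides (List.replicate (T.pat 1 0) 0) (fun k => T'.pat (k + 1)) =
        T'.demoteSlides := by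
      unfold demoteSlides
      rw [hk 1 (by omega)]
    rw [e] at hz hl
    refine ⟨q, ?_, ?_, fun k hk' => ?_⟩
    · rw [hlt T (by omega), hlt T (by omega), hlt T (by omega)]; exact hq
    · rw [hlt T (by omega), hlt T' (by omega)]; exact hz
    · rcases Nat.lt_or_ge k s with c | c
      · rw [hlt T c, hlt T' c]; exact hl k hk'
      · rw [pat_of_le _ c, pat_of_le _ c]
  | none =>
    rw [Option.map_none, Option.eq_none_iff_forall_ne_some]
    intro U hU
    rw [raise_eq_some_iff (by omega)] at hU
    have h1 : ∃ y, RaisesTo i T.demoteSlides y := by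
      have := (exists_raisesTo_iff T.demote.isPattern_pat i).1 ⟨_, hU⟩
      rw [hlt T (by omega), hlt T (by omega), hlt T (by omega)] at this
      exact (exists_raisesTo_iff T.isPattern_demoteSlides i).2 this
    obtain ⟨T', hT'⟩ := (exists_raise_eq_some_iff (T := T) (i := i + 1) (by omega)).2
      ((exists_raisesTo_iff T.isPattern_pat (i + 1)).2
        ((exists_raisesTo_iff hx i).1 (exists_raisesTo_of_slides hx T.admissible_demote h1)))
    rw [show i + 1 + 1 = i + 2 from rfl, hT] at hT'
    exact absurd hT' (by simp)

/-- The number of entries `k + 1`. -/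
def content (T : Tab κ s) (k : ℕ) : ℤ :=
  (size (κ.colLen 0) (T.pat (k + 1)) : ℤ) - size (κ.colLen 0) (T.pat k)

/-- Demotion rotates the content. -/
theorem content_demote (T : Tab κ s) {k : ℕ} (hk : k < s) :
    T.demote.content k = T.content ((k + 1) % s) := by
  unfold content
  rw [pat_demote]
  have h1 := T.size_demoteSlides k
  have e1 : T.demotePat k = T.demoteSlides k := if_pos hk
  rcases Nat.lt_or_ge (k + 1) s with c | c
  · have h2 := T.size_demoteSlides (k + 1)
    have e2 : T.demotePat (k + 1) = T.demoteSlides (k + 1) := if_pos c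
    rw [Nat.mod_eq_of_lt c, e1, e2]
    omega
  · have h2 := T.size_demoteSlides 0
    rw [T.demoteSlides_zero, size_zero] at h2
    have e2 : T.demotePat (k + 1) = κ.rowLen := if_neg (by omega)
    obtain rfl : s = k + 1 := by omega
    rw [Nat.mod_self, e1, e2, T.pat_zero, size_zero, ← T.pat_of_le le_rfl]
    simp only [zero_add] at h2 ⊢
    omega

theorem content_iterate_demote (T : Tab κ s) (t : ℕ) {k : ℕ} (hk : k < s) :
    (demote^[t] T).content k = T.content ((k + t) % s) := by
  induction t generalizing k with
  | zero => rw [Nat.add_zero, Nat.mod_eq_of_lt hk]; rfl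
  | succ t ih =>
    rw [Function.iterate_succ_apply', content_demote _ hk, ih (Nat.mod_lt _ (by omega)),
      Nat.mod_add_mod]
    congr 2
    omega

end Tab

/-! ### Highest weight patterns -/

theorem IsPattern.eq_zero_of_le {N : ℕ} {x : ℕ → ℕ → ℕ} (hx : IsPattern N x) (h0 : x 0 = 0)
    {k r : ℕ} (hkr : k ≤ r) : x k r = 0 := by
  induction k generalizing r with
  | zero => rw [h0]; rfl
  | succ k ih =>
    obtain ⟨t, rfl⟩ : ∃ t, r = t + 1 := ⟨r - 1, by omega⟩
    have := hx.succ_le k t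
    have := ih (r := t) (by omega)
    omega

section

variable {N : ℕ} {x : ℕ → ℕ → ℕ}

/-- In a highest weight pattern (one whose heights are nowhere positive, so that no raising operator
applies) that begins with the empty diagram, each row is filled with equal entries. -/
theorem highest_row {L : ℕ} (hx : IsPattern N x)
    (h : ∀ i, i + 2 ≤ L → ∀ p, height (x i) (x (i + 1)) (x (i + 2)) p ≤ 0) (r : ℕ) :
    ∀ i, r ≤ i → i + 2 ≤ L → x (i + 2) r = x (i + 1) r := by
  induction r using Nat.strong_induction_on with
  | _ r ih =>
    intro i hi hL
    have h3 := hx.interlace3 i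
    have hz : ∀ t, t < r → height (x i) (x (i + 1)) (x (i + 2)) t = 0 := by
      intro t ht
      induction t with
      | zero =>
        have := ih 0 ht i (by omega) hL
        simp only [height]; omega
      | succ t iht =>
        have h1 := ih (t + 1) ht i (by omega) hL
        obtain ⟨j, rfl⟩ : ∃ j, i = j + 1 := ⟨i - 1, by omega⟩
        have h2 := ih t (by omega) j (by omega) (by omega)
        rw [height, iht (by omega), h1, show j + 1 + 1 = j + 2 from rfl, h2]
        ring
    have h4 := h i hL r
    have h5 := h3.hBC r
    rcases r with _ | t
    · simp only [height] at h4; omega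
    · obtain ⟨j, rfl⟩ : ∃ j, i = j + 1 := ⟨i - 1, by omega⟩
      have h2 := ih t (by omega) j (by omega) (by omega)
      rw [height, hz t (by omega), show j + 1 + 1 = j + 2 from rfl, h2] at h4
      rw [show j + 1 + 1 = j + 2 from rfl] at h5 ⊢
      omega

theorem highest_eq {L : ℕ} (hx : IsPattern N x)
    (h : ∀ i, i + 2 ≤ L → ∀ p, height (x i) (x (i + 1)) (x (i + 2)) p ≤ 0) {k r : ℕ}
    (hrk : r < k) (hkL : k ≤ L) : x k r = x L r := by
  induction L, hkL using Nat.le_induction with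
  | base => rfl
  | succ l hkl ih =>
    rw [ih fun i hi p => h i (by omega) p]
    obtain ⟨j, rfl⟩ : ∃ j, l = j + 1 := ⟨l - 1, by omega⟩
    exact (highest_row hx h r j (by omega) (by omega)).symm

/-- The shape of a highest weight pattern that begins with the empty diagram is its content. -/
theorem highest_content {L : ℕ} (hx : IsPattern N x) (h0 : x 0 = 0)
    (h : ∀ i, i + 2 ≤ L → ∀ p, height (x i) (x (i + 1)) (x (i + 2)) p ≤ 0) {r : ℕ}
    (hr : r < L) : (x L r : ℤ) = (size N (x (r + 1)) : ℤ) - size N (x r) := by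
  have e : ∀ t, ((x (r + 1) t : ℤ) - x r t) = if t = r then (x L r : ℤ) else 0 := by
    intro t
    rcases lt_trichotomy t r with c | c | c
    · rw [highest_eq hx h (show t < r + 1 by omega) hr, highest_eq hx h c hr.le, if_neg c.ne]
      ring
    · subst c
      rw [highest_eq hx h (show t < t + 1 by omega) hr, hx.eq_zero_of_le h0 le_rfl, if_pos rfl]
      simp
    · rw [hx.eq_zero_of_le h0 (show r + 1 ≤ t by omega), hx.eq_zero_of_le h0 c.le, if_neg c.ne']
      simp
  unfold size
  push_cast
  rw [← Finset.sum_sub_distrib, Finset.sum_congr rfl fun t _ => e t, Finset.sum_ite_eq']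
  split_ifs with c
  · rfl
  · rw [Finset.mem_range, not_lt] at c
    rw [hx.zero L r c]; rfl

/-- Highest weight patterns that begin with the empty diagram are determined by their content. -/
theorem highest_unique {L N' : ℕ} {y : ℕ → ℕ → ℕ} (hx : IsPattern N x) (hy : IsPattern N' y)
    (hx0 : x 0 = 0) (hy0 : y 0 = 0)
    (hhx : ∀ i, i + 2 ≤ L → ∀ p, height (x i) (x (i + 1)) (x (i + 2)) p ≤ 0)
    (hhy : ∀ i, i + 2 ≤ L → ∀ p, height (y i) (y (i + 1)) (y (i + 2)) p ≤ 0)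
    (hc : ∀ r, r < L → (size N (x (r + 1)) : ℤ) - size N (x r) =
      (size N' (y (r + 1)) : ℤ) - size N' (y r)) {k : ℕ} (hk : k ≤ L) : x k = y k := by
  funext r
  rcases Nat.lt_or_ge r k with c | c
  · rw [highest_eq hx hhx c hk, highest_eq hy hhy c hk]
    have := highest_content hx hx0 hhx (show r < L by omega)
    rw [hc r (by omega), ← highest_content hy hy0 hhy (by omega)] at this
    exact_mod_cast this
  · rw [hx.eq_zero_of_le hx0 c, hy.eq_zero_of_le hy0 c]

variable {s w a : ℕ}

/-- In a highest weight pattern from level `a` on that ends with a rectangle, the entries in each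
column are consecutive numbers. -/
theorem highest_rectangle (hx : IsPattern N x) (hw : ∀ k, s ≤ k → ∀ r, r < N → x k r = w)
    (h : ∀ i, a ≤ i → i + 2 ≤ s → ∀ p, height (x i) (x (i + 1)) (x (i + 2)) p ≤ 0) :
    (∀ k, a ≤ k → ∀ t, t + 1 < N → x (k + 1) (t + 1) = x k t) ∧
    (0 < N → ∀ k, a + 1 ≤ k → x k 0 = w) := by
  have hstep : ∀ i, a ≤ i → i + 2 ≤ s → (∀ t, t + 1 < N → x (i + 2) (t + 1) = x (i + 1) t) →
      (∀ t, t + 1 < N → x (i + 1) (t + 1) = x i t) ∧ x (i + 2) 0 = x (i + 1) 0 := by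
    intro i hi his hP
    have h3 := hx.interlace3 i
    have h0 : x (i + 2) 0 = x (i + 1) 0 := by
      have h1 := h i hi his 0
      have h2 := h3.hBC 0
      simp only [height] at h1
      omega
    have hz : ∀ p, p < N → height (x i) (x (i + 1)) (x (i + 2)) p = 0 ∧
        ∀ t, t + 1 = p → x (i + 1) (t + 1) = x i t := by
      intro p hp
      induction p with
      | zero =>
        refine ⟨by simp only [height]; omega, fun t ht => by omega⟩
      | succ p ih =>
        have h1 := h i hi his (p + 1)
        have h2 := h3.hBA p
        rw [height, (ih (by omega)).1, hP p hp] at h1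
        have h4 : x (i + 1) (p + 1) = x i p := by omega
        refine ⟨?_, fun t ht => ?_⟩
        · rw [height, (ih (by omega)).1, hP p hp, h4]; ring
        · obtain rfl : t = p := by omega
          exact h4
    exact ⟨fun t ht => (hz (t + 1) ht).2 t rfl, h0⟩
  have htop : ∀ k, s ≤ k + 1 → ∀ t, t + 1 < N → x (k + 1) (t + 1) = x k t := by
    intro k hk t ht
    have h1 := hw (k + 1) hk (t + 1) ht
    have h2 := hw (k + 1) hk t (by omega)
    have h3 := hx.le_succ k t
    have h4 := hx.succ_le k t
    omega
  have hP : ∀ e k, s ≤ k + 1 + e → a ≤ k → ∀ t, t + 1 < N → x (k + 1) (t + 1) = x k t := by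
    intro e
    induction e with
    | zero => exact fun k hk _ => htop k hk
    | succ e ih =>
      intro k hk hak
      by_cases c : s ≤ k + 1
      · exact htop k c
      · exact (hstep k hak (by omega) (ih (k + 1) (by omega) (by omega))).1
  refine ⟨fun k hk => hP s k (by omega) hk, fun hN => ?_⟩
  have hQ : ∀ e k, s ≤ k + e → a + 1 ≤ k → x k 0 = w := by
    intro e
    induction e with
    | zero => exact fun k hk _ => hw k hk 0 hN
    | succ e ih =>
      intro k hk hak
      by_cases c : s ≤ k
      · exact hw k c 0 hN
      · obtain ⟨i, rfl⟩ : ∃ i, k = i + 1 := ⟨k - 1, by omega⟩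
        rw [← (hstep i (by omega) (by omega) (hP s (i + 1) (by omega) (by omega))).2]
        exact ih (i + 2) (by omega) (by omega)
  exact fun k hk => hQ s k (by omega) hk

end

/-! ### Promotion on rectangular tableaux -/

namespace Tab

variable {κ : YoungDiagram} {s : ℕ}

theorem raise_eq_none_iff {T : Tab κ s} {i : ℕ} (hs : i + 2 ≤ s) :
    T.raise (i + 1) = none ↔ ∀ p, T.patHeight i p ≤ 0 := by
  rw [Option.eq_none_iff_forall_ne_some]
  have h1 := exists_raise_eq_some_iff (T := T) hs
  have h2 := exists_raisesTo_iff T.isPattern_pat i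
  unfold patHeight
  constructor
  · intro h p
    by_contra hp
    obtain ⟨T', hT'⟩ := h1.2 (h2.2 ⟨p, not_le.1 hp⟩)
    exact h T' hT'
  · intro h T' hT'
    obtain ⟨p, hp⟩ := h2.1 (h1.1 ⟨T', hT'⟩)
    exact absurd (h p) (not_le.2 hp)

theorem raise_injective {T T' U : Tab κ s} {i : ℕ} (hs : i + 2 ≤ s)
    (h : T.raise (i + 1) = some U) (h' : T'.raise (i + 1) = some U) : T = T' :=
  pat_injective (((raise_eq_some_iff hs).1 h).unique_left ((raise_eq_some_iff hs).1 h'))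

theorem raise_comm {T T' U : Tab κ s} {i j : ℕ} (hi : i + 2 ≤ s) (hj : j + 2 ≤ s)
    (hij : i + 2 ≤ j ∨ j + 2 ≤ i) (h : T.raise (i + 1) = some T')
    (h' : T.raise (j + 1) = some U) :
    ∃ W, T'.raise (j + 1) = some W ∧ U.raise (i + 1) = some W := by
  obtain ⟨w, h1, h2⟩ := RaisesTo.comm hij ((raise_eq_some_iff hi).1 h)
    ((raise_eq_some_iff hj).1 h')
  obtain ⟨W, hW⟩ := (exists_raise_eq_some_iff hj).2 ⟨w, h1⟩
  have := ((raise_eq_some_iff hj).1 hW).unique_right h1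
  exact ⟨W, hW, (raise_eq_some_iff hi).2 (this ▸ h2)⟩

theorem exists_raise_of_raise {T T' U : Tab κ s} {i j : ℕ} (hi : i + 2 ≤ s) (hj : j + 2 ≤ s)
    (hij : i + 2 ≤ j ∨ j + 2 ≤ i) (h : T.raise (i + 1) = some T')
    (h' : T'.raise (j + 1) = some U) : ∃ V, T.raise (j + 1) = some V :=
  (exists_raise_eq_some_iff hj).2 (((raise_eq_some_iff hi).1 h).exists_of_raisesTo hij
    T.isPattern_pat ⟨_, (raise_eq_some_iff hj).1 h'⟩)

theorem patHeight_zero_le (T : Tab κ s) (p : ℕ) :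
    T.patHeight 0 p ≤ (T.pat 2 0 : ℤ) - T.pat 1 0 := by
  have h0 := T.pat_zero
  have hx := T.isPattern_pat
  induction p with
  | zero => exact le_rfl
  | succ p ih =>
    rw [patHeight, height]
    rw [patHeight] at ih
    have h1 := hx.eq_zero_of_le h0 (show 0 + 1 ≤ p + 1 by omega)
    have h2 := hx.eq_zero_of_le h0 (show 0 ≤ p by omega)
    rw [h1, h2]
    have h3 : T.pat 2 (p + 1) ≤ T.pat 1 p := hx.succ_le 1 p
    simp only [zero_add] at *
    omega

section Rectangle

variable {w : ℕ}

theorem pat_eq_width (hw : ∀ r, r < κ.colLen 0 → κ.rowLen r = w) (T : Tab κ s) {k r : ℕ}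
    (hk : s ≤ k) (hr : r < κ.colLen 0) : T.pat k r = w := by
  rw [T.pat_of_le hk, hw r hr]

/-- For a rectangular tableau of highest weight for the operators `e_3, …, e_{s-1}`, the number of
entries `k` in the last row for the first `k` at which it is not determined by the upper rows. -/
theorem content_of_highest (hw : ∀ r, r < κ.colLen 0 → κ.rowLen r = w) (T : Tab κ s)
    (hN : 0 < κ.colLen 0)
    (h : ∀ i, 2 ≤ i → i + 2 ≤ s → ∀ p, T.patHeight i p ≤ 0) :
    T.content (κ.colLen 0 + 1) = (w : ℤ) - T.pat 2 0 ∧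
      T.pat (κ.colLen 0 + 1) (κ.colLen 0 - 1) = T.pat 2 0 := by
  have hx := T.isPattern_pat
  obtain ⟨h1, h2⟩ := highest_rectangle hx (s := s) (a := 2)
    (fun k hk r hr => T.pat_eq_width hw hk hr) h
  have hdiag : ∀ r, r < κ.colLen 0 → ∀ k, 2 ≤ k → T.pat (k + r) r = T.pat k 0 := by
    intro r hr k hk
    induction r with
    | zero => rfl
    | succ r ih => rw [← add_assoc, h1 (k + r) (by omega) r hr, ih (by omega)]
  have e1 : T.pat (κ.colLen 0 + 1) (κ.colLen 0 - 1) = T.pat 2 0 := by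
    have := hdiag (κ.colLen 0 - 1) (by omega) 2 le_rfl
    rwa [show 2 + (κ.colLen 0 - 1) = κ.colLen 0 + 1 by omega] at this
  refine ⟨?_, e1⟩
  have e : ∀ r ∈ Finset.range (κ.colLen 0),
      ((T.pat (κ.colLen 0 + 1 + 1) r : ℤ) - T.pat (κ.colLen 0 + 1) r) =
        if r = κ.colLen 0 - 1 then (w : ℤ) - T.pat 2 0 else 0 := by
    intro r hr
    rw [Finset.mem_range] at hr
    have e2 := hdiag r hr (κ.colLen 0 + 1 + 1 - r) (by omega)
    rw [h2 hN _ (by omega), show κ.colLen 0 + 1 + 1 - r + r = κ.colLen 0 + 1 + 1 by omega] at e2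
    split_ifs with c
    · rw [e2, c, e1]
    · have e3 := hdiag r hr (κ.colLen 0 + 1 - r) (by omega)
      rw [h2 hN _ (by omega), show κ.colLen 0 + 1 - r + r = κ.colLen 0 + 1 by omega] at e3
      rw [e2, e3]; ring
  unfold content size
  push_cast
  rw [← Finset.sum_sub_distrib, Finset.sum_congr rfl e, Finset.sum_ite_eq',
    if_pos (Finset.mem_range.2 (by omega))]

theorem content_zero (T : Tab κ s) (hN : 0 < κ.colLen 0) : T.content 0 = T.pat 1 0 := by
  unfold content
  rw [T.pat_zero, size_zero]
  have : size (κ.colLen 0) (T.pat 1) = T.pat 1 0 := by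
    unfold size
    rw [Finset.sum_eq_single 0]
    · intro r _ hr
      exact T.isPattern_pat.eq_zero_of_le T.pat_zero (by omega)
    · intro h; simp at h; omega
  simp [this]

/-- The effect of two demotions on a tableau of highest weight for `e_3, …, e_{s-1}`. -/
structure DoubleDemotion (T : Tab κ s) (w : ℕ) : Prop where
  highest : ∀ i, i + 4 ≤ s → ∀ p, T.demote.demote.patHeight i p ≤ 0
  row : ∀ r, r + 1 < κ.colLen 0 → T.demote.demote.pat (s - 1) r = w
  last : (T.demote.demote.pat (s - 1) (κ.colLen 0 - 1) : ℤ) = w - T.content 1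
  height_eq : ∀ p, p + 1 < κ.colLen 0 → T.demote.demote.patHeight (s - 2) p = 0
  height_last : T.demote.demote.patHeight (s - 2) (κ.colLen 0 - 1) = T.pat 2 0 - T.pat 1 0
  height_le : ∀ p, κ.colLen 0 ≤ p →
    T.demote.demote.patHeight (s - 2) p ≤ T.demote.demote.patHeight (s - 2) (κ.colLen 0 - 1)

theorem content_demote_demote (T : Tab κ s) {k : ℕ} (hk : k < s) :
    T.demote.demote.content k = T.content ((k + 2) % s) :=
  content_iterate_demote T 2 hk

theorem doubleDemotion (hw : ∀ r, r < κ.colLen 0 → κ.rowLen r = w) (hs : 2 ≤ s) (T : Tab κ s)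
    (hN : 0 < κ.colLen 0) (h : ∀ i, 2 ≤ i → i + 2 ≤ s → ∀ p, T.patHeight i p ≤ 0) :
    DoubleDemotion T w := by
  obtain ⟨t, rfl⟩ : ∃ t, s = t + 2 := ⟨s - 2, by omega⟩
  have hhigh : ∀ i, i + 4 ≤ t + 2 → ∀ p, T.demote.demote.patHeight i p ≤ 0 := by
    intro i hi
    rw [← raise_eq_none_iff (by omega), raise_demote _ (by omega), raise_demote _ (by omega),
      (raise_eq_none_iff (T := T) (i := i + 2) (by omega)).2 (h (i + 2) (by omega) (by omega))]
    rfl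
  have hz := T.demote.demote.isPattern_pat
  have hz0 := T.demote.demote.pat_zero
  have hC : ∀ r, r < κ.colLen 0 → T.demote.demote.pat (t + 2) r = w := fun r hr =>
    pat_eq_width hw _ le_rfl hr
  have hB : ∀ r, r + 1 < κ.colLen 0 → T.demote.demote.pat (t + 1) r = w := by
    intro r hr
    have h1 : T.demote.demote.pat (t + 2) (r + 1) ≤ _ := hz.succ_le (t + 1) r
    have h2 : _ ≤ T.demote.demote.pat (t + 2) r := hz.le_succ (t + 1) r
    rw [hC _ hr] at h1
    rw [hC _ (by omega)] at h2
    omega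
  have hA : ∀ r, r + 2 < κ.colLen 0 → T.demote.demote.pat t r = w := by
    intro r hr
    have h1 := hz.succ_le t r
    have h2 := hz.le_succ t r
    rw [hB _ (by omega)] at h1
    rw [hB _ (by omega)] at h2
    omega
  have c1 : T.demote.demote.content (t + 1) = T.content 1 := by
    rw [content_demote_demote _ (by omega), show t + 1 + 2 = 1 + (t + 2) by omega,
      Nat.add_mod_right, Nat.mod_eq_of_lt (by omega)]
  have c0 : T.demote.demote.content t = T.pat 1 0 := by
    rw [content_demote_demote _ (by omega), Nat.mod_self, T.content_zero hN]
  have hlast : (T.demote.demote.pat (t + 1) (κ.colLen 0 - 1) : ℤ) = w - T.content 1 := by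
    rw [← c1]
    unfold content size
    push_cast
    rw [← Finset.sum_sub_distrib, Finset.sum_eq_single (κ.colLen 0 - 1)]
    · rw [hC _ (by omega)]; ring
    · intro r hr hne
      rw [Finset.mem_range] at hr
      rw [hC r hr, hB r (by omega)]; ring
    · intro hn; simp at hn; omega
  have hAlast : (T.demote.demote.pat t (κ.colLen 0 - 1) : ℤ) = w - T.pat 2 0 := by
    obtain ⟨g1, g2⟩ := T.content_of_highest hw hN h
    rcases Nat.lt_or_ge (κ.colLen 0 - 1) t with c | c
    · rw [highest_content hz hz0 (L := t) (fun i hi => hhigh i (by omega)) c]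
      have := T.content_demote_demote (k := κ.colLen 0 - 1) (by omega)
      rw [show κ.colLen 0 - 1 + 2 = κ.colLen 0 + 1 by omega, Nat.mod_eq_of_lt (by omega), g1]
        at this
      exact this
    · rw [hz.eq_zero_of_le hz0 c]
      rw [pat_eq_width hw _ (by omega) (by omega)] at g2
      rw [← g2]; simp
  have hc1 : T.content 1 = T.pat 2 0 + T.pat 2 1 - T.pat 1 0 := by
    have h0 := T.content_zero hN
    have : (size (κ.colLen 0) (T.pat (1 + 1)) : ℤ) = T.pat 2 0 + T.pat 2 1 := by
      have e : ∀ r, 2 ≤ r → T.pat (1 + 1) r = 0 := fun r hr =>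
        T.isPattern_pat.eq_zero_of_le T.pat_zero hr
      obtain ⟨M, hM⟩ : ∃ M, κ.colLen 0 = M + 1 := ⟨κ.colLen 0 - 1, by omega⟩
      unfold size
      rw [hM, Finset.sum_range_succ']
      rcases M with _ | M
      · rw [T.isPattern_pat.zero 2 1 (by omega)]
        simp
      · rw [Finset.sum_range_succ', Finset.sum_eq_zero (fun r _ => e _ (by omega))]
        push_cast
        ring
    unfold content at h0 ⊢
    rw [T.pat_zero, size_zero] at h0
    simp only [zero_add] at h0 ⊢
    omega
  have hheq : ∀ p, p + 1 < κ.colLen 0 → T.demote.demote.patHeight t p = 0 := by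
    intro p hp
    unfold patHeight
    induction p with
    | zero =>
      have := hC 0 (by omega); have := hB 0 hp
      simp only [height]; omega
    | succ p ih =>
      rw [height, ih (by omega), hC _ (by omega), hB _ (by omega), hB _ (by omega), hA _ (by omega)]
      ring
  have hhlast : T.demote.demote.patHeight t (κ.colLen 0 - 1) = T.pat 2 0 - T.pat 1 0 := by
    obtain ⟨M, hM⟩ : ∃ M, κ.colLen 0 = M + 1 := ⟨κ.colLen 0 - 1, by omega⟩
    have e1 : ∑ r ∈ Finset.range (M + 1), ((T.demote.demote.pat (t + 2) r : ℤ) -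
        T.demote.demote.pat (t + 1) r) = T.demote.demote.content (t + 1) := by
      unfold content size
      rw [hM]
      push_cast
      rw [Finset.sum_sub_distrib]
    have e2 : ∑ r ∈ Finset.range (M + 1), ((T.demote.demote.pat (t + 1) r : ℤ) -
        T.demote.demote.pat t r) = T.demote.demote.content t := by
      unfold content size
      rw [hM]
      push_cast
      rw [Finset.sum_sub_distrib]
    rw [Finset.sum_range_succ] at e2
    rw [hM] at hlast hAlast ⊢
    rw [Nat.add_sub_cancel] at hlast hAlast ⊢
    rw [patHeight, height_eq_sum, e1]
    omega
  refine ⟨hhigh, hB, hlast, hheq, hhlast, fun p hp => ?_⟩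
  simp only [Nat.add_sub_cancel]
  unfold patHeight
  rw [hz.height_eq_of_le t hp]
  obtain ⟨M, hM⟩ : ∃ M, κ.colLen 0 = M + 1 := ⟨κ.colLen 0 - 1, by omega⟩
  have e1 := hz.zero (t + 2) _ le_rfl
  have e2 := hz.zero (t + 1) _ le_rfl
  have e3 := hz.le_succ t M
  rw [hM] at e1 e2 ⊢
  rw [Nat.add_sub_cancel, height, e1, e2]
  omega

/-- Two demotions turn `e_1` into `e_{s-1}` at a tableau of highest weight for
`e_3, …, e_{s-1}`. -/
theorem raise_demote_demote_of_highest (hw : ∀ r, r < κ.colLen 0 → κ.rowLen r = w) (hs : 2 ≤ s)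
    (T : Tab κ s) (h : ∀ i, 2 ≤ i → i + 2 ≤ s → ∀ p, T.patHeight i p ≤ 0) :
    T.demote.demote.raise (s - 1) = (T.raise 1).map fun U => U.demote.demote := by
  obtain ⟨t, rfl⟩ : ∃ t, s = t + 2 := ⟨s - 2, by omega⟩
  rw [show t + 2 - 1 = t + 1 from rfl]
  rcases Nat.eq_zero_or_pos (κ.colLen 0) with hN | hN
  · have hzero : ∀ (U : Tab κ (t + 2)) i, i + 2 ≤ t + 2 → U.raise (i + 1) = none := by
      intro U i hi
      rw [raise_eq_none_iff hi]
      intro p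
      have e := fun k r => U.isPattern_pat.zero k r (by omega)
      unfold patHeight
      induction p with
      | zero => simp [height, e]
      | succ p ih => rw [height]; simp [e, ih]
    rw [hzero _ t le_rfl, hzero T 0 (by omega)]
    rfl
  have hD := doubleDemotion hw hs T hN h
  have hle : ∀ p, T.demote.demote.patHeight t p ≤ max 0 ((T.pat 2 0 : ℤ) - T.pat 1 0) := by
    intro p
    rcases Nat.lt_or_ge (p + 1) (κ.colLen 0) with c | c
    · exact (hD.height_eq p c).le.trans (le_max_left _ _)
    · refine le_trans ?_ (le_max_right _ _)
      rw [← hD.height_last]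
      rcases c.lt_or_eq with c | c
      · exact hD.height_le p (by omega)
      · rw [c]; exact le_rfl
  rcases le_or_gt ((T.pat 2 0 : ℤ) - T.pat 1 0) 0 with hu | hu
  · rw [(raise_eq_none_iff le_rfl).2 fun p => (hle p).trans (max_le le_rfl hu),
      (raise_eq_none_iff (T := T) (i := 0) (by omega)).2 fun p => (T.patHeight_zero_le p).trans hu]
    rfl
  · have hfm : IsFirstMax (T.patHeight 0) 0 :=
      ⟨hu, T.patHeight_zero_le, fun q hq => by omega⟩
    obtain ⟨T', hT'⟩ := (exists_raise_eq_some_iff (T := T) (i := 0) (by omega)).2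
      ((exists_raisesTo_iff T.isPattern_pat 0).2 ⟨0, hu⟩)
    obtain ⟨p, hp, hy, hk⟩ := (raise_eq_some_iff (i := 0) (by omega)).1 hT'
    obtain rfl := hfm.unique hp
    simp only [zero_add] at hT' hy hk
    rw [hT', Option.map_some, raise_eq_some_iff le_rfl]
    have h' : ∀ i, 2 ≤ i → i + 2 ≤ t + 2 → ∀ p, T'.patHeight i p ≤ 0 := by
      intro i hi his
      unfold patHeight
      rw [hk i (by omega), hk (i + 1) (by omega), hk (i + 2) (by omega)]
      exact h i hi his
    have hD' := doubleDemotion hw hs T' hN h'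
    have hcont : T'.content 1 = T.content 1 - 1 := by
      have h1 := T'.content_zero hN
      have h2 := T.content_zero hN
      unfold content at h1 h2 ⊢
      simp only [zero_add] at h1 h2 ⊢
      have h3 : T'.pat 1 0 = T.pat 1 0 + 1 := by rw [hy]; rfl
      have h4 : T'.pat (1 + 1) = T.pat (1 + 1) := hk _ (by omega)
      rw [T'.pat_zero, size_zero] at h1
      rw [T.pat_zero, size_zero] at h2
      rw [h4]
      omega
    refine ⟨κ.colLen 0 - 1, ⟨?_, fun q => ?_, fun q hq => ?_⟩, ?_, fun k hk' => ?_⟩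
    · exact hu.trans_eq hD.height_last.symm
    · refine (hle q).trans ?_
      rw [max_eq_right hu.le]
      exact hD.height_last.ge
    · exact (hD.height_eq q (by omega)).trans_lt (hu.trans_eq hD.height_last.symm)
    · funext r
      have l1 := hD.last
      have l2 := hD'.last
      have r1 := hD.row r
      have r2 := hD'.row r
      simp only [Nat.add_succ_sub_one] at l1 l2 r1 r2
      simp only [incRow]
      split_ifs with c
      · subst c; omega
      · rcases Nat.lt_or_ge r (κ.colLen 0) with c' | c'
        · rw [r1 (by omega), r2 (by omega)]
        · rw [isPattern_pat _ |>.zero _ _ c', isPattern_pat _ |>.zero _ _ c']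
    · rcases Nat.lt_or_ge k (t + 2) with c | c
      · refine highest_unique (L := t) (isPattern_pat _) (isPattern_pat _) (pat_zero _) (pat_zero _)
          (fun i hi => hD'.highest i (by omega)) (fun i hi => hD.highest i (by omega))
          (fun r hr => ?_) (by omega)
        have e1 := T.content_demote_demote (k := r) (by omega)
        have e2 := T'.content_demote_demote (k := r) (by omega)
        rw [Nat.mod_eq_of_lt (by omega)] at e1 e2
        have e3 : T'.content (r + 2) = T.content (r + 2) := by
          unfold content
          rw [hk _ (by omega), hk _ (by omega)]
        rw [e3, ← e1] at e2
        exact e2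
      · rw [pat_of_le _ c, pat_of_le _ c]

/-- Two demotions of a rectangular tableau turn `e_1` into `e_{s-1}`. -/
theorem raise_demote_demote (hw : ∀ r, r < κ.colLen 0 → κ.rowLen r = w) (hs : 2 ≤ s)
    (T : Tab κ s) :
    T.demote.demote.raise (s - 1) = (T.raise 1).map fun U => U.demote.demote := by
  induction T using raise_induction (I := fun i => 2 ≤ i ∧ i + 2 ≤ s) (hI := fun i hi => hi.2) with
  | h T ih =>
    by_cases hT : ∃ i T', (2 ≤ i ∧ i + 2 ≤ s) ∧ T.raise (i + 1) = some T'
    · obtain ⟨i, T', ⟨hi, his⟩, hT'⟩ := hT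
      have ih' := ih i ⟨hi, his⟩ T' hT'
      obtain ⟨t, rfl⟩ : ∃ t, s = t + 2 := ⟨s - 2, by omega⟩
      obtain ⟨j, rfl⟩ : ∃ j, i = j + 2 := ⟨i - 2, by omega⟩
      rw [show t + 2 - 1 = t + 1 from rfl] at ih' ⊢
      have hdd : ∀ {U V : Tab κ (t + 2)}, U.raise (j + 2 + 1) = some V →
          U.demote.demote.raise (j + 1) = some V.demote.demote := by
        intro U V hUV
        rw [raise_demote _ (by omega), raise_demote _ (by omega), hUV]
        rfl
      cases hU : T.raise 1 with
      | some U =>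
        obtain ⟨W, hW1, hW2⟩ := raise_comm his (by omega) (by omega) hT' (j := 0) hU
        rw [zero_add] at hW1
        rw [hW1, Option.map_some] at ih'
        obtain ⟨V, hV⟩ := exists_raise_of_raise (j := t) (by omega) le_rfl (by omega)
          (hdd hT') ih'
        obtain ⟨W', hW1', hW2'⟩ := raise_comm (by omega) le_rfl (by omega) (hdd hT') hV
        rw [ih'] at hW1'
        rw [← Option.some.inj hW1'] at hW2'
        rw [hV, Option.map_some, raise_injective (by omega) hW2' (hdd hW2)]
      | none =>
        have hnone : T'.raise 1 = none := by
          rw [Option.eq_none_iff_forall_ne_some]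
          intro W hW
          obtain ⟨V, hV⟩ := exists_raise_of_raise (j := 0) his (by omega) (by omega) hT' hW
          rw [zero_add, hU] at hV
          simp at hV
        rw [hnone, Option.map_none] at ih'
        rw [Option.map_none, Option.eq_none_iff_forall_ne_some]
        intro V hV
        obtain ⟨W', hW1', -⟩ := raise_comm (by omega) le_rfl (by omega) (hdd hT') hV
        rw [ih'] at hW1'
        simp at hW1'
    · refine raise_demote_demote_of_highest hw hs T fun i hi his => ?_
      rw [← raise_eq_none_iff his, Option.eq_none_iff_forall_ne_some]
      exact fun T' hT' => hT ⟨i, T', ⟨hi, his⟩, hT'⟩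

theorem raise_iterate_demote (T : Tab κ s) (t : ℕ) {i : ℕ} (hi : i + t + 2 ≤ s) :
    (demote^[t] T).raise (i + 1) = (T.raise (i + t + 1)).map demote^[t] := by
  induction t generalizing i with
  | zero => simp
  | succ t ih =>
    rw [Function.iterate_succ_apply', raise_demote _ (by omega), show i + 2 = i + 1 + 1 from rfl,
      ih (by omega), Option.map_map, ← Function.iterate_succ',
      show i + 1 + t + 1 = i + (t + 1) + 1 by omega]

/-- The inverse of the action of `j` permutes the raising operators of the blocks cyclically. -/
theorem raise_blockDemotion {m n : ℕ} (hw : ∀ r, r < κ.colLen 0 → κ.rowLen r = w)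
    (T : Tab κ (m * n)) {k i : ℕ} (hk : k < n) (hi : i + 2 ≤ m) :
    (demote^[m] T).raise (k * m + i + 1) =
      (T.raise ((k + 1) % n * m + i + 1)).map demote^[m] := by
  have hmn : ∀ a, a < n → a * m + m ≤ m * n := by
    intro a ha
    rw [mul_comm m n, ← Nat.succ_mul]
    exact Nat.mul_le_mul_right m ha
  rcases Nat.lt_or_ge (k + 1) n with c | c
  · have h1 := hmn (k + 1) c
    rw [Nat.succ_mul] at h1
    rw [Nat.mod_eq_of_lt c, raise_iterate_demote _ _ (by omega), Nat.succ_mul,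
      show k * m + i + m + 1 = k * m + m + i + 1 by omega]
  · obtain rfl : n = k + 1 := by omega
    have h1 := hmn k (by omega)
    have h2 : m * (k + 1) = k * m + m := by rw [Nat.mul_succ, mul_comm]
    rw [Nat.mod_self, zero_mul, zero_add]
    have e : demote^[m] T = demote^[m - 2 - i] ((demote^[i] T).demote.demote) := by
      rw [← Function.iterate_succ_apply' demote, ← Function.iterate_succ_apply' demote,
        ← Function.iterate_add_apply]
      congr 2
      omega
    have h3 := raise_demote_demote hw (s := m * (k + 1)) (by omega) (demote^[i] T)
    have h4 := raise_iterate_demote T i (i := 0) (by omega)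
    rw [zero_add] at h4
    rw [h4] at h3
    rw [e, raise_iterate_demote _ _ (by omega),
      show k * m + i + (m - 2 - i) + 1 = m * (k + 1) - 1 by omega, h3, Option.map_map,
      Option.map_map]
    congr 1
    · funext U
      simp only [Function.comp_apply]
      rw [← Function.iterate_succ_apply' demote, ← Function.iterate_succ_apply' demote,
        ← Function.iterate_add_apply]
      congr 2
      omega
    · rw [zero_add]

end Rectangle

end Tab

/-! ### Blocks -/

theorem mul_add_le_mul {m n k : ℕ} (hk : k < n) : k * m + m ≤ m * n := by
  rw [mul_comm m n, ← Nat.succ_mul]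
  exact Nat.mul_le_mul_right m hk

theorem RaisesTo.le {i : ℕ} {x y : ℕ → ℕ → ℕ} (h : RaisesTo i x y) (k r : ℕ) :
    x k r ≤ y k r := by
  obtain ⟨p, -, hy, hk⟩ := h
  by_cases c : k = i + 1
  · subst c
    rw [hy]
    simp only [incRow]
    split_ifs <;> omega
  · rw [hk k c]

namespace Tab

variable {κ : YoungDiagram} {s m n : ℕ}

theorem shapeLE_eq {T T' : Tab κ s} {a : ℕ} (h : T.pat a = T'.pat a) :
    T.shapeLE a = T'.shapeLE a := by
  ext ⟨r, c⟩
  rw [YoungDiagram.mem_cells, YoungDiagram.mem_cells, YoungDiagram.mem_iff_lt_rowLen,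
    YoungDiagram.mem_iff_lt_rowLen]
  exact Iff.of_eq (congrArg (c < ·) (congrFun h r))

/-- The pattern of the skew tableau `φ_k(T)`, constant from level `m` on. -/
def blockPat (T : Tab κ s) (m k : ℕ) : ℕ → ℕ → ℕ := fun i => T.pat (k * m + min i m)

theorem blockPat_of_le (T : Tab κ s) {i : ℕ} (k : ℕ) (hi : i ≤ m) :
    T.blockPat m k i = T.pat (k * m + i) := by
  unfold blockPat
  rw [min_eq_left hi]

theorem blockPat_zero (T : Tab κ s) (m k : ℕ) : T.blockPat m k 0 = (T.shapeLE (k * m)).rowLen := by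
  rw [T.blockPat_of_le k (Nat.zero_le m)]
  rfl

theorem isPattern_blockPat (T : Tab κ s) (m k : ℕ) :
    IsPattern (κ.colLen 0) (T.blockPat m k) where
  le_succ i r := T.isPattern_pat.mono (by omega) r
  succ_le i r := by
    unfold blockPat
    rcases Nat.lt_or_ge i m with c | c
    · rw [min_eq_left c.le, min_eq_left (show i + 1 ≤ m from c), ← add_assoc]
      exact T.isPattern_pat.succ_le _ r
    · rw [min_eq_right c, min_eq_right (by omega)]
      exact T.isPattern_pat.succ_row_le _ r
  zero i r hr := T.isPattern_pat.zero _ r hr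

theorem blockPat_stationary (T : Tab κ s) (k : ℕ) :
    ∀ i, m ≤ i → T.blockPat m k i = T.blockPat m k m := by
  intro i hi
  unfold blockPat
  rw [min_eq_right hi, min_self]

theorem represents_blockPat (T : Tab κ s) (m k : ℕ) :
    Represents (T.blockPat m k) (T.block m k) := by
  have hmem : ∀ {r c}, (r, c) ∈ (T.block m k).shape ↔ (r, c) ∈ κ ∧ T.1 r c ≤ (k + 1) * m := by
    intro r c
    rw [← YoungDiagram.mem_cells]
    simp [block, shapeLE]
  refine ⟨fun i r c => ?_, fun r c h => ?_⟩
  · rw [hmem]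
    unfold blockPat
    rw [lt_pat]
    simp only [block]
    rw [Nat.succ_mul]
    constructor
    · rintro ⟨h1, h2⟩
      refine ⟨⟨h1, by omega⟩, ?_⟩
      split_ifs <;> omega
    · rintro ⟨⟨h1, h2⟩, h3⟩
      refine ⟨h1, ?_⟩
      split_ifs at h3 <;> omega
  · rw [hmem, not_and, not_le] at h
    simp only [block]
    by_cases hm : (r, c) ∈ κ
    · rw [if_neg (by have := h hm; omega)]
    · rw [T.1.zeros hm, if_neg (by omega)]

/-- The pattern of the rectification of `φ_k(T)`. -/
def blockRect (T : Tab κ s) (m k : ℕ) : ℕ → ℕ → ℕ :=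
  slides (cornerRows (T.shapeLE (k * m))) (T.blockPat m k)

/-- The rows in which the slides of the rectification of `φ_k(T)` end. Together with the
rectification, they determine `φ_k(T)`. -/
def blockEnds (T : Tab κ s) (m k : ℕ) : List ℕ :=
  slideEnds m (cornerRows (T.shapeLE (k * m))) (T.blockPat m k)

theorem admissible_block (T : Tab κ s) (m k : ℕ) :
    Admissible (cornerRows (T.shapeLE (k * m))) (T.blockPat m k 0) :=
  admissible_cornerRows (T.blockPat_zero m k)

theorem isPattern_blockRect (T : Tab κ s) (m k : ℕ) : IsPattern (κ.colLen 0) (T.blockRect m k) :=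
  slides_isPattern (T.isPattern_blockPat m k) (T.admissible_block m k)

theorem blockRect_zero (T : Tab κ s) (m k : ℕ) : T.blockRect m k 0 = 0 :=
  slides_cornerRows_zero (T.blockPat_zero m k)

theorem blockRect_stationary (T : Tab κ s) (k : ℕ) {i : ℕ} (hi : m ≤ i) :
    T.blockRect m k i = T.blockRect m k m :=
  slides_stationary (T.isPattern_blockPat m k) (T.admissible_block m k) (T.blockPat_stationary k) hi

theorem represents_blockRect (T : Tab κ s) (m k : ℕ) :
    Represents (T.blockRect m k) (rect (T.shapeLE (k * m)) (T.block m k)) :=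
  (T.represents_blockPat m k).rect (T.isPattern_blockPat m k) (T.blockPat_stationary k)
    (T.blockPat_zero m k)

theorem size_blockRect (T : Tab κ s) (k : ℕ) {r : ℕ} (hr : r < m) :
    (size (κ.colLen 0) (T.blockRect m k (r + 1)) : ℤ) - size (κ.colLen 0) (T.blockRect m k r) =
      T.content (k * m + r) := by
  have h1 := size_slides (T.isPattern_blockPat m k) (T.admissible_block m k) r
  have h2 := size_slides (T.isPattern_blockPat m k) (T.admissible_block m k) (r + 1)
  rw [T.blockPat_of_le k hr.le] at h1
  rw [T.blockPat_of_le k (show r + 1 ≤ m from hr)] at h2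
  unfold content blockRect
  rw [add_assoc]
  omega

/-- A raising operator belonging to the block `k` changes only the interior levels of that
block. -/
theorem pat_eq_of_raise {T T' : Tab κ s} {k i : ℕ} (hi : i + 2 ≤ m) (hs : k * m + m ≤ s)
    (h : T.raise (k * m + i + 1) = some T') {l : ℕ} (hl : l ≤ k * m ∨ k * m + m ≤ l) :
    T'.pat l = T.pat l := by
  obtain ⟨p, -, -, hk⟩ := (raise_eq_some_iff (by omega)).1 h
  exact hk l (by omega)

theorem shapeLE_eq_of_raise {T T' : Tab κ s} {k i : ℕ} (hi : i + 2 ≤ m) (hs : k * m + m ≤ s)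
    (h : T.raise (k * m + i + 1) = some T') (k' : ℕ) :
    T'.shapeLE (k' * m) = T.shapeLE (k' * m) := by
  refine shapeLE_eq (pat_eq_of_raise hi hs h ?_)
  rcases Nat.lt_or_ge k k' with c | c
  · exact Or.inr (by rw [← Nat.succ_mul]; exact Nat.mul_le_mul_right m c)
  · exact Or.inl (Nat.mul_le_mul_right m c)

theorem blockPat_eq_of_raise {T T' : Tab κ s} {k i : ℕ} (hi : i + 2 ≤ m) (hs : k * m + m ≤ s)
    (h : T.raise (k * m + i + 1) = some T') {k' : ℕ} (hk : k' ≠ k) :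
    T'.blockPat m k' = T.blockPat m k' := by
  funext l
  refine pat_eq_of_raise hi hs h ?_
  rcases hk.lt_or_gt with c | c
  · have := Nat.mul_le_mul_right m (Nat.succ_le_of_lt c)
    rw [Nat.succ_mul] at this
    omega
  · have := Nat.mul_le_mul_right m (Nat.succ_le_of_lt c)
    rw [Nat.succ_mul] at this
    omega

theorem blockRect_eq_of_raise {T T' : Tab κ s} {k i : ℕ} (hi : i + 2 ≤ m) (hs : k * m + m ≤ s)
    (h : T.raise (k * m + i + 1) = some T') {k' : ℕ} (hk : k' ≠ k) :
    T'.blockRect m k' = T.blockRect m k' := by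
  unfold blockRect
  rw [shapeLE_eq_of_raise hi hs h, blockPat_eq_of_raise hi hs h hk]

/-- The raising operators of the block `k` are those of the rectification of `φ_k(T)`. -/
theorem raisesTo_blockRect {T T' : Tab κ s} {k i : ℕ} (hi : i + 2 ≤ m) (hs : k * m + m ≤ s)
    (h : T.raise (k * m + i + 1) = some T') :
    RaisesTo i (T.blockRect m k) (T'.blockRect m k) ∧ T'.blockEnds m k = T.blockEnds m k := by
  obtain ⟨p, hp, hy, hk⟩ := (raise_eq_some_iff (by omega)).1 h
  have hb : RaisesTo i (T.blockPat m k) (T'.blockPat m k) := by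
    refine ⟨p, ?_, ?_, fun l hl => ?_⟩
    · rw [T.blockPat_of_le k (by omega), T.blockPat_of_le k (by omega),
        T.blockPat_of_le k (by omega)]
      exact hp
    · rw [T.blockPat_of_le k (by omega), T'.blockPat_of_le k (by omega)]
      exact hy
    · exact hk _ (by omega)
  obtain ⟨h1, h2⟩ := hb.slides (T.isPattern_blockPat m k) (T.admissible_block m k)
  unfold blockRect blockEnds
  rw [shapeLE_eq_of_raise hi hs h]
  exact ⟨h1, h2 m (by omega)⟩

theorem blockEnds_eq_of_raise {T T' : Tab κ s} {k i : ℕ} (hi : i + 2 ≤ m) (hs : k * m + m ≤ s)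
    (h : T.raise (k * m + i + 1) = some T') (k' : ℕ) : T'.blockEnds m k' = T.blockEnds m k' := by
  by_cases hk : k' = k
  · rw [hk]
    exact (raisesTo_blockRect hi hs h).2
  · unfold blockEnds
    rw [shapeLE_eq_of_raise hi hs h, blockPat_eq_of_raise hi hs h hk]

theorem exists_raise_of_blockRect (T : Tab κ s) {k i : ℕ} (hi : i + 2 ≤ m) (hs : k * m + m ≤ s)
    (h : ∃ y, RaisesTo i (T.blockRect m k) y) : ∃ T', T.raise (k * m + i + 1) = some T' := by
  have h1 := exists_raisesTo_of_slides (T.isPattern_blockPat m k) (T.admissible_block m k) h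
  rw [exists_raisesTo_iff (T.isPattern_blockPat m k), T.blockPat_of_le k (by omega),
    T.blockPat_of_le k (by omega), T.blockPat_of_le k (by omega)] at h1
  exact (exists_raise_eq_some_iff (by omega)).2
    ((exists_raisesTo_iff T.isPattern_pat (k * m + i)).2 h1)

theorem exists_lower_of_blockRect {N : ℕ} (T : Tab κ s) {k i : ℕ} (hi : i + 2 ≤ m)
    (hs : k * m + m ≤ s) {y : ℕ → ℕ → ℕ} (hy : IsPattern N y)
    (h : RaisesTo i y (T.blockRect m k)) : ∃ T' : Tab κ s, T'.raise (k * m + i + 1) = some T := by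
  have hy : IsPattern (κ.colLen 0) y := ⟨hy.le_succ, hy.succ_le, fun l r hr =>
    Nat.le_zero.1 ((h.le l r).trans_eq ((T.isPattern_blockRect m k).zero l r hr))⟩
  obtain ⟨z, hz, hz'⟩ := exists_raisesTo_left_of_slides (i := i) (T.isPattern_blockPat m k)
    (T.admissible_block m k) ⟨y, hy, h⟩
  have h1 := (exists_raisesTo_left_iff (T.isPattern_blockPat m k) i).1 ⟨z, hz, hz'⟩
  rw [T.blockPat_of_le k (by omega), T.blockPat_of_le k (by omega),
    T.blockPat_of_le k (by omega)] at h1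
  obtain ⟨x, hx, hx'⟩ := (exists_raisesTo_left_iff T.isPattern_pat (k * m + i)).2 h1
  exact exists_lower_of_raisesTo (by omega) hx hx'

theorem height_blockRect_nonpos (T : Tab κ s) {k : ℕ} (hs : k * m + m ≤ s)
    (h : ∀ i, i + 2 ≤ m → T.raise (k * m + i + 1) = none) :
    ∀ i, i + 2 ≤ m → ∀ p,
      height (T.blockRect m k i) (T.blockRect m k (i + 1)) (T.blockRect m k (i + 2)) p ≤ 0 := by
  intro i hi p
  by_contra hp
  obtain ⟨T', hT'⟩ := T.exists_raise_of_blockRect hi hs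
    ((exists_raisesTo_iff (T.isPattern_blockRect m k) i).2 ⟨p, not_le.1 hp⟩)
  rw [h i hi] at hT'
  exact absurd hT' (by simp)

/-- A tableau is determined by the rectifications of its blocks and by data that the raising
operators of the blocks do not change. -/
theorem eq_of_blockRect {T T' : Tab κ (m * n)}
    (hshape : ∀ k < n, T.shapeLE (k * m) = T'.shapeLE (k * m))
    (hends : ∀ k < n, T.blockEnds m k = T'.blockEnds m k)
    (hrect : ∀ k < n, T.blockRect m k = T'.blockRect m k) : T = T' := by
  refine pat_injective (funext fun l => ?_)
  rcases Nat.lt_or_ge l (m * n) with hl | hl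
  swap
  · rw [pat_of_le _ hl, pat_of_le _ hl]
  have hm : 0 < m := Nat.pos_of_mul_pos_right (by omega : 0 < m * n)
  have hk : l / m < n := Nat.div_lt_of_lt_mul hl
  have e : l = l / m * m + l % m := (Nat.div_add_mod' l m).symm
  have hlt : l % m ≤ m := (Nat.mod_lt l hm).le
  have h1 := hends _ hk
  have h2 := hrect _ hk
  have h3 := T'.admissible_block m (l / m)
  unfold blockEnds at h1
  unfold blockRect at h2
  rw [← hshape _ hk] at h1 h2 h3
  have h4 := slides_injective (T.isPattern_blockPat m _) (T'.isPattern_blockPat m _)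
    (T.admissible_block m _) h3 h1 (fun k _ => by rw [h2]) _ hlt
  rwa [T.blockPat_of_le _ hlt, T'.blockPat_of_le _ hlt, ← e] at h4

/-! ### Promotion and blocks -/

section Rectangle

variable {w : ℕ}

/-- The inverse of the action of `j` rotates the rectified blocks of a rectangular tableau. -/
theorem blockRect_demote (hw : ∀ r, r < κ.colLen 0 → κ.rowLen r = w) (T : Tab κ (m * n)) {k : ℕ}
    (hk : k < n) : (demote^[m] T).blockRect m k = T.blockRect m ((k + 1) % n) := by
  have hk1 : (k + 1) % n < n := Nat.mod_lt _ (by omega)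
  have hs := mul_add_le_mul (m := m) hk
  have hs1 := mul_add_le_mul (m := m) hk1
  have hI : ∀ j, (∃ i, i + 2 ≤ m ∧ j = (k + 1) % n * m + i) → j + 2 ≤ m * n := by
    rintro j ⟨i, hi, rfl⟩
    omega
  induction T using raise_induction (hI := hI) with
  | h T ih =>
    by_cases hT : ∃ i T', i + 2 ≤ m ∧ T.raise ((k + 1) % n * m + i + 1) = some T'
    · obtain ⟨i, T', hi, hT'⟩ := hT
      have h1 := ih _ ⟨i, hi, rfl⟩ T' hT'
      have h2 := raise_blockDemotion hw T hk hi
      rw [hT', Option.map_some] at h2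
      have h3 := (raisesTo_blockRect hi hs h2).1
      rw [h1] at h3
      exact h3.unique_left (raisesTo_blockRect hi hs1 hT').1
    · have hnone : ∀ i, i + 2 ≤ m → T.raise ((k + 1) % n * m + i + 1) = none := by
        intro i hi
        rw [Option.eq_none_iff_forall_ne_some]
        exact fun T' hT' => hT ⟨i, T', hi, hT'⟩
      have hnone' : ∀ i, i + 2 ≤ m → (demote^[m] T).raise (k * m + i + 1) = none := by
        intro i hi
        rw [raise_blockDemotion hw T hk hi, hnone i hi]
        rfl
      have key : ∀ l, l ≤ m →
          (demote^[m] T).blockRect m k l = T.blockRect m ((k + 1) % n) l := by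
        intro l hl
        refine highest_unique (isPattern_blockRect _ _ _) (isPattern_blockRect _ _ _)
          (blockRect_zero _ _ _) (blockRect_zero _ _ _) (height_blockRect_nonpos _ hs hnone')
          (height_blockRect_nonpos _ hs1 hnone) (fun r hr => ?_) hl
        rw [size_blockRect _ _ hr, size_blockRect _ _ hr, content_iterate_demote _ _ (by omega)]
        congr 1
        rcases Nat.lt_or_ge (k + 1) n with c | c
        · rw [Nat.mod_eq_of_lt c] at hs1 ⊢
          rw [Nat.succ_mul] at hs1 ⊢
          rw [Nat.mod_eq_of_lt (by omega)]
          omega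
        · obtain rfl : n = k + 1 := by omega
          have h2 : m * (k + 1) = k * m + m := by rw [Nat.mul_succ, mul_comm]
          rw [Nat.mod_self, zero_mul, zero_add, h2, show k * m + r + m = r + (k * m + m) by omega,
            Nat.add_mod_right, Nat.mod_eq_of_lt (by omega)]
      funext l
      rcases Nat.lt_or_ge l m with c | c
      · exact key l c.le
      · rw [blockRect_stationary _ _ c, blockRect_stationary _ _ c]
        exact key m le_rfl

theorem iterate_demote_blockPromotion (T : Tab κ s) : demote^[m] (blockPromotion m T) = T :=
  Function.LeftInverse.iterate (f := promotion) (g := demote) demote_promotion m T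

theorem blockPromotion_iterate_demote (T : Tab κ s) : blockPromotion m (demote^[m] T) = T :=
  Function.LeftInverse.iterate (f := demote) (g := promotion) promotion_demote m T

theorem blocks_blockPromotion (hw : ∀ r, r < κ.colLen 0 → κ.rowLen r = w) (T : Tab κ (m * n))
    (k : Fin n) : (blockPromotion m T).blocks m n ⟨(k + 1) % n, Nat.mod_lt _ k.pos⟩ =
      T.blocks m n k := by
  refine (represents_blockRect _ m _).filling_unique ?_
  have := blockRect_demote hw (blockPromotion m T) k.2
  rw [iterate_demote_blockPromotion] at this
  rw [← this]
  exact T.represents_blockRect m k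

theorem blocks_iterate_blockPromotion (hw : ∀ r, r < κ.colLen 0 → κ.rowLen r = w)
    (T : Tab κ (m * n)) (t : ℕ) (k : Fin n) :
    ((blockPromotion m)^[t] T).blocks m n ⟨(k + t) % n, Nat.mod_lt _ k.pos⟩ = T.blocks m n k := by
  induction t with
  | zero =>
    congr 1
    exact Fin.ext (Nat.mod_eq_of_lt k.2)
  | succ t ih =>
    rw [← ih, Function.iterate_succ_apply']
    refine Eq.trans ?_ (blocks_blockPromotion hw _ _)
    congr 1
    refine Fin.ext ?_
    simp only [Nat.mod_add_mod, add_assoc]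

theorem blocks_iterate_eq_cyclicShift (hw : ∀ r, r < κ.colLen 0 → κ.rowLen r = w)
    (T : Tab κ (m * n)) {d : ℕ} (hd : d ∣ n) :
    ((blockPromotion m)^[d] T).blocks m n = cyclicShift d (T.blocks m n) := by
  funext k
  have hdn : d ≤ n := Nat.le_of_dvd k.pos hd
  have := blocks_iterate_blockPromotion hw T d ⟨(k + (n - d)) % n, Nat.mod_lt _ k.pos⟩
  unfold cyclicShift
  rw [← this]
  congr 1
  refine Fin.ext ?_
  simp only [Nat.mod_add_mod]
  rw [show (k : ℕ) + (n - d) + d = k + n by omega, Nat.add_mod_right, Nat.mod_eq_of_lt k.2]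

end Rectangle

end Tab

/-! ### Connected components of crystals -/

namespace CrystalOps

variable {I X Y : Type} {A : CrystalOps I X} {A' : CrystalOps I Y}

/-- A function that the raising operators preserve is constant on connected components. -/
theorem eq_of_mem_supp {α : Type*} {f : X → α}
    (hf : ∀ i x y, A.e i x = some y → f y = f x) {C : A.graph.ConnectedComponent} {x y : X}
    (hx : x ∈ C.supp) (hy : y ∈ C.supp) : f x = f y := by
  obtain ⟨p⟩ : A.graph.Reachable x y := by
    rw [← SimpleGraph.ConnectedComponent.eq]
    exact hx.trans hy.symm
  induction p with
  | nil => rfl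
  | @cons u v w huv p ih =>
    have hv : v ∈ C.supp := (C.mem_supp_congr_adj huv).1 hx
    rw [← ih hv hy]
    rcases huv.2 with ⟨i, h⟩ | ⟨i, h⟩
    · exact (hf i _ _ h).symm
    · exact hf i _ _ h

theorem connectedComponentMk_eq {i : I} {x y : X} (h : A.e i x = some y) :
    A.graph.connectedComponentMk y = A.graph.connectedComponentMk x := by
  by_cases hxy : x = y
  · rw [hxy]
  · exact SimpleGraph.ConnectedComponent.sound
      (SimpleGraph.Adj.reachable (G := A.graph) ⟨Ne.symm hxy, Or.inr ⟨i, h⟩⟩)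

theorem mem_supp_iff_of_e {C : A.graph.ConnectedComponent} {i : I} {x y : X}
    (h : A.e i x = some y) : y ∈ C.supp ↔ x ∈ C.supp := by
  rw [SimpleGraph.ConnectedComponent.mem_supp_iff, SimpleGraph.ConnectedComponent.mem_supp_iff,
    connectedComponentMk_eq h]

/-- When the lowering operators are the partial inverses of the raising operators, it suffices that
a bijection commutes with the latter. -/
theorem isComponentIso_of_e {C : A.graph.ConnectedComponent} (Φ : C.supp ≃ Y)
    (hA : ∀ i x y, A.f i y = some x ↔ A.e i x = some y)
    (hA' : ∀ i x y, A'.f i y = some x ↔ A'.e i x = some y)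
    (he : ∀ (i : I) (b b' : C.supp), A.e i b = some b'.1 → A'.e i (Φ b) = some (Φ b'))
    (hne : ∀ (i : I) (b : C.supp) (y : Y), A'.e i (Φ b) = some y → ∃ x, A.e i b = some x) :
    A.IsComponentIso A' C Φ := by
  have he' : ∀ (i : I) (b b' : C.supp), A.e i b = some b'.1 ↔ A'.e i (Φ b) = some (Φ b') := by
    refine fun i b b' => ⟨he i b b', fun h => ?_⟩
    obtain ⟨x, hx⟩ := hne i b _ h
    have h1 := he i b ⟨x, (mem_supp_iff_of_e hx).2 b.2⟩ hx
    rw [h, Option.some.injEq, Φ.apply_eq_iff_eq] at h1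
    rw [hx, h1]
  refine fun i b => ⟨Option.ext fun x => ?_, Option.ext fun x => ?_⟩
  · rw [Option.map_eq_some_iff]
    constructor
    · intro h
      exact ⟨_, he i b ⟨x, (mem_supp_iff_of_e h).2 b.2⟩ h, by rw [Φ.symm_apply_apply]⟩
    · rintro ⟨y, hy, rfl⟩
      rw [he', hy, Φ.apply_symm_apply]
  · rw [Option.map_eq_some_iff, hA]
    constructor
    · intro h
      refine ⟨Φ ⟨x, (mem_supp_iff_of_e h).1 b.2⟩, ?_, by rw [Φ.symm_apply_apply]⟩
      rw [hA']
      exact he i ⟨x, _⟩ b h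
    · rintro ⟨y, hy, rfl⟩
      rw [he', ← hA', hy, Φ.apply_symm_apply]

end CrystalOps

/-- The invariant tuples of a cyclic shift by a divisor `d` of `n` are the `d`-periodic ones. -/
theorem cyclicShift_eq_self_iff {X : Type} {n d : ℕ} (hdn : d ∣ n) (x : Fin n → X) :
    cyclicShift d x = x ↔ ∀ k k' : Fin n, (k : ℕ) ≡ k' [MOD d] → x k = x k' := by
  constructor
  · intro h
    have key : ∀ k (hk : k < n), x ⟨k, hk⟩ = x ⟨k % d, (Nat.mod_le k d).trans_lt hk⟩ := by
      intro k
      induction k using Nat.strong_induction_on with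
      | _ k ih =>
        intro hk
        have hdn' := Nat.le_of_dvd (by omega) hdn
        have hd : 0 < d := Nat.pos_of_dvd_of_pos hdn (by omega)
        rcases Nat.lt_or_ge k d with c | c
        · congr 1
          exact Fin.ext (Nat.mod_eq_of_lt c).symm
        · have h1 := congrFun h ⟨k, hk⟩
          have e : (k + (n - d)) % n = k - d := by
            rw [show k + (n - d) = k - d + n by omega, Nat.add_mod_right,
              Nat.mod_eq_of_lt (by omega)]
          simp only [cyclicShift, e] at h1
          rw [← h1, ih _ (by omega)]
          congr 1
          exact Fin.ext (Nat.mod_eq_sub_mod c).symm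
    intro k k' hkk'
    rw [key k k.2, key k' k'.2]
    congr 1
    exact Fin.ext hkk'
  · intro h
    funext k
    refine h _ _ ?_
    have hdn' := Nat.le_of_dvd k.pos hdn
    change (k + (n - d)) % n % d = k % d
    rw [Nat.mod_mod_of_dvd _ hdn]
    obtain ⟨q, hq⟩ := Nat.dvd_sub hdn (dvd_refl d)
    rw [hq, Nat.add_mul_mod_self_left]

/-! ### Highest weight tableaux -/

/-- The filling of a highest weight pattern that begins with the empty diagram is `b_β`. -/
theorem represents_highestFilling {N m : ℕ} {x : ℕ → ℕ → ℕ} {β : YoungDiagram}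
    (hx : IsPattern N x) (hx0 : x 0 = 0) (hs : ∀ k, m ≤ k → x k = β.rowLen)
    (h : ∀ i, i + 2 ≤ m → ∀ p, height (x i) (x (i + 1)) (x (i + 2)) p ≤ 0) :
    Represents x (highestFilling β) := by
  refine ⟨fun k r c => ?_, fun r c hm => if_neg hm⟩
  change c < x k r ↔ (r, c) ∈ β ∧ (if (r, c) ∈ β then r + 1 else 0) ≤ k
  rcases Nat.lt_or_ge r k with hr | hr
  · have e : x k r = β.rowLen r := by
      rcases Nat.lt_or_ge k m with hk | hk
      · rw [highest_eq hx h hr hk.le, hs m le_rfl]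
      · rw [hs k hk]
    rw [e, ← YoungDiagram.mem_iff_lt_rowLen]
    refine ⟨fun hm => ⟨hm, ?_⟩, fun hm => hm.1⟩
    rw [if_pos hm]
    omega
  · rw [hx.eq_zero_of_le hx0 hr]
    simp only [Nat.not_lt_zero, false_iff, not_and]
    intro hm
    rw [if_pos hm]
    omega

/-- Highest weight patterns that begin with the empty diagram are determined by their shape. -/
theorem highest_unique_of_shape {L N N' : ℕ} {x y : ℕ → ℕ → ℕ} (hx : IsPattern N x)
    (hy : IsPattern N' y) (hx0 : x 0 = 0) (hy0 : y 0 = 0)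
    (hsx : ∀ k, L ≤ k → x k = x L) (hsy : ∀ k, L ≤ k → y k = y L)
    (hhx : ∀ i, i + 2 ≤ L → ∀ p, height (x i) (x (i + 1)) (x (i + 2)) p ≤ 0)
    (hhy : ∀ i, i + 2 ≤ L → ∀ p, height (y i) (y (i + 1)) (y (i + 2)) p ≤ 0)
    (h : x L = y L) : x = y := by
  funext k r
  rcases Nat.lt_or_ge k L with hk | hk
  · rcases Nat.lt_or_ge r k with hr | hr
    · rw [highest_eq hx hhx hr hk.le, highest_eq hy hhy hr hk.le, h]
    · rw [hx.eq_zero_of_le hx0 hr, hy.eq_zero_of_le hy0 hr]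
  · rw [hsx k hk, hsy k hk, h]

/-! ### Components of the block crystal -/

section BlockCrystal

variable {κ : YoungDiagram} {m n : ℕ}

theorem add_two_le (a : Fin n × Fin (m - 1)) : (a.2 : ℕ) + 2 ≤ m := by
  have := a.2.2
  omega

theorem blockCrystal_e_eq_some_iff {a : Fin n × Fin (m - 1)} {T T' : Tab κ (m * n)} :
    (blockCrystal κ m n).e a T = some T' ↔ T.raise (a.1 * m + a.2 + 1) = some T' := Iff.rfl

theorem blockCrystal_f_eq_some_iff (a : Fin n × Fin (m - 1)) (T T' : Tab κ (m * n)) :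
    (blockCrystal κ m n).f a T' = some T ↔ (blockCrystal κ m n).e a T = some T' :=
  Tab.lower_eq_some_iff (by
    have := mul_add_le_mul (m := m) a.1.2
    have := add_two_le a
    omega)

theorem isHighestWeight_iff {T : Tab κ (m * n)} : (blockCrystal κ m n).IsHighestWeight T ↔
    ∀ k i, k < n → i + 2 ≤ m → T.raise (k * m + i + 1) = none :=
  ⟨fun h k i hk hi => h (⟨k, hk⟩, ⟨i, by omega⟩), fun h a => h _ _ a.1.2 (add_two_le a)⟩

variable {C : (blockCrystal κ m n).graph.ConnectedComponent} {T T' : Tab κ (m * n)}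

theorem exists_highestWeight_mem (C : (blockCrystal κ m n).graph.ConnectedComponent) :
    ∃ b ∈ C.supp, (blockCrystal κ m n).IsHighestWeight b := by
  obtain ⟨T, hT⟩ := C.nonempty_supp
  induction T using induction_of_finite (w := Tab.weight) with
  | h T ih =>
    by_cases h : (blockCrystal κ m n).IsHighestWeight T
    · exact ⟨T, hT, h⟩
    · obtain ⟨a, ha⟩ := not_forall.1 h
      obtain ⟨T', hT'⟩ := Option.ne_none_iff_exists'.1 ha
      have := mul_add_le_mul (m := m) a.1.2
      have := add_two_le a
      exact ih T' (Tab.weight_lt_of_raise (by omega) hT')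
        ((CrystalOps.mem_supp_iff_of_e hT').2 hT)

theorem shapeLE_eq_of_mem (hT : T ∈ C.supp) (hT' : T' ∈ C.supp) (k : ℕ) :
    T.shapeLE (k * m) = T'.shapeLE (k * m) :=
  CrystalOps.eq_of_mem_supp (f := fun T => T.shapeLE (k * m))
    (fun a _ _ h => Tab.shapeLE_eq_of_raise (add_two_le a) (mul_add_le_mul a.1.2) h k) hT hT'

theorem blockEnds_eq_of_mem (hT : T ∈ C.supp) (hT' : T' ∈ C.supp) (k : ℕ) :
    T.blockEnds m k = T'.blockEnds m k :=
  CrystalOps.eq_of_mem_supp (f := fun T => T.blockEnds m k)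
    (fun a _ _ h => Tab.blockEnds_eq_of_raise (add_two_le a) (mul_add_le_mul a.1.2) h k) hT hT'

theorem blockRect_last_eq_of_mem (hT : T ∈ C.supp) (hT' : T' ∈ C.supp) (k : ℕ) :
    T.blockRect m k m = T'.blockRect m k m := by
  refine CrystalOps.eq_of_mem_supp (f := fun T => T.blockRect m k m) (fun a x y h => ?_) hT hT'
  have ha := add_two_le a
  by_cases c : k = a.1
  · subst c
    obtain ⟨p, -, -, hk⟩ := (Tab.raisesTo_blockRect ha (mul_add_le_mul a.1.2) h).1
    exact hk m (by omega)
  · exact congrFun (Tab.blockRect_eq_of_raise ha (mul_add_le_mul a.1.2) h c) m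

/-- On a connected component, `φ` is injective. -/
theorem eq_of_blocks_eq (hT : T ∈ C.supp) (hT' : T' ∈ C.supp)
    (h : T.blocks m n = T'.blocks m n) : T = T' :=
  Tab.eq_of_blockRect (fun k _ => shapeLE_eq_of_mem hT hT' k)
    (fun k _ => blockEnds_eq_of_mem hT hT' k) fun k hk =>
    (T.represents_blockRect m k).pattern_unique (by
      rw [show rect _ _ = _ from congrFun h ⟨k, hk⟩]
      exact T'.represents_blockRect m k)

theorem height_blockRect_of_isHighestWeight (h : (blockCrystal κ m n).IsHighestWeight T) {k : ℕ}
    (hk : k < n) : ∀ i, i + 2 ≤ m → ∀ p,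
      height (T.blockRect m k i) (T.blockRect m k (i + 1)) (T.blockRect m k (i + 2)) p ≤ 0 :=
  T.height_blockRect_nonpos (mul_add_le_mul hk) fun i hi => isHighestWeight_iff.1 h k i hk hi

theorem isHighestWeight_unique (hT : T ∈ C.supp) (hT' : T' ∈ C.supp)
    (h : (blockCrystal κ m n).IsHighestWeight T) (h' : (blockCrystal κ m n).IsHighestWeight T') :
    T = T' :=
  Tab.eq_of_blockRect (fun k _ => shapeLE_eq_of_mem hT hT' k)
    (fun k _ => blockEnds_eq_of_mem hT hT' k) fun k hk =>
    highest_unique_of_shape (T.isPattern_blockRect m k) (T'.isPattern_blockRect m k)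
      (T.blockRect_zero m k) (T'.blockRect_zero m k) (fun _ => T.blockRect_stationary k)
      (fun _ => T'.blockRect_stationary k) (height_blockRect_of_isHighestWeight h hk)
      (height_blockRect_of_isHighestWeight h' hk) (blockRect_last_eq_of_mem hT hT' k)

/-- The shape of the rectification of `φ_k(T)`. -/
def Tab.blockShape (T : Tab κ (m * n)) (k : ℕ) : YoungDiagram :=
  (rect (T.shapeLE (k * m)) (T.block m k)).shape

theorem Tab.rowLen_blockShape (T : Tab κ (m * n)) (k : ℕ) :
    (T.blockShape k).rowLen = T.blockRect m k m := by
  funext r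
  refine eq_of_forall_lt_iff fun c => ?_
  rw [← YoungDiagram.mem_iff_lt_rowLen]
  exact (T.represents_blockRect m k).mem_shape_iff_of_stationary (T.isPattern_blockRect m k)
    fun _ => T.blockRect_stationary k

theorem Tab.colLen_blockShape_le (T : Tab κ (m * n)) (k : ℕ) : (T.blockShape k).colLen 0 ≤ m := by
  by_contra h
  have h1 := YoungDiagram.mem_iff_lt_rowLen.1 (YoungDiagram.mem_iff_lt_colLen.2 (not_le.1 h))
  rw [rowLen_blockShape,
    (T.isPattern_blockRect m k).eq_zero_of_le (T.blockRect_zero m k) le_rfl] at h1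
  exact absurd h1 (lt_irrefl 0)

theorem blockShape_eq_of_mem (hT : T ∈ C.supp) (hT' : T' ∈ C.supp) (k : ℕ) :
    T.blockShape k = T'.blockShape k := by
  ext ⟨r, c⟩
  rw [YoungDiagram.mem_cells, YoungDiagram.mem_cells, YoungDiagram.mem_iff_lt_rowLen,
    YoungDiagram.mem_iff_lt_rowLen, Tab.rowLen_blockShape, Tab.rowLen_blockShape,
    blockRect_last_eq_of_mem hT hT']

theorem blocks_of_isHighestWeight (h : (blockCrystal κ m n).IsHighestWeight T) (k : Fin n) :
    T.blocks m n k = highestFilling (T.blockShape k) :=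
  (T.represents_blockRect m k).filling_unique
    (represents_highestFilling (T.isPattern_blockRect m k) (T.blockRect_zero m k)
      (fun _ hl => by rw [T.rowLen_blockShape, T.blockRect_stationary _ hl])
      (height_blockRect_of_isHighestWeight h k.2))

end BlockCrystal

/-! ### The isomorphism with a product of crystals -/

section Product

variable {κ : YoungDiagram} {m n : ℕ} {γ : Fin n → YoungDiagram}

theorem productCrystal_e_eq_some_iff {a : Fin n × Fin (m - 1)} {U V : ∀ k, Tab (γ k) m} :
    (productCrystal m γ).e a U = some V ↔
      (U a.1).raise (a.2 + 1) = some (V a.1) ∧ ∀ k, k ≠ a.1 → V k = U k := by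
  change ((U a.1).raise (a.2 + 1)).map (Function.update U a.1) = some V ↔ _
  rw [Option.map_eq_some_iff]
  constructor
  · rintro ⟨W, hW, rfl⟩
    rw [Function.update_self]
    exact ⟨hW, fun k hk => Function.update_of_ne hk _ _⟩
  · rintro ⟨h1, h2⟩
    refine ⟨_, h1, funext fun k => ?_⟩
    by_cases c : k = a.1
    · subst c
      rw [Function.update_self]
    · rw [Function.update_of_ne c, h2 k c]

theorem productCrystal_f_eq_some_iff (a : Fin n × Fin (m - 1)) (U V : ∀ k, Tab (γ k) m) :
    (productCrystal m γ).f a V = some U ↔ (productCrystal m γ).e a U = some V := by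
  rw [productCrystal_e_eq_some_iff, ← Tab.lower_eq_some_iff (add_two_le a)]
  change ((V a.1).lower (a.2 + 1)).map (Function.update V a.1) = some U ↔ _
  rw [Option.map_eq_some_iff]
  constructor
  · rintro ⟨W, hW, rfl⟩
    rw [Function.update_self]
    exact ⟨hW, fun k hk => (Function.update_of_ne hk _ _).symm⟩
  · rintro ⟨h1, h2⟩
    refine ⟨_, h1, funext fun k => ?_⟩
    by_cases c : k = a.1
    · subst c
      rw [Function.update_self]
    · rw [Function.update_of_ne c, h2 k c]

variable {C : (blockCrystal κ m n).graph.ConnectedComponent}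

/-- A map that sends each tableau to its tuple of rectified blocks commutes with the raising
operators. -/
theorem raise_component {φ : C.supp → ∀ k, Tab (γ k) m}
    (hφ : ∀ T k, (φ T k).pat = T.1.blockRect m k) {a : Fin n × Fin (m - 1)} {T T' : C.supp}
    (h : (blockCrystal κ m n).e a T = some T'.1) :
    (productCrystal m γ).e a (φ T) = some (φ T') := by
  rw [productCrystal_e_eq_some_iff, Tab.raise_eq_some_iff (add_two_le a), hφ, hφ]
  refine ⟨(Tab.raisesTo_blockRect (add_two_le a) (mul_add_le_mul a.1.2) h).1, fun k hk => ?_⟩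
  refine Tab.pat_injective ?_
  rw [hφ, hφ]
  exact Tab.blockRect_eq_of_raise (add_two_le a) (mul_add_le_mul a.1.2) h
    fun e => hk (Fin.ext e)

/-- Each tuple is reached from the tuple of highest weight by undoing raising operators, and these can
be undone in the component as well. -/
theorem surjective_component {φ : C.supp → ∀ k, Tab (γ k) m}
    (hφ : ∀ T k, (φ T k).pat = T.1.blockRect m k) : Function.Surjective φ := by
  intro U
  induction U using induction_of_finite 
    (w := fun U : ∀ k, Tab (γ k) m => ∑ k, (U k).weight) with
  | h U ih =>
    by_cases hU : ∀ k i, i + 2 ≤ m → (U k).raise (i + 1) = none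
    · obtain ⟨b, hbC, hb⟩ := exists_highestWeight_mem C
      refine ⟨⟨b, hbC⟩, funext fun k => Tab.pat_injective ?_⟩
      rw [hφ]
      refine highest_unique_of_shape (b.isPattern_blockRect m k) (U k).isPattern_pat
        (b.blockRect_zero m k) (U k).pat_zero (fun _ => b.blockRect_stationary k)
        (U k).pat_stationary (height_blockRect_of_isHighestWeight hb k.2)
        (fun i hi => (Tab.raise_eq_none_iff hi).1 (hU k i hi)) ?_
      rw [(U k).pat_of_le le_rfl, ← (φ ⟨b, hbC⟩ k).pat_of_le le_rfl, hφ]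
    · simp only [not_forall] at hU
      obtain ⟨k, i, hi, hr⟩ := hU
      obtain ⟨V, hV⟩ := Option.ne_none_iff_exists'.1 hr
      obtain ⟨T', hT'⟩ := ih (Function.update U k V) (Finset.sum_lt_sum (fun l _ => by
        by_cases c : l = k
        · subst c
          rw [Function.update_self]
          exact (Tab.weight_lt_of_raise hi hV).le
        · rw [Function.update_of_ne c]) ⟨k, Finset.mem_univ k, by
          rw [Function.update_self]
          exact Tab.weight_lt_of_raise hi hV⟩)
      have h1 := (Tab.raise_eq_some_iff hi).1 hV
      have h2 : T'.1.blockRect m k = V.pat := by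
        rw [← hφ, hT', Function.update_self]
      obtain ⟨T, hT⟩ := T'.1.exists_lower_of_blockRect hi (mul_add_le_mul k.2)
        (U k).isPattern_pat (by rw [h2]; exact h1)
      have hT : (blockCrystal κ m n).e (k, ⟨i, by omega⟩) T = some T'.1 := hT
      have hTC : T ∈ C.supp := (CrystalOps.mem_supp_iff_of_e hT).1 T'.2
      refine ⟨⟨T, hTC⟩, funext fun l => ?_⟩
      obtain ⟨h3, h4⟩ := productCrystal_e_eq_some_iff.1
        (raise_component hφ (T := ⟨T, hTC⟩) hT)
      by_cases c : l = k
      · subst c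
        rw [hT', Function.update_self] at h3
        exact Tab.raise_injective hi h3 hV
      · rw [← h4 l c, hT', Function.update_of_ne c]

/-- The map `φ` identifies a connected component with a product of crystals. -/
theorem exists_componentIso (hγ : ∀ T ∈ C.supp, ∀ k : Fin n, T.blockShape k = γ k) :
    ∃ Φ : C.supp ≃ (∀ k, Tab (γ k) m),
      (∀ T : C.supp, T.1.blocks m n = fun k => (Φ T k).toFilling) ∧
      (blockCrystal κ m n).IsComponentIso (productCrystal m γ) C Φ := by
  have hex : ∀ (T : C.supp) (k : Fin n), ∃ U : Tab (γ k) m, U.pat = T.1.blockRect m k := by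
    intro T k
    refine Tab.exists_pat_eq (T.1.isPattern_blockRect m k) (T.1.blockRect_zero m k)
      fun l hl => ?_
    rw [← hγ T.1 T.2 k, T.1.rowLen_blockShape, T.1.blockRect_stationary _ hl]
  choose φ hφ using hex
  have hfill : ∀ T : C.supp, T.1.blocks m n = fun k => (φ T k).toFilling := fun T =>
    funext fun k => (T.1.represents_blockRect m k).filling_unique
      (hφ T k ▸ (φ T k).represents_pat)
  have hinj : Function.Injective φ := fun T T' h =>
    Subtype.ext (eq_of_blocks_eq T.2 T'.2 (by rw [hfill, hfill, h]))
  have hbij : Function.Bijective φ := ⟨hinj, surjective_component hφ⟩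
  refine ⟨Equiv.ofBijective φ hbij, hfill,
    CrystalOps.isComponentIso_of_e _ blockCrystal_f_eq_some_iff productCrystal_f_eq_some_iff
      (fun a T T' h => raise_component hφ h) fun a T V h => ?_⟩
  obtain ⟨h1, -⟩ := productCrystal_e_eq_some_iff.1 h
  rw [Tab.raise_eq_some_iff (add_two_le a)] at h1
  change RaisesTo _ (φ T a.1).pat _ at h1
  rw [hφ] at h1
  exact T.1.exists_raise_of_blockRect (add_two_le a) (mul_add_le_mul a.1.2) ⟨_, h1⟩

end Product

/-! ### The action of `j` on components -/

section Rectangle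

variable {κ : YoungDiagram} {m n w : ℕ}

/-- The action of `j` carries edges of the crystal graph to edges. -/
theorem exists_e_blockPromotion (hw : ∀ r, r < κ.colLen 0 → κ.rowLen r = w)
    {a : Fin n × Fin (m - 1)} {T T' : Tab κ (m * n)}
    (h : (blockCrystal κ m n).e a T = some T') :
    ∃ a', (blockCrystal κ m n).e a' (Tab.blockPromotion m T) =
      some (Tab.blockPromotion m T') := by
  have h1 := Tab.raise_blockDemotion hw (Tab.blockPromotion m T) a.1.2 (add_two_le a)
  rw [Tab.iterate_demote_blockPromotion, blockCrystal_e_eq_some_iff.1 h, eq_comm,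
    Option.map_eq_some_iff] at h1
  obtain ⟨V, hV, rfl⟩ := h1
  refine ⟨(⟨(a.1 + 1) % n, Nat.mod_lt _ a.1.pos⟩, a.2), ?_⟩
  rw [Tab.blockPromotion_iterate_demote]
  exact hV

theorem isHighestWeight_blockPromotion (hw : ∀ r, r < κ.colLen 0 → κ.rowLen r = w)
    {T : Tab κ (m * n)} (h : (blockCrystal κ m n).IsHighestWeight T) :
    (blockCrystal κ m n).IsHighestWeight (Tab.blockPromotion m T) := by
  rw [isHighestWeight_iff] at h ⊢
  intro k i hk hi
  have h1 := Tab.raise_blockDemotion hw (Tab.blockPromotion m T) (k := (k + (n - 1)) % n)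
    (Nat.mod_lt _ (by omega)) hi
  rw [Tab.iterate_demote_blockPromotion, h _ i (Nat.mod_lt _ (by omega)) hi, Nat.mod_add_mod,
    show k + (n - 1) + 1 = k + n by omega, Nat.add_mod_right, Nat.mod_eq_of_lt hk, eq_comm,
    Option.map_eq_none_iff] at h1
  exact h1

theorem mem_supp_blockPromotion (hw : ∀ r, r < κ.colLen 0 → κ.rowLen r = w)
    {C : (blockCrystal κ m n).graph.ConnectedComponent} {T T' : Tab κ (m * n)} (hT : T ∈ C.supp)
    (hT' : T' ∈ C.supp) (t : ℕ) (h : (Tab.blockPromotion m)^[t] T ∈ C.supp) :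
    (Tab.blockPromotion m)^[t] T' ∈ C.supp := by
  have hf : ∀ t a (x y : Tab κ (m * n)), (blockCrystal κ m n).e a x = some y →
      ∃ a', (blockCrystal κ m n).e a' ((Tab.blockPromotion m)^[t] x) =
        some ((Tab.blockPromotion m)^[t] y) := by
    intro t
    induction t with
    | zero => exact fun a x y h => ⟨a, h⟩
    | succ t ih =>
      intro a x y h
      obtain ⟨a', h'⟩ := ih a x y h
      rw [Function.iterate_succ_apply', Function.iterate_succ_apply']
      exact exists_e_blockPromotion hw h'
  rw [SimpleGraph.ConnectedComponent.mem_supp_iff] at h ⊢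
  rw [← h]
  exact (CrystalOps.eq_of_mem_supp
    (f := fun x => (blockCrystal κ m n).graph.connectedComponentMk ((Tab.blockPromotion m)^[t] x))
    (fun a x y hxy => by
      obtain ⟨a', h'⟩ := hf t a x y hxy
      exact CrystalOps.connectedComponentMk_eq h') hT hT').symm

/-- If a power of `j` fixes an element of a component, it maps this component to itself and hence
fixes its unique element of highest weight. -/
theorem iterate_blockPromotion_eq_of_mem (hw : ∀ r, r < κ.colLen 0 → κ.rowLen r = w)
    {C : (blockCrystal κ m n).graph.ConnectedComponent} {b T : Tab κ (m * n)} (hbC : b ∈ C.supp)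
    (hb : (blockCrystal κ m n).IsHighestWeight b) (hT : T ∈ C.supp) {t : ℕ}
    (h : (Tab.blockPromotion m)^[t] T = T) : (Tab.blockPromotion m)^[t] b = b := by
  refine isHighestWeight_unique (mem_supp_blockPromotion hw hT hbC t (by rwa [h])) hbC ?_ hb
  clear h
  induction t with
  | zero => exact hb
  | succ t ih =>
    rw [Function.iterate_succ_apply']
    exact isHighestWeight_blockPromotion hw ih

end Rectangle

theorem IsRectangular.exists_width {κ : YoungDiagram} (h : IsRectangular κ) :
    ∃ w, ∀ r, r < κ.colLen 0 → κ.rowLen r = w := by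
  have hpos : ∀ r, r < κ.colLen 0 → 0 < κ.rowLen r := fun r hr =>
    YoungDiagram.mem_iff_lt_rowLen.1 (YoungDiagram.mem_iff_lt_colLen.2 hr)
  exact ⟨κ.rowLen 0, fun r hr => h r 0 (hpos r hr) (hpos 0 (by omega))⟩

theorem mainTheorem5 (m n d : ℕ) (hd : 0 < d) (hdn : d ∣ n) (lam : YoungDiagram)
    (hparts : lam.colLen 0 ≤ m * n) (hrect : IsRectangular lam) :
    (∀ T : Tab lam (m * n),
      ((Tab.blockPromotion m)^[d] T).blocks m n = cyclicShift d (T.blocks m n)) ∧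
    (∀ C : (blockCrystal lam m n).graph.ConnectedComponent,
      ∃ b ∈ C.supp, (blockCrystal lam m n).IsHighestWeight b ∧
        (∀ b' ∈ C.supp, (blockCrystal lam m n).IsHighestWeight b' → b' = b) ∧
        ((Tab.blockPromotion m)^[d] b ≠ b →
          {T : C.supp | (Tab.blockPromotion m)^[d] T.1 = T.1} = ∅) ∧
        ((Tab.blockPromotion m)^[d] b = b →
          ∃ β : Fin d → YoungDiagram,
            (∀ l, (β l).colLen 0 ≤ m) ∧
            b.blocks m n = periodicTuple hd n (fun l => highestFilling (β l)) ∧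
            ∃ Φ : C.supp ≃ (∀ k : Fin n, Tab (periodicTuple hd n β k) m),
              (∀ T : C.supp, T.1.blocks m n = fun k => (Φ T k).toFilling) ∧
              (blockCrystal lam m n).IsComponentIso
                (productCrystal m (periodicTuple hd n β)) C Φ ∧
              Set.BijOn Φ
                {T : C.supp | (Tab.blockPromotion m)^[d] T.1 = T.1}
                {U | ∀ k k' : Fin n, (k : ℕ) ≡ k' [MOD d] →
                  (U k).toFilling = (U k').toFilling})) := by
  obtain ⟨w, hw⟩ := hrect.exists_width
  have hshift := fun T : Tab lam (m * n) => Tab.blocks_iterate_eq_cyclicShift hw T hdn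
  refine ⟨hshift, fun C => ?_⟩
  obtain ⟨b, hbC, hb⟩ := exists_highestWeight_mem C
  refine ⟨b, hbC, hb, fun b' hb'C hb' => isHighestWeight_unique hb'C hbC hb' hb, fun hne => ?_,
    fun hfix => ?_⟩
  · rw [Set.eq_empty_iff_forall_notMem]
    exact fun T hT => hne (iterate_blockPromotion_eq_of_mem hw hbC hb T.2 hT)
  · have hper : ∀ k : Fin n, b.blockShape k = periodicTuple hd n (fun l => b.blockShape l) k := by
      intro k
      have h1 := (cyclicShift_eq_self_iff hdn _).1 ((hshift b).symm.trans (by rw [hfix])) k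
        ⟨k % d, (Nat.mod_le k d).trans_lt k.2⟩ (Nat.mod_mod k d).symm
      exact congrArg Filling.shape h1
    obtain ⟨Φ, hΦ, hiso⟩ := exists_componentIso (C := C)
      (γ := periodicTuple hd n (fun l => b.blockShape l))
      fun T hT k => (blockShape_eq_of_mem hT hbC k).trans (hper k)
    refine ⟨fun l => b.blockShape l, fun l => b.colLen_blockShape_le l, ?_, Φ, hΦ, hiso, ?_⟩
    · funext k
      rw [blocks_of_isHighestWeight hb, hper]
      rfl
    · have hiff : ∀ T : C.supp, (Tab.blockPromotion m)^[d] T.1 = T.1 ↔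
          ∀ k k' : Fin n, (k : ℕ) ≡ k' [MOD d] → (Φ T k).toFilling = (Φ T k').toFilling := by
        intro T
        have h1 := cyclicShift_eq_self_iff hdn (T.1.blocks m n)
        rw [← hshift, hΦ T] at h1
        rw [← h1]
        refine ⟨fun h => by rw [h, hΦ T], fun h => ?_⟩
        exact eq_of_blocks_eq (mem_supp_blockPromotion hw hbC T.2 d (by rwa [hfix])) T.2
          (h.trans (hΦ T).symm)
      refine ⟨fun T hT => (hiff T).1 hT, Φ.injective.injOn, fun U hU => ?_⟩
      refine ⟨Φ.symm U, (hiff _).2 ?_, Φ.apply_symm_apply U⟩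
      rwa [Φ.apply_symm_apply]
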